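/- Let $d\ge 2$ be even, $L>0$, $M>0$, $r>0$, $Q\in\mathbb R$, and let $\gamma_1,\dots,\gamma_d$ be anti-hermitian complex $2^{d/2}\times2^{d/2}$ matrices with $\gamma_\mu\gamma_\nu+\gamma_\nu\gamma_\mu=-2\delta_{\mu\nu}I$; put $\gamma_{d+1}=i^{d/2}\gamma_1\cdots\gamma_d$. Let $A_1,\dots,A_d$ and $\xi$ be smooth real functions on $\mathbb T^d=(\mathbb R/L\mathbb Z)^d$ and $F_{\mu\nu}=\partial_\mu A_\nu-\partial_\nu A_\mu$. For $a=L/N$, $N$ a positive integer, let $\mathbb T^d_a=(a\mathbb Z/L\mathbb Z)^d$. On anti-periodic functions $u:\mathbb T^d_a\to\mathbb C^{2^{d/2}}$ (changing sign when a coordinate is increased by $L$), with inner product $(v,u)=a^d\sum_x(v(x),u(x))_x$, $(v(x),u(x))_x=\sum_s\bar v_s(x)u_s(x)$, put $$U_\mu(x)=\exp\Big(-iQ\int_0^aA_\mu(x+se_\mu)\,ds\Big),\quad (T_\mu u)(x)=U_\mu(x)u(x+ae_\mu),$$ $$D_\mu=\tfrac1{2a}(T_\mu-T_\mu^*),\quad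 W=-\sum_{\mu=1}^d(2I-T_\mu-T_\mu^*),\quad H=i\sum_{\mu=1}^d\gamma_\mu D_\mu+MI-\tfrac r{2a}W.$$ Let $\bar\psi_s(x),\psi_s(x)$ be independent generators of a Grassmann algebra, let $S=(\bar\psi,H\psi)$, where $(\bar\psi(x),\psi(x))_x=\sum_s\bar\psi_s(x)\psi_s(x)$, and for $\Phi$ in this algebra let $$\langle\Phi\rangle=\frac{\int\prod_x d\bar\psi(x)\,d\psi(x)\;e^{-S}\,\Phi}{\int\prod_x d\bar\psi(x)\,d\psi(x)\;e^{-S}}$$ with Grassmann integrals. Put $$J_\mu(x)=\tfrac12(\bar\psi(x),\gamma_{d+1}\gamma_\mu(T_\mu\psi)(x))_x+\tfrac12((T_\mu\bar\psi)(x),\gamma_{d+1}\gamma_\mu\psi(x))_x,$$ where $(T_\mu\bar\psi)(x)=\overline{U_\mu(x)}\,\bar\psi(x+ae_\mu)$, $$Y(x)=\tfrac1a\sum_{\mu=1}^d(J_\mu(x)-J_\mu(x-ae_\mu))-2Mi(\bar\psi(x),\gamma_{d+1}\psi(x))_x,\qquad Y(\xi)=a^d\sum_{x\in\mathbb T^d_a}\xi(x)Y(x).$$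 Let ${\mathbb T^d_a}^*$ be the set of $p\in\mathbb R^d$ with $p_\mu\in\frac{\pi}{L}(2\mathbb Z+1)$ for all $\mu$, where each $p_\mu$ is taken modulo $2\pi/a$ (so it has $N^d$ elements), and put $$G(p)=-2r^2a^d\sum_{\mu=1}^d(1-\cos ap_\mu)\;\prod_{\lambda=1}^d\cos ap_\lambda\;\frac{\frac{Ma}r+\sum_\nu(1-\cos ap_\nu)-\sum_\nu\frac{\sin^2ap_\nu}{\cos ap_\nu}}{\Big[\big(Ma+r\sum_\nu(1-\cos ap_\nu)\big)^2+\sum_\nu\sin^2ap_\nu\Big]^{d/2+1}},$$ where $\frac{\sin^2ap_\nu}{\cos ap_\nu}\prod_\lambda\cos ap_\lambda$ is read as $\sin^2ap_\nu\prod_{\lambda\ne\nu}\cos ap_\lambda$, and $$\kappa_a=\frac1{L^d}\sum_{p\in{\mathbb T^d_a}^*}G(p),\qquad \epsilon F^{d/2}(x)=\sum_{\mu_1,\nu_1,\dots,\mu_{d/2},\nu_{d/2}=1}^d\epsilon_{\mu_1\nu_1\dots\mu_{d/2}\nu_{d/2}}\prod_{j=1}^{d/2}F_{\mu_j\nu_j}(x),$$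 with $\epsilon$ the totally antisymmetric tensor. Then $$\lim_{a\to0}\Big(\langle Y(\xi)\rangle-i\,\kappa_a\,Q^{d/2}\,a^d\sum_{x\in\mathbb T^d_a}\xi(x)\,\epsilon F^{d/2}(x)\Big)=0,$$ where $a\to0$ through the values $a=L/N$, $N\in\mathbb N$. -/

import Mathlib

namespace LatticeFermion

noncomputable section

open scoped Kronecker Matrix ComplexConjugate

/-! ### The continuum torus, the gauge field and its field strength -/

/-- A smooth real function on the continuum torus `(ℝ / Lℤ)^d`, viewed as a smooth function on
`ℝ^d` which is `L`-periodic in every coordinate. -/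
def SmoothOnTorus {d : ℕ} (L : ℝ) (f : (Fin d → ℝ) → ℝ) : Prop :=
  ContDiff ℝ (⊤ : ℕ∞) f ∧ ∀ (μ : Fin d) (x : Fin d → ℝ), f (x + Pi.single μ L) = f x

/-- The field strength `F_{μν} = ∂_μ A_ν - ∂_ν A_μ`. -/
def fieldStrength {d : ℕ} (A : Fin d → (Fin d → ℝ) → ℝ) (μ ν : Fin d) (x : Fin d → ℝ) : ℝ :=
  fderiv ℝ (A ν) x (Pi.single μ 1) - fderiv ℝ (A μ) x (Pi.single ν 1)

open scoped Classical in
/-- The totally antisymmetric tensor `ε_{f 0, f 1, …, f (d-1)}`. -/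
def epsilon {d : ℕ} (f : Fin d → Fin d) : ℝ :=
  if h : Function.Bijective f then ((Equiv.Perm.sign (Equiv.ofBijective f h) : ℤ) : ℝ) else 0

/-- `εF^{d/2}(x) = ∑ ε_{μ₁ν₁…μ_{d/2}ν_{d/2}} ∏_j F_{μ_j ν_j}(x)` for `d = 2m`; the multi-index
`(μ₁, ν₁, …, μ_m, ν_m)` is the function `f`. -/
def epsilonF {m : ℕ} (A : Fin (2 * m) → (Fin (2 * m) → ℝ) → ℝ) (x : Fin (2 * m) → ℝ) : ℝ :=
  ∑ f : Fin (2 * m) → Fin (2 * m), epsilon f *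
    ∏ j : Fin m, fieldStrength A (f ⟨2 * j, by omega⟩) (f ⟨2 * j + 1, by omega⟩) x

/-! ### The lattice torus and the operators on it

The lattice spacing is `a = L / N`.  A site `x` is given by its coordinates `x μ ∈ {0, …, N-1}` in
units of `a`.  An anti-periodic field is given by its values on these representatives. -/

/-- The sites of the discrete torus with `N` points in each of the `d` directions. -/
abbrev Site (d N : ℕ) : Type := Fin d → Fin N

/-- The index set of the components `u_s(x)` of a lattice spinor field, for `d = 2m`. -/
abbrev Comp (m N : ℕ) : Type := Site (2 * m) N × Fin (2 ^ m)

/-- The lattice spacing `a = L / N`. -/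
def spacing (L : ℝ) (N : ℕ) : ℝ := L / N

/-- The point of `ℝ^d` represented by a site. -/
def position {d : ℕ} (L : ℝ) (N : ℕ) (x : Site d N) : Fin d → ℝ :=
  fun μ => spacing L N * ((x μ : ℕ) : ℝ)

/-- The neighbour `x + a e_μ`. -/
def next {d N : ℕ} [NeZero N] (x : Site d N) (μ : Fin d) : Site d N :=
  Function.update x μ (x μ + 1)

/-- The neighbour `x - a e_μ`. -/
def prev {d N : ℕ} [NeZero N] (x : Site d N) (μ : Fin d) : Site d N :=
  Function.update x μ (x μ - 1)

/-- The sign by which an anti-periodic field changes when the step from `x` to `x + a e_μ` leaves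
the set of representatives. -/
def wrapSign {d N : ℕ} (x : Site d N) (μ : Fin d) : ℂ :=
  if (x μ : ℕ) + 1 = N then -1 else 1

/-- The link variable `U_μ(x) = exp(-iQ ∫₀^a A_μ(x + s e_μ) ds)`. -/
def link {d : ℕ} (L Q : ℝ) (A : Fin d → (Fin d → ℝ) → ℝ) (N : ℕ) (μ : Fin d) (x : Site d N) : ℂ :=
  Complex.exp (-Complex.I * Q *
    ((∫ s in (0 : ℝ)..spacing L N, A μ (position L N x + Pi.single μ s) : ℝ) : ℂ))

/-- The covariant translation `(T_μ u)(x) = U_μ(x) u(x + a e_μ)` on scalar anti-periodic fields. -/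
def translation {d : ℕ} (L Q : ℝ) (A : Fin d → (Fin d → ℝ) → ℝ) (N : ℕ) [NeZero N] (μ : Fin d) :
    Matrix (Site d N) (Site d N) ℂ :=
  Matrix.of fun x y => if y = next x μ then link L Q A N μ x * wrapSign x μ else 0

/-- `D_μ = (T_μ - T_μ^*) / (2a)`. -/
def derivOp {d : ℕ} (L Q : ℝ) (A : Fin d → (Fin d → ℝ) → ℝ) (N : ℕ) [NeZero N] (μ : Fin d) :
    Matrix (Site d N) (Site d N) ℂ :=
  (1 / (2 * (spacing L N : ℂ))) • (translation L Q A N μ - (translation L Q A N μ)ᴴ)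

/-- The Wilson operator `W = -∑_μ (2 - T_μ - T_μ^*)`. -/
def wilsonOp {d : ℕ} (L Q : ℝ) (A : Fin d → (Fin d → ℝ) → ℝ) (N : ℕ) [NeZero N] :
    Matrix (Site d N) (Site d N) ℂ :=
  -∑ μ : Fin d, ((2 : ℂ) • (1 : Matrix (Site d N) (Site d N) ℂ)
    - translation L Q A N μ - (translation L Q A N μ)ᴴ)

/-- The lattice Dirac operator `∑_μ γ_μ D_μ` on spinor fields. -/
def diracOp {m : ℕ} (L Q : ℝ) (A : Fin (2 * m) → (Fin (2 * m) → ℝ) → ℝ)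
    (γ : Fin (2 * m) → Matrix (Fin (2 ^ m)) (Fin (2 ^ m)) ℂ) (N : ℕ) [NeZero N] :
    Matrix (Comp m N) (Comp m N) ℂ :=
  ∑ μ : Fin (2 * m), derivOp L Q A N μ ⊗ₖ γ μ

/-- The operator `i D̸ + M I - (r / 2a) W` of the fermion action. -/
def actionOp {m : ℕ} (L M r Q : ℝ) (A : Fin (2 * m) → (Fin (2 * m) → ℝ) → ℝ)
    (γ : Fin (2 * m) → Matrix (Fin (2 ^ m)) (Fin (2 ^ m)) ℂ) (N : ℕ) [NeZero N] :
    Matrix (Comp m N) (Comp m N) ℂ :=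
  Complex.I • diracOp L Q A γ N + (M : ℂ) • (1 : Matrix (Comp m N) (Comp m N) ℂ)
    - ((r : ℂ) / (2 * (spacing L N : ℂ))) •
      (wilsonOp L Q A N ⊗ₖ (1 : Matrix (Fin (2 ^ m)) (Fin (2 ^ m)) ℂ))

/-- The chirality `γ_{d+1} = i^{d/2} γ_1 γ_2 ⋯ γ_d`. -/
def chirality {m : ℕ} (γ : Fin (2 * m) → Matrix (Fin (2 ^ m)) (Fin (2 ^ m)) ℂ) :
    Matrix (Fin (2 ^ m)) (Fin (2 ^ m)) ℂ :=
  Complex.I ^ m • (List.ofFn γ).prod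

/-- The operator `S ⊗ I` on lattice spinor fields given by a matrix `S` acting on the fibre. -/
def spinOp {m : ℕ} (N : ℕ) (S : Matrix (Fin (2 ^ m)) (Fin (2 ^ m)) ℂ) :
    Matrix (Comp m N) (Comp m N) ℂ :=
  (1 : Matrix (Site (2 * m) N) (Site (2 * m) N) ℂ) ⊗ₖ S

/-- The covariant translation on lattice spinor fields. -/
def spinTranslation {m : ℕ} (L Q : ℝ) (A : Fin (2 * m) → (Fin (2 * m) → ℝ) → ℝ)
    (N : ℕ) [NeZero N] (μ : Fin (2 * m)) : Matrix (Comp m N) (Comp m N) ℂ :=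
  translation L Q A N μ ⊗ₖ (1 : Matrix (Fin (2 ^ m)) (Fin (2 ^ m)) ℂ)

/-! ### Grassmann integration -/

/-- The Grassmann integral over all generators, indexed by a finite type `G`: the linear functional
on the exterior algebra that vanishes on products of fewer than `card G` generators and is `1` on
the product of all generators, taken in some fixed order.  (A change of the order changes the
functional by a sign, which cancels in the quotient defining the vacuum expectation.) -/
def berezin (G : Type) [Fintype G] [DecidableEq G] : ExteriorAlgebra ℂ (G → ℂ) →ₗ[ℂ] ℂ :=
  ExteriorAlgebra.liftAlternating fun k =>
    if h : k = Fintype.card G then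
      (Pi.basisFun ℂ G).det.domDomCongr ((Fintype.equivFin G).trans (finCongr h.symm))
    else 0

/-- The Grassmann algebra generated by the `ψ̄_s(x)` (left summand) and `ψ_s(x)` (right summand). -/
abbrev Grassmann (m N : ℕ) : Type := ExteriorAlgebra ℂ (Comp m N ⊕ Comp m N → ℂ)

/-- The field `ψ̄`. -/
def psiBar (m N : ℕ) (i : Comp m N) : Grassmann m N :=
  ExteriorAlgebra.ι ℂ (Pi.single (Sum.inl i) 1)

/-- The field `ψ`. -/
def psi (m N : ℕ) (i : Comp m N) : Grassmann m N :=
  ExteriorAlgebra.ι ℂ (Pi.single (Sum.inr i) 1)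

/-- The action of an operator on `ψ`-type (linear) Grassmann fields. -/
def act {m N : ℕ} (K : Matrix (Comp m N) (Comp m N) ℂ) (u : Comp m N → Grassmann m N) :
    Comp m N → Grassmann m N :=
  fun i => ∑ j, K i j • u j

/-- The action of an operator on `ψ̄`-type (conjugate) Grassmann fields: as `ψ̄` occupies the
conjugate-linear slot of the inner product, the complex conjugate matrix acts on its components. -/
def actBar {m N : ℕ} (K : Matrix (Comp m N) (Comp m N) ℂ) (v : Comp m N → Grassmann m N) :
    Comp m N → Grassmann m N :=
  fun i => ∑ j, conj (K i j) • v j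

/-- The fibre pairing `(v(x), u(x))_x = ∑_s v_s(x) u_s(x)` of a `ψ̄`-type and a `ψ`-type field. -/
def fibrePairing {m N : ℕ} (v u : Comp m N → Grassmann m N) (x : Site (2 * m) N) :
    Grassmann m N :=
  ∑ s : Fin (2 ^ m), v (x, s) * u (x, s)

/-- The fermion action `S(ψ̄, ψ) = a^d ∑_x (ψ̄(x), ((iD̸ + M - (r/2a) W) ψ)(x))_x`. -/
def action {m : ℕ} (L M r Q : ℝ) (A : Fin (2 * m) → (Fin (2 * m) → ℝ) → ℝ)
    (γ : Fin (2 * m) → Matrix (Fin (2 ^ m)) (Fin (2 ^ m)) ℂ) (N : ℕ) [NeZero N] :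
    Grassmann m N :=
  ((spacing L N : ℂ) ^ (2 * m)) • ∑ x : Site (2 * m) N,
    fibrePairing (psiBar m N) (act (actionOp L M r Q A γ N) (psi m N)) x

/-- The vacuum expectation `⟨Φ⟩ = Z⁻¹ ∫ ∏ dψ̄ dψ exp(-S) Φ`, `Z = ∫ ∏ dψ̄ dψ exp(-S)`.  The action
is nilpotent, so the exponential is a finite sum. -/
def expectation {m : ℕ} (L M r Q : ℝ) (A : Fin (2 * m) → (Fin (2 * m) → ℝ) → ℝ)
    (γ : Fin (2 * m) → Matrix (Fin (2 ^ m)) (Fin (2 ^ m)) ℂ) (N : ℕ) [NeZero N]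
    (Φ : Grassmann m N) : ℂ :=
  berezin (Comp m N ⊕ Comp m N) (IsNilpotent.exp (-action L M r Q A γ N) * Φ) /
    berezin (Comp m N ⊕ Comp m N) (IsNilpotent.exp (-action L M r Q A γ N))

/-! ### The chiral current -/

/-- The lattice chiral current
`J_μ(x) = ½ (ψ̄(x), γ_{d+1} γ_μ (T_μ ψ)(x))_x + ½ ((T_μ ψ̄)(x), γ_{d+1} γ_μ ψ(x))_x`. -/
def current {m : ℕ} (L Q : ℝ) (A : Fin (2 * m) → (Fin (2 * m) → ℝ) → ℝ)
    (γ : Fin (2 * m) → Matrix (Fin (2 ^ m)) (Fin (2 ^ m)) ℂ) (N : ℕ) [NeZero N]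
    (μ : Fin (2 * m)) (x : Site (2 * m) N) : Grassmann m N :=
  (1 / 2 : ℂ) • fibrePairing (psiBar m N)
      (act (spinOp N (chirality γ * γ μ)) (act (spinTranslation L Q A N μ) (psi m N))) x
    + (1 / 2 : ℂ) • fibrePairing (actBar (spinTranslation L Q A N μ) (psiBar m N))
      (act (spinOp N (chirality γ * γ μ)) (psi m N)) x

/-- The mass-corrected divergence
`Y(x) = (1/a) ∑_μ (J_μ(x) - J_μ(x - a e_μ)) - 2 M i (ψ̄(x), γ_{d+1} ψ(x))_x`. -/
def divergence {m : ℕ} (L M Q : ℝ) (A : Fin (2 * m) → (Fin (2 * m) → ℝ) → ℝ)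
    (γ : Fin (2 * m) → Matrix (Fin (2 ^ m)) (Fin (2 ^ m)) ℂ) (N : ℕ) [NeZero N]
    (x : Site (2 * m) N) : Grassmann m N :=
  (1 / (spacing L N : ℂ)) • ∑ μ : Fin (2 * m),
      (current L Q A γ N μ x - current L Q A γ N μ (prev x μ))
    - (2 * (M : ℂ) * Complex.I) •
      fibrePairing (psiBar m N) (act (spinOp N (chirality γ)) (psi m N)) x

/-- The smeared divergence `Y(ξ) = a^d ∑_x ξ(x) Y(x)`. -/
def smearedDivergence {m : ℕ} (L M Q : ℝ) (A : Fin (2 * m) → (Fin (2 * m) → ℝ) → ℝ)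
    (γ : Fin (2 * m) → Matrix (Fin (2 ^ m)) (Fin (2 ^ m)) ℂ) (ξ : (Fin (2 * m) → ℝ) → ℝ)
    (N : ℕ) [NeZero N] : Grassmann m N :=
  ((spacing L N : ℂ) ^ (2 * m)) • ∑ x : Site (2 * m) N,
    ((ξ (position L N x) : ℝ) : ℂ) • divergence L M Q A γ N x

/-! ### The coefficient -/

/-- The momentum function `G(p)` at lattice spacing `a`, for `d = 2m`.  The factor
`∏ cos(a p_l)` has been multiplied into the sum over `ν`, so that the terms
`sin²(a p_ν) / cos(a p_ν) · ∏_l cos(a p_l)` read `sin²(a p_ν) ∏_{l ≠ ν} cos(a p_l)`, also where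
`cos(a p_ν) = 0`. -/
def momentumG (m : ℕ) (M r a : ℝ) (p : Fin (2 * m) → ℝ) : ℝ :=
  -2 * r ^ 2 * a ^ (2 * m) * (∑ μ, (1 - Real.cos (a * p μ))) *
    (((M * a / r + ∑ ν, (1 - Real.cos (a * p ν))) * ∏ l, Real.cos (a * p l)
        - ∑ ν, Real.sin (a * p ν) ^ 2 * ∏ l ∈ Finset.univ.erase ν, Real.cos (a * p l)) /
      ((M * a + r * ∑ ν, (1 - Real.cos (a * p ν))) ^ 2 + ∑ ν, Real.sin (a * p ν) ^ 2) ^ (m + 1))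

/-- `κ_a = L^{-d} ∑_p G(p)`.  The momenta `p_μ = (2 k_μ + 1) π / L`, `k_μ ∈ ℤ`, form a discrete torus
of period `2π / a = 2πN / L`; the representatives `0 ≤ k_μ < N` are used. -/
def kappa (m : ℕ) (L M r : ℝ) (N : ℕ) : ℝ :=
  1 / L ^ (2 * m) * ∑ k : Fin (2 * m) → Fin N,
    momentumG m M r (spacing L N) fun μ => (2 * ((k μ : ℕ) : ℝ) + 1) / L * Real.pi

end

end LatticeFermion

/-! The starting point is a Ward identity. Smeared against ξ, the divergence is a bilinear form
ψ̄Kψ, and Gaussian Grassmann integration gives ⟨ψ̄Kψ⟩ = -tr(H⁻¹K) (`berezin_exp_mul_bilinear`). With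
Ξ multiplication by ξ and X = Ξ ⊗ γ_{d+1}, the fact that γ_{d+1} anticommutes with every γ_μ turns K
into -i(HX + XH) minus a Wilson term. The anticommutator contributes a multiple of tr X, which is 0
because γ_{d+1} is traceless. What is left is i(r/2a) tr(H⁻¹ (WΞ + ΞW) ⊗ γ_{d+1})
(`expectation_smearedDivergence`).

This trace is computed in the basis of anti-periodic plane waves with lattice momentum q = ap. On a
wave times a smooth function, aH acts through an operator `hSym` on symbols in (a, q, x). By
`dirac_square`, `hSym * hSymAdj` is the scalar ρ(a,q)² = `freeSq` plus a remainder, and the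
remainder splits as `scalarSym + curvSym`. Inverting iteratively gives a finite Neumann series for
H⁻¹ (`actionOp_inv_mul_waveMap`).

Each term is weighed by powers a^t ρ^n and by the number j of gamma matrices. `scalarSym` has order
(1,1,0), `curvSym` has order (2,0,2), and the Wilson source has order (0,2,0). Two facts decide
which terms survive. The trace against γ_{d+1} kills products of fewer than d = 2m gamma matrices,
so m curvature factors are needed and these already cost a^{2m}. And Ma ≤ ρ, so powers of a may be
traded for powers of ρ. Hence only the term with exactly m curvature factors, all at leading order,
escapes an extra factor a (`hSymAdj_remSym_pow_mem`). The tail of the series is controlled without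
perturbation theory by Re(u, Hu) ≥ M‖u‖², which bounds H⁻¹ by 1/M.

The leading trace is an exact Clifford computation (`CliffordRel.trace_main`). It produces both the
numerator of G and εF^{d/2}, and the sum over modes produces κ_a (`sum_leading`).

The total error is at most a constant times ∑_q a^{d+1}/ρ^d. Bounding ρ below by a multiple of
|sin(q_μ/2)|, once for each direction μ, factorizes this sum into d one-dimensional harmonic sums,
so it is O((1 + log N)^d / N). -/

namespace LatticeFermion
noncomputable section
open scoped Kronecker Matrix ComplexConjugate

/-! ### Gaussian Grassmann integrals and integration by parts -/

section Berezin

open CliffordAlgebra (contractLeft)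

variable {G : Type} [Fintype G] [DecidableEq G]

/-- The interior product with `d` lowers the degree by one. -/
theorem contractLeft_mem_exteriorPower {V : Type*} [AddCommGroup V] [Module ℂ V]
    (d : Module.Dual ℂ V) (k : ℕ) (x : ExteriorAlgebra ℂ V) (hx : x ∈ ⋀[ℂ]^(k + 1) V) :
    contractLeft (Q := 0) d x ∈ ⋀[ℂ]^k V := by
  induction k generalizing x with
  | zero =>
    rw [← ExteriorAlgebra.ιMulti_span_fixedDegree] at hx
    induction hx using Submodule.span_induction with
    | mem x h =>
      obtain ⟨v, rfl⟩ := h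
      rw [ExteriorAlgebra.ιMulti_succ_apply, ExteriorAlgebra.ιMulti_zero_apply, mul_one]
      erw [CliffordAlgebra.contractLeft_ι]
      simp [Submodule.one_eq_range]
    | zero => simp
    | add x y _ _ hx hy => rw [map_add]; exact add_mem hx hy
    | smul c x _ hx => rw [map_smul]; exact Submodule.smul_mem _ _ hx
  | succ k ih =>
    rw [← ExteriorAlgebra.ιMulti_span_fixedDegree] at hx
    induction hx using Submodule.span_induction with
    | mem x h =>
      obtain ⟨v, rfl⟩ := h
      rw [ExteriorAlgebra.ιMulti_succ_apply]
      erw [CliffordAlgebra.contractLeft_ι_mul]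
      have h1 : ExteriorAlgebra.ιMulti ℂ (k + 1) (Matrix.vecTail v) ∈ ⋀[ℂ]^(k + 1) V :=
        ExteriorAlgebra.ιMulti_range ℂ (k + 1) ⟨_, rfl⟩
      refine sub_mem (Submodule.smul_mem _ _ h1) ?_
      have h2 := ih _ h1
      change _ ∈ LinearMap.range (ExteriorAlgebra.ι ℂ) ^ (k + 1)
      rw [pow_succ']
      exact Submodule.mul_mem_mul ⟨v 0, rfl⟩ h2
    | zero => simp
    | add x y _ _ hx hy => rw [map_add]; exact add_mem hx hy
    | smul c x _ hx => rw [map_smul]; exact Submodule.smul_mem _ _ hx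

theorem berezin_ιMulti_of_ne {k : ℕ} (hk : k ≠ Fintype.card G) (v : Fin k → G → ℂ) :
    berezin G (ExteriorAlgebra.ιMulti ℂ k v) = 0 := by
  rw [berezin, ExteriorAlgebra.liftAlternating_apply_ιMulti, dif_neg hk]
  rfl

theorem berezin_eq_zero_of_mem {k : ℕ} (hk : k ≠ Fintype.card G) {x : ExteriorAlgebra ℂ (G → ℂ)}
    (hx : x ∈ ⋀[ℂ]^k (G → ℂ)) : berezin G x = 0 := by
  rw [← ExteriorAlgebra.ιMulti_span_fixedDegree] at hx
  induction hx using Submodule.span_induction with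
  | mem x h => obtain ⟨v, rfl⟩ := h; exact berezin_ιMulti_of_ne hk v
  | zero => simp
  | add x y _ _ hx hy => rw [map_add, hx, hy, add_zero]
  | smul c x _ hx => rw [map_smul, hx, smul_zero]

/-- Every linear functional is determined on the exterior powers. -/
theorem exterior_linear_eq_zero {V W : Type*} [AddCommGroup V] [Module ℂ V] [AddCommGroup W]
    [Module ℂ W] (f : ExteriorAlgebra ℂ V →ₗ[ℂ] W)
    (h : ∀ k, ∀ x ∈ ⋀[ℂ]^k V, f x = 0) (x : ExteriorAlgebra ℂ V) : f x = 0 := by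
  have hf : f = 0 := by
    apply ExteriorAlgebra.lhom_ext
    intro k
    ext v
    exact h k _ (ExteriorAlgebra.ιMulti_range ℂ k ⟨v, rfl⟩)
  rw [hf]; rfl

/-- The Grassmann integral of an interior product vanishes. -/
theorem berezin_contractLeft (d : Module.Dual ℂ (G → ℂ)) (x : ExteriorAlgebra ℂ (G → ℂ)) :
    berezin G (contractLeft (Q := 0) d x) = 0 := by
  refine exterior_linear_eq_zero (berezin G ∘ₗ contractLeft (Q := 0) d) (fun k x hx => ?_) x
  rw [LinearMap.comp_apply]
  -- Only degree one above the top could be lowered into the top degree, and there the exterior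
  -- power is zero because the vectors are linearly dependent.
  by_cases hk : k = Fintype.card G + 1
  · rw [← ExteriorAlgebra.ιMulti_span_fixedDegree] at hx
    induction hx using Submodule.span_induction with
    | mem x h =>
      obtain ⟨v, rfl⟩ := h
      rw [AlternatingMap.map_linearDependent, map_zero, map_zero]
      intro hv
      have := hv.fintype_card_le_finrank
      simp [hk] at this
    | zero => simp
    | add x y _ _ hx hy => rw [map_add, map_add, hx, hy, add_zero]
    | smul c x _ hx => rw [map_smul, map_smul, hx, smul_zero]
  · cases k with
    | zero =>
      have : x ∈ (1 : Submodule ℂ (ExteriorAlgebra ℂ (G → ℂ))) := by simpa using hx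
      rw [Submodule.mem_one] at this
      obtain ⟨c, rfl⟩ := this
      erw [CliffordAlgebra.contractLeft_algebraMap]
      simp
    | succ k =>
      exact berezin_eq_zero_of_mem (k := k) (by omega) (contractLeft_mem_exteriorPower d k x hx)

theorem berezin_top_ne_zero : ∃ x, berezin G x ≠ 0 := by
  refine ⟨ExteriorAlgebra.ιMulti ℂ (Fintype.card G)
    (fun i => Pi.single ((Fintype.equivFin G).symm i) 1), ?_⟩
  rw [berezin, ExteriorAlgebra.liftAlternating_apply_ιMulti, dif_pos rfl]
  rw [AlternatingMap.domDomCongr_apply]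
  have : ((fun i => Pi.single ((Fintype.equivFin G).symm i) (1 : ℂ)) ∘
      ((Fintype.equivFin G).trans (finCongr rfl)) : G → G → ℂ) = ⇑(Pi.basisFun ℂ G) := by
    ext g
    simp
  erw [this, Module.Basis.det_self]
  exact one_ne_zero

/-- The span of the products of two generators. -/
def quadratics (V : Type*) [AddCommGroup V] [Module ℂ V] : Submodule ℂ (ExteriorAlgebra ℂ V) :=
  Submodule.span ℂ {x | ∃ v w : V, x = ExteriorAlgebra.ι ℂ v * ExteriorAlgebra.ι ℂ w}

variable {V : Type*} [AddCommGroup V] [Module ℂ V]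

/-- Even elements are central: passing a generator through a product of two generators produces two
signs. Hence the exponential of a quadratic form can be differentiated as in the commutative case.
-/
theorem quadratics_commute {s : ExteriorAlgebra ℂ V} (hs : s ∈ quadratics V)
    (x : ExteriorAlgebra ℂ V) : Commute s x := by
  induction hs using Submodule.span_induction with
  | mem s h =>
    obtain ⟨v, w, rfl⟩ := h
    induction x using ExteriorAlgebra.induction with
    | algebraMap r => exact (Algebra.commutes r _).symm
    | ι u =>
      have hvu : ExteriorAlgebra.ι ℂ v * ExteriorAlgebra.ι ℂ u =
        -(ExteriorAlgebra.ι ℂ u * ExteriorAlgebra.ι ℂ v) :=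
        eq_neg_of_add_eq_zero_left (ExteriorAlgebra.ι_add_mul_swap v u)
      have hwu : ExteriorAlgebra.ι ℂ w * ExteriorAlgebra.ι ℂ u =
        -(ExteriorAlgebra.ι ℂ u * ExteriorAlgebra.ι ℂ w) :=
        eq_neg_of_add_eq_zero_left (ExteriorAlgebra.ι_add_mul_swap w u)
      rw [commute_iff_eq, mul_assoc, hwu, mul_neg, ← mul_assoc, hvu, neg_mul, neg_neg, mul_assoc]
    | mul a b ha hb => exact ha.mul_right hb
    | add a b ha hb => exact ha.add_right hb
  | zero => exact Commute.zero_left x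
  | add a b _ _ ha hb => exact ha.add_left hb
  | smul c a _ ha => exact ha.smul_left c

theorem quadratics_isNilpotent {s : ExteriorAlgebra ℂ V} (hs : s ∈ quadratics V) :
    IsNilpotent s := by
  induction hs using Submodule.span_induction with
  | mem s h =>
    obtain ⟨v, w, rfl⟩ := h
    refine ⟨2, ?_⟩
    have hwv : ExteriorAlgebra.ι ℂ w * ExteriorAlgebra.ι ℂ v =
      -(ExteriorAlgebra.ι ℂ v * ExteriorAlgebra.ι ℂ w) :=
      eq_neg_of_add_eq_zero_left (ExteriorAlgebra.ι_add_mul_swap w v)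
    rw [sq, mul_assoc, ← mul_assoc (ExteriorAlgebra.ι ℂ w), hwv, neg_mul, mul_neg, mul_assoc,
      ExteriorAlgebra.ι_sq_zero]
    simp
  | zero => exact IsNilpotent.zero
  | add a b ha _ iha ihb => exact (quadratics_commute ha b).isNilpotent_add iha ihb
  | smul c a _ ha => exact ha.smul c

/-- The interior product is an antiderivation; on an even factor the sign disappears and the plain
Leibniz rule remains. -/
theorem contractLeft_quadratic_mul (d : Module.Dual ℂ V) {s : ExteriorAlgebra ℂ V}
    (hs : s ∈ quadratics V) (x : ExteriorAlgebra ℂ V) :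
    contractLeft (Q := 0) d (s * x) =
      contractLeft (Q := 0) d s * x + s * contractLeft (Q := 0) d x := by
  induction hs using Submodule.span_induction with
  | mem s h =>
    obtain ⟨v, w, rfl⟩ := h
    rw [mul_assoc]
    have h1 : ∀ (u : V) (y : ExteriorAlgebra ℂ V),
      contractLeft (Q := 0) d (ExteriorAlgebra.ι ℂ u * y) =
        d u • y - ExteriorAlgebra.ι ℂ u * contractLeft (Q := 0) d y := fun u y =>
      CliffordAlgebra.contractLeft_ι_mul d u y
    have h2 : ∀ u : V, contractLeft (Q := 0) d (ExteriorAlgebra.ι ℂ u) =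
      algebraMap ℂ (ExteriorAlgebra ℂ V) (d u) := fun u => CliffordAlgebra.contractLeft_ι 0 d u
    rw [h1, h1, h1, h2]
    rw [Algebra.algebraMap_eq_smul_one]
    simp only [mul_sub, sub_mul, smul_mul_assoc, mul_smul_comm, mul_one, mul_assoc]
    abel
  | zero => simp
  | add a b _ _ ha hb => simp only [add_mul, map_add, ha, hb]; abel
  | smul c a _ ha => simp only [smul_mul_assoc, map_smul, ha, smul_add]

theorem contractLeft_quadratic_pow_mul (d : Module.Dual ℂ V) {s : ExteriorAlgebra ℂ V}
    (hs : s ∈ quadratics V) (n : ℕ) (x : ExteriorAlgebra ℂ V) :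
    contractLeft (Q := 0) d (s ^ (n + 1) * x) =
      (n + 1 : ℂ) • (s ^ n * (contractLeft (Q := 0) d s * x))
        + s ^ (n + 1) * contractLeft (Q := 0) d x := by
  induction n generalizing x with
  | zero => simp [contractLeft_quadratic_mul d hs]
  | succ n ih =>
    rw [pow_succ s (n + 1), mul_assoc, ih, contractLeft_quadratic_mul d hs, mul_add]
    have h1 : contractLeft (Q := 0) d s * (s * x) = s * (contractLeft (Q := 0) d s * x) := by
      rw [← mul_assoc, ← mul_assoc, (quadratics_commute hs _).eq]
    rw [h1, ← mul_assoc (s ^ n) s, ← pow_succ, ← add_assoc, ← mul_assoc (s ^ (n + 1)) s,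
      ← pow_succ]
    congr 1
    rw [Nat.cast_add, Nat.cast_one, add_smul (n + 1 : ℂ) 1, one_smul]

theorem contractLeft_exp_mul {X : Type*} (d : Module.Dual ℂ (X → ℂ)) {s : ExteriorAlgebra ℂ (X → ℂ)}
    (hs : s ∈ quadratics (X → ℂ)) (x : ExteriorAlgebra ℂ (X → ℂ)) :
    contractLeft (Q := 0) d (IsNilpotent.exp s * x) =
      IsNilpotent.exp s * (contractLeft (Q := 0) d s * x)
        + IsNilpotent.exp s * contractLeft (Q := 0) d x := by
  obtain ⟨k, hk⟩ := quadratics_isNilpotent hs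
  -- The exponential is written with two truncations. Differentiation lowers the power of s by one,
  -- so the series of length k + 1 yields the one of length k.
  have hk1 : s ^ (k + 1) = 0 := by rw [pow_succ, hk, zero_mul]
  have e1 := IsNilpotent.exp_eq_sum hk
  have e2 := IsNilpotent.exp_eq_sum hk1
  have q : ∀ (n : ℕ) (y : ExteriorAlgebra ℂ (X → ℂ)), ((n.factorial : ℚ)⁻¹) • y =
      ((n.factorial : ℂ)⁻¹) • y := by
    intro n y
    rw [← Rat.cast_smul_eq_qsmul ℂ]
    simp
  simp only [q] at e1 e2
  have key : contractLeft (Q := 0) d (IsNilpotent.exp s * x) =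
      (∑ i ∈ Finset.range k, ((i.factorial : ℂ)⁻¹) • s ^ i) * (contractLeft (Q := 0) d s * x)
        + (∑ i ∈ Finset.range (k + 1), ((i.factorial : ℂ)⁻¹) • s ^ i) *
          contractLeft (Q := 0) d x := by
    rw [e2, Finset.sum_range_succ', Finset.sum_mul, add_mul, add_mul, map_add,
      Finset.sum_mul, Finset.sum_mul, map_sum, ← add_assoc, ← Finset.sum_add_distrib]
    congr 1
    · refine Finset.sum_congr rfl fun i _ => ?_
      rw [smul_mul_assoc, map_smul, contractLeft_quadratic_pow_mul d hs, smul_add, smul_smul,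
        smul_mul_assoc, smul_mul_assoc, Nat.factorial_succ]
      congr 2
      have h1 : ((i : ℂ) + 1) ≠ 0 := Nat.cast_add_one_ne_zero i
      push_cast
      field_simp
    · simp
  rw [key, ← e1, ← e2]

/-- Integration by parts for Gaussian Grassmann integrals. -/
theorem berezin_schwinger_dyson (d : Module.Dual ℂ (G → ℂ)) {s : ExteriorAlgebra ℂ (G → ℂ)}
    (hs : s ∈ quadratics (G → ℂ)) (x : ExteriorAlgebra ℂ (G → ℂ)) :
    berezin G (IsNilpotent.exp s * (contractLeft (Q := 0) d s * x)) =
      -berezin G (IsNilpotent.exp s * contractLeft (Q := 0) d x) := by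
  have h := berezin_contractLeft d (IsNilpotent.exp s * x)
  rw [contractLeft_exp_mul d hs, map_add] at h
  exact eq_neg_of_add_eq_zero_left h

/-- A Gaussian integral with a nondegenerate quadratic form does not vanish. -/
theorem berezin_exp_ne_zero {s : ExteriorAlgebra ℂ (G → ℂ)} (hs : s ∈ quadratics (G → ℂ))
    (hnd : ∀ v : G → ℂ, ∃ d : Module.Dual ℂ (G → ℂ),
      contractLeft (Q := 0) d s = ExteriorAlgebra.ι ℂ v) :
    berezin G (IsNilpotent.exp s) ≠ 0 := by
  intro h0
  -- If the integral of e^s vanished, so would every moment. By nondegeneracy the first generator of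
  -- a product is d⌟s for some d, and integration by parts lowers the degree by two.
  have key : ∀ k, ∀ x ∈ ⋀[ℂ]^k (G → ℂ), berezin G (IsNilpotent.exp s * x) = 0 := by
    intro k
    induction k using Nat.strong_induction_on with
    | _ k ih =>
      intro x hx
      cases k with
      | zero =>
        have : x ∈ (1 : Submodule ℂ (ExteriorAlgebra ℂ (G → ℂ))) := by simpa using hx
        rw [Submodule.mem_one] at this
        obtain ⟨c, rfl⟩ := this
        rw [Algebra.algebraMap_eq_smul_one, mul_smul_comm, mul_one, map_smul, h0, smul_zero]
      | succ k =>
        rw [← ExteriorAlgebra.ιMulti_span_fixedDegree] at hx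
        induction hx using Submodule.span_induction with
        | mem x h =>
          obtain ⟨v, rfl⟩ := h
          rw [ExteriorAlgebra.ιMulti_succ_apply]
          obtain ⟨d, hd⟩ := hnd (v 0)
          rw [← hd, berezin_schwinger_dyson d hs, neg_eq_zero]
          have h1 : ExteriorAlgebra.ιMulti ℂ k (Matrix.vecTail v) ∈ ⋀[ℂ]^k (G → ℂ) :=
            ExteriorAlgebra.ιMulti_range ℂ k ⟨_, rfl⟩
          cases k with
          | zero =>
            rw [ExteriorAlgebra.ιMulti_zero_apply]
            erw [CliffordAlgebra.contractLeft_one]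
            simp
          | succ k => exact ih k (by omega) _ (contractLeft_mem_exteriorPower d k _ h1)
        | zero => simp
        | add x y _ _ hx hy => rw [mul_add, map_add, hx, hy, add_zero]
        | smul c x _ hx => rw [mul_smul_comm, map_smul, hx, smul_zero]
  obtain ⟨t, ht⟩ := berezin_top_ne_zero (G := G)
  apply ht
  -- Choosing the moment e^{-s}t cancels the weight and leaves the unweighted integral of t, which
  -- is not zero.
  have := exterior_linear_eq_zero (berezin G ∘ₗ LinearMap.mulLeft ℂ (IsNilpotent.exp s))
    key (IsNilpotent.exp (-s) * t)
  rw [LinearMap.comp_apply, LinearMap.mulLeft_apply, ← mul_assoc,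
    IsNilpotent.exp_mul_exp_neg_self (quadratics_isNilpotent hs), one_mul] at this
  exact this

end Berezin

/-! ### The two-point function -/

section Bilinear

open CliffordAlgebra (contractLeft)

variable {I : Type} [Fintype I] [DecidableEq I]

/-- The bilinear expression `∑ ψ̄_i K_{ij} ψ_j` in the generators of a Grassmann algebra. -/
def bilinear : Matrix I I ℂ →ₗ[ℂ] ExteriorAlgebra ℂ (I ⊕ I → ℂ) where
  toFun K := ∑ i, ∑ j, K i j • (ExteriorAlgebra.ι ℂ (Pi.single (Sum.inl i) (1 : ℂ)) *
    ExteriorAlgebra.ι ℂ (Pi.single (Sum.inr j) (1 : ℂ)))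
  map_add' K K' := by simp only [Matrix.add_apply, add_smul, Finset.sum_add_distrib]
  map_smul' c K := by
    simp only [Matrix.smul_apply, smul_eq_mul, mul_smul, Finset.smul_sum, RingHom.id_apply]

theorem bilinear_apply (K : Matrix I I ℂ) : bilinear K =
    ∑ i, ∑ j, K i j • (ExteriorAlgebra.ι ℂ (Pi.single (Sum.inl i) (1 : ℂ)) *
      ExteriorAlgebra.ι ℂ (Pi.single (Sum.inr j) (1 : ℂ))) := rfl

theorem bilinear_mem_quadratics (K : Matrix I I ℂ) : bilinear K ∈ quadratics (I ⊕ I → ℂ) :=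
  sum_mem fun _ _ => sum_mem fun _ _ =>
    Submodule.smul_mem _ _ (Submodule.subset_span ⟨_, _, rfl⟩)

theorem contractLeft_bilinear (K : Matrix I I ℂ) (d : Module.Dual ℂ (I ⊕ I → ℂ)) :
    contractLeft (Q := 0) d (bilinear K) =
      ∑ i, ∑ j, K i j • (d (Pi.single (Sum.inl i) 1) •
          ExteriorAlgebra.ι ℂ (Pi.single (Sum.inr j) (1 : ℂ))
        - d (Pi.single (Sum.inr j) 1) • ExteriorAlgebra.ι ℂ (Pi.single (Sum.inl i) (1 : ℂ))) := by
  have h1 : ∀ (u : I ⊕ I → ℂ) (y : ExteriorAlgebra ℂ (I ⊕ I → ℂ)),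
      contractLeft (Q := 0) d (ExteriorAlgebra.ι ℂ u * y) =
        d u • y - ExteriorAlgebra.ι ℂ u * contractLeft (Q := 0) d y := fun u y =>
      CliffordAlgebra.contractLeft_ι_mul d u y
  have h2 : ∀ u : I ⊕ I → ℂ, contractLeft (Q := 0) d (ExteriorAlgebra.ι ℂ u) =
      algebraMap ℂ (ExteriorAlgebra ℂ (I ⊕ I → ℂ)) (d u) := fun u =>
        CliffordAlgebra.contractLeft_ι 0 d u
  rw [bilinear_apply, map_sum]
  refine Finset.sum_congr rfl fun i _ => ?_
  rw [map_sum]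
  refine Finset.sum_congr rfl fun j _ => ?_
  rw [map_smul, h1, h2, Algebra.algebraMap_eq_smul_one, mul_smul_comm, mul_one]

theorem bilinear_nondegenerate {B : Matrix I I ℂ} (hB : IsUnit B.det) (v : I ⊕ I → ℂ) :
    ∃ d : Module.Dual ℂ (I ⊕ I → ℂ),
      contractLeft (Q := 0) d (bilinear B) = ExteriorAlgebra.ι ℂ v := by
  -- Contracting with d turns B into a row combination of the ψ and a column combination of the ψ̄.
  -- Matching the two halves of v means solving pB = v_ψ and Bq = v_ψ̄; the minus sign on q in d
  -- undoes the sign of the second contraction.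
  let p : I → ℂ := fun i => ∑ j, v (Sum.inr j) * B⁻¹ j i
  let q : I → ℂ := fun j => ∑ i, B⁻¹ j i * v (Sum.inl i)
  have hp : p ᵥ* B = fun j => v (Sum.inr j) := by
    change (fun j => v (Sum.inr j)) ᵥ* B⁻¹ ᵥ* B = _
    rw [Matrix.vecMul_vecMul, Matrix.nonsing_inv_mul _ hB, Matrix.vecMul_one]
  have hq : B *ᵥ q = fun i => v (Sum.inl i) := by
    change B *ᵥ (B⁻¹ *ᵥ fun j => v (Sum.inl j)) = _
    rw [Matrix.mulVec_mulVec, Matrix.mul_nonsing_inv _ hB, Matrix.one_mulVec]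
  let d : Module.Dual ℂ (I ⊕ I → ℂ) :=
    ∑ i, p i • LinearMap.proj (Sum.inl i) - ∑ j, q j • LinearMap.proj (Sum.inr j)
  have d1 : ∀ i, d (Pi.single (Sum.inl i) 1) = p i := by
    intro i
    simp [d, Pi.single_apply, LinearMap.sum_apply]
  have d2 : ∀ i, d (Pi.single (Sum.inr i) 1) = -q i := by
    intro i
    simp [d, Pi.single_apply, LinearMap.sum_apply]
  refine ⟨d, ?_⟩
  rw [contractLeft_bilinear]
  simp only [d1, d2, neg_smul, sub_neg_eq_add, smul_add, Finset.sum_add_distrib, smul_smul]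
  have e1 : ∑ i, ∑ j, (B i j * p i) • ExteriorAlgebra.ι ℂ (Pi.single (Sum.inr j) (1 : ℂ)) =
      ∑ j : I, v (Sum.inr j) •
        ExteriorAlgebra.ι ℂ (Pi.single (Sum.inr j) (1 : ℂ) : I ⊕ I → ℂ) := by
    rw [Finset.sum_comm]
    refine Finset.sum_congr rfl fun j _ => ?_
    rw [← Finset.sum_smul]
    congr 1
    rw [← congrFun hp j]
    exact Finset.sum_congr rfl fun i _ => mul_comm _ _
  have e2 : ∑ i, ∑ j, (B i j * q j) • ExteriorAlgebra.ι ℂ (Pi.single (Sum.inl i) (1 : ℂ)) =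
      ∑ i : I, v (Sum.inl i) •
        ExteriorAlgebra.ι ℂ (Pi.single (Sum.inl i) (1 : ℂ) : I ⊕ I → ℂ) := by
    refine Finset.sum_congr rfl fun i _ => ?_
    rw [← Finset.sum_smul]
    congr 1
    exact congrFun hq i
  rw [e1, e2, add_comm]
  simp only [← map_smul, ← map_sum, ← map_add]
  congr 1
  ext g
  rcases g with g | g <;> simp [Finset.sum_apply, Pi.single_apply]

/-- The two-point function of a Gaussian Grassmann integral. -/
theorem berezin_exp_mul_bilinear {B : Matrix I I ℂ} (hB : IsUnit B.det) (K : Matrix I I ℂ) :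
    berezin (I ⊕ I) (IsNilpotent.exp (-bilinear B) * bilinear K) /
      berezin (I ⊕ I) (IsNilpotent.exp (-bilinear B)) = -(B⁻¹ * K).trace := by
  rw [← map_neg]
  have hs := bilinear_mem_quadratics (-B)
  have hB' : IsUnit (-B).det := by
    rw [Matrix.det_neg]
    exact (IsUnit.pow _ (by simp)).mul hB
  have hZ := berezin_exp_ne_zero hs (bilinear_nondegenerate hB')
  set Z := berezin (I ⊕ I) (IsNilpotent.exp (bilinear (-B))) with hZdef
  rw [div_eq_iff hZ]
  let C : Matrix I I ℂ := Matrix.of fun j k =>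
    berezin (I ⊕ I) (IsNilpotent.exp (bilinear (-B)) *
      (ExteriorAlgebra.ι ℂ (Pi.single (Sum.inl k) (1 : ℂ)) *
        ExteriorAlgebra.ι ℂ (Pi.single (Sum.inr j) (1 : ℂ))))
  have hCapp : ∀ j k, C j k = berezin (I ⊕ I) (IsNilpotent.exp (bilinear (-B)) *
      (ExteriorAlgebra.ι ℂ (Pi.single (Sum.inl k) (1 : ℂ)) *
        ExteriorAlgebra.ι ℂ (Pi.single (Sum.inr j) (1 : ℂ)))) := fun _ _ => rfl
  clear_value C
  -- Integration by parts with the derivative along ψ̄_i, applied to ψ̄_k. The minus sign comes from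
  -- C having ψ̄ before ψ, the reverse of the order in which the derivative of the exponent produces
  -- them.
  have hC : B * C = -Z • (1 : Matrix I I ℂ) := by
    ext i k
    have h := berezin_schwinger_dyson (LinearMap.proj (Sum.inl i)) hs
      (ExteriorAlgebra.ι ℂ (Pi.single (Sum.inl k) (1 : ℂ)))
    have hι : contractLeft (Q := 0) (LinearMap.proj (Sum.inl i) : (I ⊕ I → ℂ) →ₗ[ℂ] ℂ)
        (ExteriorAlgebra.ι ℂ (Pi.single (Sum.inl k) (1 : ℂ))) =
        algebraMap ℂ (ExteriorAlgebra ℂ (I ⊕ I → ℂ)) (if i = k then 1 else 0) := by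
      erw [CliffordAlgebra.contractLeft_ι]
      congr 1
      simp [Pi.single_apply]
    have hs' : contractLeft (Q := 0) (LinearMap.proj (Sum.inl i)) (bilinear (-B)) =
        -∑ j, B i j • ExteriorAlgebra.ι ℂ (Pi.single (Sum.inr j) (1 : ℂ) : I ⊕ I → ℂ) := by
      rw [contractLeft_bilinear, Finset.sum_eq_single i]
      · simp
      · intro b _ hb
        simp [hb.symm]
      · simp
    rw [hι, hs', Algebra.algebraMap_eq_smul_one, mul_smul_comm, mul_one, map_smul, neg_mul,
      mul_neg, map_neg, neg_inj, Finset.sum_mul, Finset.mul_sum, map_sum] at h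
    rw [Matrix.mul_apply, Matrix.smul_apply, Matrix.one_apply, neg_smul]
    rw [smul_eq_mul] at h
    rw [smul_eq_mul, mul_comm Z, hZdef, ← h, ← Finset.sum_neg_distrib]
    refine Finset.sum_congr rfl fun j _ => ?_
    rw [smul_mul_assoc, mul_smul_comm, map_smul, smul_eq_mul, ← mul_neg, ← map_neg, ← mul_neg]
    rw [hCapp]
    rw [eq_neg_of_add_eq_zero_left (ExteriorAlgebra.ι_add_mul_swap (R := ℂ)
      (Pi.single (Sum.inl k) (1 : ℂ) : I ⊕ I → ℂ) (Pi.single (Sum.inr j) (1 : ℂ)))]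
  have hC' : C = -Z • B⁻¹ := by
    calc C = B⁻¹ * (B * C) := by rw [← mul_assoc, Matrix.nonsing_inv_mul _ hB, one_mul]
      _ = _ := by rw [hC, mul_smul_comm, mul_one]
  have hK : berezin (I ⊕ I) (IsNilpotent.exp (bilinear (-B)) * bilinear K) = (C * K).trace := by
    rw [bilinear_apply K, Finset.mul_sum, map_sum, Matrix.trace_mul_comm]
    refine Finset.sum_congr rfl fun i _ => ?_
    rw [Finset.mul_sum, map_sum, Matrix.diag_apply, Matrix.mul_apply]
    refine Finset.sum_congr rfl fun j _ => ?_
    rw [mul_smul_comm, map_smul, smul_eq_mul, hCapp]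
  rw [hK, hC', smul_mul_assoc, Matrix.trace_smul, smul_eq_mul]
  ring

end Bilinear
end
end LatticeFermion

namespace LatticeFermion
noncomputable section
open scoped Kronecker Matrix ComplexConjugate

/-! ### Traces of gamma matrices against the chirality -/

section Clifford

variable {m : ℕ} {γ : Fin (2 * m) → Matrix (Fin (2 ^ m)) (Fin (2 ^ m)) ℂ}

/-- The relations `γ_μ γ_ν + γ_ν γ_μ = -2 δ_{μν}`. -/
def CliffordRel (γ : Fin (2 * m) → Matrix (Fin (2 ^ m)) (Fin (2 ^ m)) ℂ) : Prop :=
  ∀ μ ν, γ μ * γ ν + γ ν * γ μ =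
    if μ = ν then (-2 : ℂ) • (1 : Matrix (Fin (2 ^ m)) (Fin (2 ^ m)) ℂ) else 0

theorem CliffordRel.sq (h : CliffordRel γ) (μ : Fin (2 * m)) : γ μ * γ μ = -1 := by
  have := h μ μ
  rw [if_pos rfl, ← two_smul ℂ] at this
  have h2 := congrArg (fun x => (2 : ℂ)⁻¹ • x) this
  simp only [smul_smul] at h2
  norm_num at h2
  exact h2

theorem CliffordRel.anticomm (h : CliffordRel γ) {μ ν : Fin (2 * m)} (hne : μ ≠ ν) :
    γ μ * γ ν = -(γ ν * γ μ) := by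
  have := h μ ν
  rw [if_neg hne] at this
  exact eq_neg_of_add_eq_zero_left this

/-- Moving γ_μ across the word costs one sign for each letter different from μ; modulo 2 that number
is the length plus the multiplicity of μ. -/
theorem CliffordRel.mul_prod (h : CliffordRel γ) (μ : Fin (2 * m)) (l : List (Fin (2 * m))) :
    γ μ * (l.map γ).prod = (-1 : ℂ) ^ (l.length + l.count μ) • ((l.map γ).prod * γ μ) := by
  induction l with
  | nil => simp
  | cons a l ih =>
    rw [List.map_cons, List.prod_cons, List.length_cons]
    by_cases ha : a = μ
    · subst ha
      rw [List.count_cons_self, mul_assoc, ih, mul_smul_comm,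
        show l.length + 1 + (l.count a + 1) = l.length + l.count a + 2 by ring,
        pow_add _ (l.length + l.count a)]
      norm_num
    · rw [List.count_cons_of_ne ha, ← mul_assoc, h.anticomm (Ne.symm ha), neg_mul, mul_assoc, ih,
        mul_smul_comm, ← neg_smul, mul_assoc]
      congr 1
      rw [show l.length + 1 + l.count μ = l.length + l.count μ + 1 by ring, pow_succ]
      ring

theorem chirality_eq : chirality γ = Complex.I ^ m • ((List.finRange (2 * m)).map γ).prod := by
  rw [chirality, List.ofFn_eq_map]

theorem CliffordRel.mul_chirality (h : CliffordRel γ) (μ : Fin (2 * m)) :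
    γ μ * chirality γ = -(chirality γ * γ μ) := by
  rw [chirality_eq, mul_smul_comm, h.mul_prod, smul_mul_assoc, List.length_finRange,
    List.count_eq_one_of_mem (List.nodup_finRange _) (List.mem_finRange μ), pow_succ, pow_mul]
  simp

/-- Since γ_μ² = -1, evaluating tr(γ_μ X γ_μ) by cyclicity and by anticommutation gives tr X with
opposite signs. -/
theorem CliffordRel.trace_eq_zero_of_anticomm (h : CliffordRel γ) (μ : Fin (2 * m))
    {X : Matrix (Fin (2 ^ m)) (Fin (2 ^ m)) ℂ} (hX : γ μ * X = -(X * γ μ)) : X.trace = 0 := by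
  have h1 : (γ μ * X * γ μ).trace = -X.trace := by
    rw [Matrix.trace_mul_comm, ← mul_assoc, h.sq, neg_one_mul, Matrix.trace_neg]
  have h2 : (γ μ * X * γ μ).trace = X.trace := by
    rw [hX, neg_mul, mul_assoc, h.sq, mul_neg, mul_one, neg_neg]
  exact CharZero.eq_neg_self_iff.mp (h2.symm.trans h1)

theorem CliffordRel.trace_prod_eq_zero (h : CliffordRel γ) (l : List (Fin (2 * m)))
    (μ : Fin (2 * m)) (hl : Even (l.length + l.count μ)) :
    ((l.map γ).prod * chirality γ).trace = 0 := by
  refine h.trace_eq_zero_of_anticomm μ ?_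
  rw [← mul_assoc, h.mul_prod, hl.neg_one_pow, one_smul, mul_assoc, h.mul_chirality, mul_neg,
    ← mul_assoc]

/-- A nonzero trace forces length + multiplicity to be odd for every index. If the length is even,
each index occurs, so the length is at least 2m. If it is odd, all multiplicities are even and
cannot add up to it. -/
theorem CliffordRel.trace_prod_eq_zero_of_length_lt (h : CliffordRel γ) (l : List (Fin (2 * m)))
    (hl : l.length < 2 * m) : ((l.map γ).prod * chirality γ).trace = 0 := by
  have hs : ∑ μ, l.count μ = l.length := by
    have := Multiset.sum_count_eq_card (s := Finset.univ) (m := (l : Multiset (Fin (2 * m))))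
      (fun a _ => Finset.mem_univ a)
    simpa using this
  by_contra hne
  have hodd : ∀ μ, ¬Even (l.length + l.count μ) := fun μ hμ => hne (h.trace_prod_eq_zero l μ hμ)
  rcases Nat.even_or_odd l.length with he | ho
  · have h1 : ∀ μ, 1 ≤ l.count μ := by
      intro μ
      by_contra hc
      apply hodd μ
      rw [show l.count μ = 0 by omega]
      simpa using he
    have : ∑ μ : Fin (2 * m), 1 ≤ ∑ μ, l.count μ := Finset.sum_le_sum fun μ _ => h1 μ
    simp at this
    omega
  · have h1 : ∀ μ, Even (l.count μ) := by
      intro μ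
      by_contra hc
      exact hodd μ (ho.add_odd (Nat.not_even_iff_odd.mp hc))
    rw [← Nat.not_even_iff_odd, ← hs] at ho
    exact ho (Finset.even_sum _ fun μ _ => h1 μ)

theorem CliffordRel.prod_mul_prod (h : CliffordRel γ) (l : List (Fin (2 * m))) (hl : l.Nodup) :
    (l.map γ).prod * (l.map γ).prod =
      (-1 : ℂ) ^ (∑ i ∈ Finset.range (l.length + 1), i) • 1 := by
  induction l with
  | nil => simp
  | cons a l ih =>
    rw [List.nodup_cons] at hl
    have h1 := h.mul_prod a l
    rw [List.count_eq_zero_of_not_mem hl.1, add_zero] at h1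
    have h2 : (l.map γ).prod * γ a = (-1 : ℂ) ^ l.length • (γ a * (l.map γ).prod) := by
      rw [h1, smul_smul, ← mul_pow]
      simp
    rw [List.map_cons, List.prod_cons, mul_assoc, ← mul_assoc _ (γ a), h2, smul_mul_assoc,
      mul_smul_comm, mul_assoc, ← mul_assoc (γ a), h.sq, neg_one_mul, ih hl.2, List.length_cons,
      Finset.sum_range_succ _ (l.length + 1), smul_neg, smul_smul, ← neg_smul]
    congr 1
    rw [pow_add, pow_succ _ l.length]
    ring

theorem neg_one_pow_sum_range (m : ℕ) :
    (-1 : ℂ) ^ (∑ i ∈ Finset.range (2 * m + 1), i) = (-1) ^ m := by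
  induction m with
  | zero => simp
  | succ m ih =>
    rw [show 2 * (m + 1) + 1 = 2 * m + 1 + 1 + 1 by ring, Finset.sum_range_succ,
      Finset.sum_range_succ, pow_add, pow_add, ih, pow_succ _ m,
      show (2 * m + 1 + 1) = 2 * (m + 1) by ring, pow_succ _ (2 * m), pow_mul, pow_mul]
    simp

theorem CliffordRel.trace_full (h : CliffordRel γ) :
    ((List.ofFn γ).prod * chirality γ).trace = (-Complex.I) ^ m * 2 ^ m := by
  rw [chirality_eq, List.ofFn_eq_map, mul_smul_comm, h.prod_mul_prod _ (List.nodup_finRange _),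
    List.length_finRange, neg_one_pow_sum_range, smul_smul, Matrix.trace_smul, Matrix.trace_one,
    ← mul_pow]
  simp

theorem prod_ofFn_swap {R : Type*} [Ring R] {n : ℕ} (v : Fin (n + 1) → R) (i : Fin n)
    (hv : v i.castSucc * v i.succ = -(v i.succ * v i.castSucc)) :
    (List.ofFn (v ∘ Equiv.swap i.castSucc i.succ)).prod = -(List.ofFn v).prod := by
  induction n with
  | zero => exact i.elim0
  | succ n ih =>
    induction i using Fin.cases with
    | zero =>
      have h0 : (fun i : Fin n => (v ∘ Equiv.swap (Fin.castSucc 0) (Fin.succ 0)) i.succ.succ) =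
          fun i => v i.succ.succ := by
        ext i
        rw [Function.comp_apply, Equiv.swap_apply_of_ne_of_ne]
        · simp [Fin.ext_iff]
        · simp [Fin.ext_iff]
      rw [List.ofFn_succ, List.ofFn_succ, h0, List.ofFn_succ (f := v), List.ofFn_succ]
      simp only [List.prod_cons, Function.comp_apply, Fin.castSucc_zero, Equiv.swap_apply_left,
        Equiv.swap_apply_right, ← mul_assoc]
      rw [← neg_mul]
      congr 1
      rw [Fin.castSucc_zero] at hv
      rw [hv, neg_neg]
    | succ j =>
      have h0 : (fun k : Fin (n + 1) => (v ∘ Equiv.swap j.succ.castSucc j.succ.succ) k.succ) =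
          (fun k => v k.succ) ∘ Equiv.swap j.castSucc j.succ := by
        ext k
        rw [Function.comp_apply, Function.comp_apply, ← Fin.succ_castSucc,
          (Fin.succ_injective _).swap_apply]
      have h1 : (v ∘ Equiv.swap j.succ.castSucc j.succ.succ) 0 = v 0 := by
        rw [Function.comp_apply, Equiv.swap_apply_of_ne_of_ne]
        · simp [Fin.ext_iff]
        · simp [Fin.ext_iff]
      rw [List.ofFn_succ, List.ofFn_succ (f := v), List.prod_cons, List.prod_cons, h0, h1,
        ih (fun k => v k.succ) j hv, mul_neg]

/-- Adjacent transpositions generate the symmetric group, and each of them flips the sign of a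
product of anticommuting factors. -/
theorem prod_ofFn_perm {n : ℕ} (σ : Equiv.Perm (Fin n)) :
    ∀ v : Fin n → Matrix (Fin (2 ^ m)) (Fin (2 ^ m)) ℂ,
      (∀ i j, i ≠ j → v i * v j = -(v j * v i)) →
      (List.ofFn (v ∘ σ)).prod = ((Equiv.Perm.sign σ : ℤ) : ℂ) • (List.ofFn v).prod := by
  cases n with
  | zero => intro v _; simp [Subsingleton.elim σ 1]
  | succ n =>
    have hσ : σ ∈ Submonoid.closure
        (Set.range fun i : Fin n => Equiv.swap i.castSucc i.succ) := by
      rw [Equiv.Perm.mclosure_swap_castSucc_succ]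
      trivial
    induction hσ using Submonoid.closure_induction with
    | mem τ h =>
      obtain ⟨i, rfl⟩ := h
      intro v hv
      rw [prod_ofFn_swap v i (hv _ _ (by simp [Fin.ext_iff])),
        Equiv.Perm.sign_swap (by simp [Fin.ext_iff])]
      simp
    | one => intro v _; simp
    | mul τ τ' _ _ h1 h2 =>
      intro v hv
      rw [Equiv.Perm.coe_mul, ← Function.comp_assoc,
        h2 (v ∘ τ) (fun i j hij => hv _ _ (τ.injective.ne hij)), h1 v hv, smul_smul, map_mul]
      congr 1
      push_cast
      ring

/-- A permutation of the indices is sorted at the price of its sign. Otherwise some index μ is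
missing, and then the even length 2m together with multiplicity 0 makes the trace vanish. -/
theorem CliffordRel.trace_ofFn (h : CliffordRel γ) (f : Fin (2 * m) → Fin (2 * m)) :
    ((List.ofFn (γ ∘ f)).prod * chirality γ).trace =
      (epsilon f : ℂ) * ((-Complex.I) ^ m * 2 ^ m) := by
  rw [epsilon]
  split_ifs with hf
  · have := prod_ofFn_perm (Equiv.ofBijective f hf) γ fun i j hij => h.anticomm hij
    rw [show γ ∘ Equiv.ofBijective f hf = γ ∘ f from rfl] at this
    rw [this, smul_mul_assoc, Matrix.trace_smul, h.trace_full]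
    simp
  · have hs : ¬Function.Surjective f := fun hs => hf (Finite.surjective_iff_bijective.mp hs)
    rw [Function.Surjective] at hs
    push Not at hs
    obtain ⟨μ, hμ⟩ := hs
    have e : List.ofFn (γ ∘ f) = (List.ofFn f).map γ := by rw [List.map_ofFn]
    rw [e, h.trace_prod_eq_zero _ μ]
    · simp
    · rw [List.count_eq_zero_of_not_mem, List.length_ofFn]
      · simp
      · rw [List.mem_ofFn]
        rintro ⟨i, hi⟩
        exact hμ i hi

theorem sum_fin_succ_succ {ι M : Type*} [Fintype ι] [AddCommMonoid M] (n : ℕ)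
    (F : (Fin (n + 2) → ι) → M) :
    ∑ f, F f = ∑ a, ∑ b, ∑ f : Fin n → ι,
      F (Fin.cons a (Fin.cons b f : Fin (n + 1) → ι) : Fin (n + 2) → ι) := by
  rw [← (Fin.consEquiv fun _ : Fin (n + 2) => ι).sum_comp, Fintype.sum_prod_type]
  refine Finset.sum_congr rfl fun a _ => ?_
  rw [← (Fin.consEquiv fun _ : Fin (n + 1) => ι).sum_comp, Fintype.sum_prod_type]
  rfl

theorem pow_sum_pairs (Ω : Fin (2 * m) → Fin (2 * m) → ℂ) (k : ℕ) :
    (∑ μ, ∑ ν, Ω μ ν • (γ μ * γ ν)) ^ k =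
      ∑ f : Fin (2 * k) → Fin (2 * m),
        (∏ j : Fin k, Ω (f ⟨2 * j, by omega⟩) (f ⟨2 * j + 1, by omega⟩)) •
          (List.ofFn (γ ∘ f)).prod := by
  induction k with
  | zero => simp
  | succ k ih =>
    rw [pow_succ', ih]
    refine Eq.symm ((sum_fin_succ_succ (2 * k) _).trans ?_)
    rw [Finset.sum_mul]
    refine Finset.sum_congr rfl fun μ _ => ?_
    rw [Finset.sum_mul]
    refine Finset.sum_congr rfl fun ν _ => ?_
    rw [Finset.mul_sum]
    refine Finset.sum_congr rfl fun f _ => ?_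
    rw [Fin.prod_univ_succ, smul_mul_smul_comm]
    congr 1
    · erw [List.ofFn_succ, List.ofFn_succ]
      rw [List.prod_cons, List.prod_cons, ← mul_assoc]
      rfl

/-- The span of the products of at most `j` gamma matrices. -/
def Fil (γ : Fin (2 * m) → Matrix (Fin (2 ^ m)) (Fin (2 ^ m)) ℂ) (j : ℕ) :
    Submodule ℂ (Matrix (Fin (2 ^ m)) (Fin (2 ^ m)) ℂ) :=
  Submodule.span ℂ {X | ∃ l : List (Fin (2 * m)), l.length ≤ j ∧ X = (l.map γ).prod}

theorem Fil_mono {i j : ℕ} (h : i ≤ j) : Fil γ i ≤ Fil γ j :=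
  Submodule.span_mono fun _ ⟨l, hl, e⟩ => ⟨l, hl.trans h, e⟩

theorem one_mem_Fil (j : ℕ) : 1 ∈ Fil γ j :=
  Submodule.subset_span ⟨[], by simp, by simp⟩

theorem gamma_mem_Fil (μ : Fin (2 * m)) : γ μ ∈ Fil γ 1 :=
  Submodule.subset_span ⟨[μ], by simp, by simp⟩

theorem mul_mem_Fil {i j : ℕ} {X Y : Matrix (Fin (2 ^ m)) (Fin (2 ^ m)) ℂ} (hX : X ∈ Fil γ i)
    (hY : Y ∈ Fil γ j) : X * Y ∈ Fil γ (i + j) := by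
  have h : Fil γ i * Fil γ j ≤ Fil γ (i + j) := by
    rw [Fil, Fil, Submodule.span_mul_span, Submodule.span_le]
    rintro _ ⟨_, ⟨l, hl, rfl⟩, _, ⟨l', hl', rfl⟩, rfl⟩
    exact Submodule.subset_span ⟨l ++ l', by rw [List.length_append]; omega, by simp⟩
  exact h (Submodule.mul_mem_mul hX hY)

theorem pow_mem_Fil {i : ℕ} {X : Matrix (Fin (2 ^ m)) (Fin (2 ^ m)) ℂ} (hX : X ∈ Fil γ i)
    (k : ℕ) : X ^ k ∈ Fil γ (i * k) := by
  induction k with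
  | zero => simpa using one_mem_Fil 0
  | succ k ih => rw [pow_succ, Nat.mul_succ]; exact mul_mem_Fil ih hX

theorem CliffordRel.trace_Fil (h : CliffordRel γ) {j : ℕ} (hj : j < 2 * m)
    {X : Matrix (Fin (2 ^ m)) (Fin (2 ^ m)) ℂ} (hX : X ∈ Fil γ j) :
    (X * chirality γ).trace = 0 := by
  induction hX using Submodule.span_induction with
  | mem X hX =>
    obtain ⟨l, hl, rfl⟩ := hX
    exact h.trace_prod_eq_zero_of_length_lt l (hl.trans_lt hj)
  | zero => simp
  | add X Y _ _ hX hY => rw [add_mul, Matrix.trace_add, hX, hY, add_zero]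
  | smul c X _ hX => rw [smul_mul_assoc, Matrix.trace_smul, hX, smul_zero]

/-- A commutator of a quadratic element with a linear one has degree 1 rather than 3, and the
Leibniz rule carries this gain to powers. -/
theorem pow_commutator_mem_Fil {X t : Matrix (Fin (2 ^ m)) (Fin (2 ^ m)) ℂ} (hX : X ∈ Fil γ 2)
    (hXt : X * t - t * X ∈ Fil γ 1) (k : ℕ) :
    X ^ (k + 1) * t - t * X ^ (k + 1) ∈ Fil γ (2 * k + 1) := by
  induction k with
  | zero => simpa using hXt
  | succ k ih =>
    have e : X ^ (k + 1 + 1) * t - t * X ^ (k + 1 + 1) =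
        X * (X ^ (k + 1) * t - t * X ^ (k + 1)) + (X * t - t * X) * X ^ (k + 1) := by
      rw [pow_succ' X (k + 1)]
      noncomm_ring
    rw [e]
    refine add_mem ?_ ?_
    · exact Fil_mono (by omega) (mul_mem_Fil hX ih)
    · exact Fil_mono (by omega) (mul_mem_Fil hXt (pow_mem_Fil hX _))

/-- To leading order a perturbation of lower degree that is a commutator acts as a derivation. -/
theorem add_pow_sub_mem_Fil {X Y t : Matrix (Fin (2 ^ m)) (Fin (2 ^ m)) ℂ} (hX : X ∈ Fil γ 2)
    (hY : Y ∈ Fil γ 1) (hYt : Y = X * t - t * X) (k : ℕ) :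
    (X + Y) ^ (k + 1) - X ^ (k + 1) - (X ^ (k + 1) * t - t * X ^ (k + 1)) ∈ Fil γ (2 * k) := by
  have hXt : X * t - t * X ∈ Fil γ 1 := hYt ▸ hY
  induction k with
  | zero => rw [zero_add, pow_one, pow_one, hYt, add_sub_cancel_left, sub_self]; exact zero_mem _
  | succ k ih =>
    set e := (X + Y) ^ (k + 1) - X ^ (k + 1) - (X ^ (k + 1) * t - t * X ^ (k + 1)) with he
    have e1 : (X + Y) ^ (k + 1) = X ^ (k + 1) + (X ^ (k + 1) * t - t * X ^ (k + 1)) + e := by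
      rw [he]; abel
    -- The error obeys a recursion with three terms, each of degree at most 2(k + 1). The
    -- first-order terms combine into the commutator for the next power because Y = [X, t].
    have e2 : (X + Y) ^ (k + 1 + 1) - X ^ (k + 1 + 1) -
        (X ^ (k + 1 + 1) * t - t * X ^ (k + 1 + 1)) =
        X * e + Y * (X ^ (k + 1) * t - t * X ^ (k + 1)) + Y * e := by
      rw [pow_succ' (X + Y), e1, pow_succ' X (k + 1), add_mul]
      nth_rewrite 1 [mul_add Y, mul_add Y]
      nth_rewrite 1 [hYt]
      noncomm_ring
    rw [e2]
    refine add_mem (add_mem ?_ ?_) ?_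
    · exact Fil_mono (by omega) (mul_mem_Fil hX ih)
    · exact Fil_mono (by omega) (mul_mem_Fil hY (pow_commutator_mem_Fil hX hXt k))
    · exact Fil_mono (by omega) (mul_mem_Fil hY ih)

theorem CliffordRel.commutator_pair (h : CliffordRel γ) (μ ν l : Fin (2 * m)) :
    γ μ * γ ν * γ l - γ l * (γ μ * γ ν) =
      (if μ = l then (2 : ℂ) else 0) • γ ν - (if ν = l then (2 : ℂ) else 0) • γ μ := by
  have h1 : γ μ * γ ν * γ l - γ l * (γ μ * γ ν) =
      γ μ * (γ ν * γ l + γ l * γ ν) - (γ μ * γ l + γ l * γ μ) * γ ν := by noncomm_ring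
  rw [h1, h, h]
  split_ifs <;> simp [sub_eq_add_neg, add_comm]

/-- The commutator of an antisymmetric bilinear expression with a linear one. -/
theorem CliffordRel.commutator_bilinear (h : CliffordRel γ) (Ω : Fin (2 * m) → Fin (2 * m) → ℂ)
    (hΩ : ∀ μ ν, Ω ν μ = -Ω μ ν) (t : Fin (2 * m) → ℂ) :
    (∑ μ, ∑ ν, Ω μ ν • (γ μ * γ ν)) * (∑ l, t l • γ l) -
      (∑ l, t l • γ l) * (∑ μ, ∑ ν, Ω μ ν • (γ μ * γ ν)) =
      ∑ μ, ∑ ν, (-4 * (Ω μ ν * t ν)) • γ μ := by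
  have e : (∑ μ, ∑ ν, Ω μ ν • (γ μ * γ ν)) * (∑ l, t l • γ l) -
      (∑ l, t l • γ l) * (∑ μ, ∑ ν, Ω μ ν • (γ μ * γ ν)) =
      ∑ μ, ∑ ν, (2 * (Ω μ ν * t μ)) • γ ν - ∑ μ, ∑ ν, (2 * (Ω μ ν * t ν)) • γ μ := by
    rw [Finset.sum_mul, Finset.mul_sum, ← Finset.sum_sub_distrib, ← Finset.sum_sub_distrib]
    refine Finset.sum_congr rfl fun μ _ => ?_
    rw [Finset.sum_mul, Finset.mul_sum, ← Finset.sum_sub_distrib, ← Finset.sum_sub_distrib]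
    refine Finset.sum_congr rfl fun ν _ => ?_
    rw [Finset.mul_sum, Finset.sum_mul, ← Finset.sum_sub_distrib]
    have : ∀ l, Ω μ ν • (γ μ * γ ν) * t l • γ l - t l • γ l * Ω μ ν • (γ μ * γ ν) =
        (if μ = l then (2 * (Ω μ ν * t l)) • γ ν else 0)
          - if ν = l then (2 * (Ω μ ν * t l)) • γ μ else 0 := by
      intro l
      rw [smul_mul_smul_comm, smul_mul_smul_comm, mul_comm (t l), ← smul_sub, h.commutator_pair]
      split_ifs <;> simp [smul_smul, smul_sub, mul_comm]
    rw [Finset.sum_congr rfl fun l _ => this l, Finset.sum_sub_distrib, Finset.sum_ite_eq,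
      Finset.sum_ite_eq]
    simp
  rw [e, Finset.sum_comm, ← Finset.sum_sub_distrib]
  refine Finset.sum_congr rfl fun μ _ => ?_
  rw [← Finset.sum_sub_distrib]
  refine Finset.sum_congr rfl fun ν _ => ?_
  rw [hΩ, ← sub_smul]
  congr 1
  ring

theorem CliffordRel.linear_anticomm (h : CliffordRel γ) (s t : Fin (2 * m) → ℂ) :
    (∑ l, t l • γ l) * (∑ l, s l • γ l) + (∑ l, s l • γ l) * (∑ l, t l • γ l) =
      (-2 * ∑ l, t l * s l) • 1 := by
  rw [Finset.sum_mul_sum, Finset.sum_mul_sum, Finset.sum_comm (f := fun i j => s i • γ i * _),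
    ← Finset.sum_add_distrib, Finset.mul_sum, Finset.sum_smul]
  refine Finset.sum_congr rfl fun μ _ => ?_
  rw [← Finset.sum_add_distrib, Finset.sum_eq_single μ]
  · rw [smul_mul_smul_comm, smul_mul_smul_comm, mul_comm (s μ), ← smul_add, h, if_pos rfl,
      smul_smul]
    congr 1
    ring
  · intro ν _ hν
    rw [smul_mul_smul_comm, smul_mul_smul_comm, mul_comm (s ν), ← smul_add, h,
      if_neg (Ne.symm hν), smul_zero]
  · simp

theorem linear_mem_Fil (s : Fin (2 * m) → ℂ) : ∑ l, s l • γ l ∈ Fil γ 1 :=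
  sum_mem fun l _ => Submodule.smul_mem _ _ (gamma_mem_Fil l)

theorem bilinear_mem_Fil (Ω : Fin (2 * m) → Fin (2 * m) → ℂ) :
    ∑ μ, ∑ ν, Ω μ ν • (γ μ * γ ν) ∈ Fil γ 2 :=
  sum_mem fun _ _ => sum_mem fun _ _ =>
    Submodule.smul_mem _ _ (mul_mem_Fil (i := 1) (j := 1) (gamma_mem_Fil _) (gamma_mem_Fil _))

theorem CliffordRel.linear_chirality (h : CliffordRel γ) (s : Fin (2 * m) → ℂ) :
    (∑ l, s l • γ l) * chirality γ = -(chirality γ * ∑ l, s l • γ l) := by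
  rw [Finset.sum_mul, Finset.mul_sum, ← Finset.sum_neg_distrib]
  refine Finset.sum_congr rfl fun l _ => ?_
  rw [smul_mul_assoc, mul_smul_comm, h.mul_chirality, smul_neg]

/-- Write S and T for the two linear elements. Up to terms too short to be seen by the chiral trace,
(X + [X,T])^m is X^m + [X^m,T]. Of the products with b + S only b X^m and S[X^m,T] survive. Since T
anticommutes with the chirality, cyclicity turns the second into -(TS + ST)X^m, and TS + ST is a
scalar. -/
theorem CliffordRel.trace_top_aux (h : CliffordRel γ) (k : ℕ) (hk : m = k + 1)
    {X : Matrix (Fin (2 ^ m)) (Fin (2 ^ m)) ℂ} (hX : X ∈ Fil γ 2) (s t : Fin (2 * m) → ℂ)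
    (hXt : ∀ t : Fin (2 * m) → ℂ, X * (∑ l, t l • γ l) - (∑ l, t l • γ l) * X ∈ Fil γ 1)
    (b : ℂ) :
    ((b • 1 + ∑ l, s l • γ l) * (X + (X * (∑ l, t l • γ l) - (∑ l, t l • γ l) * X)) ^ (k + 1) *
        chirality γ).trace =
      (b + 2 * ∑ l, t l * s l) * (X ^ (k + 1) * chirality γ).trace := by
  set S := ∑ l, s l • γ l with hS
  set T := ∑ l, t l • γ l with hT
  have hS1 : S ∈ Fil γ 1 := linear_mem_Fil s
  set e := (X + (X * T - T * X)) ^ (k + 1) - X ^ (k + 1) - (X ^ (k + 1) * T - T * X ^ (k + 1))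
    with he
  have hemem : e ∈ Fil γ (2 * k) := add_pow_sub_mem_Fil hX (hXt t) rfl k
  have e1 : (X + (X * T - T * X)) ^ (k + 1) =
      X ^ (k + 1) + (X ^ (k + 1) * T - T * X ^ (k + 1)) + e := by
    rw [he]; abel
  clear_value e
  have z1 : ((X ^ (k + 1) * T - T * X ^ (k + 1)) * chirality γ).trace = 0 :=
    h.trace_Fil (by omega) (pow_commutator_mem_Fil hX (hXt t) k)
  have z2 : (e * chirality γ).trace = 0 := h.trace_Fil (by omega) hemem
  have z3 : (S * e * chirality γ).trace = 0 := h.trace_Fil (by omega) (mul_mem_Fil hS1 hemem)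
  have z4 : ((X ^ (k + 1) * S - S * X ^ (k + 1)) * chirality γ).trace = 0 :=
    h.trace_Fil (by omega) (pow_commutator_mem_Fil hX (hXt s) k)
  have cyc : ∀ Y : Matrix (Fin (2 ^ m)) (Fin (2 ^ m)) ℂ, ∀ s : Fin (2 * m) → ℂ,
      (Y * (∑ l, s l • γ l) * chirality γ).trace = -((∑ l, s l • γ l) * Y * chirality γ).trace := by
    intro Y s
    rw [mul_assoc, h.linear_chirality, mul_neg, Matrix.trace_neg, ← mul_assoc,
      Matrix.trace_mul_comm, ← mul_assoc]
  -- The chiral traces of X^m S and S X^m are opposite by cyclicity and equal because the commutator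
  -- has degree below 2m.
  have z5 : (S * X ^ (k + 1) * chirality γ).trace = 0 := by
    rw [sub_mul, Matrix.trace_sub, cyc] at z4
    linear_combination (-1 / 2 : ℂ) * z4
  have z6 : (S * (X ^ (k + 1) * T - T * X ^ (k + 1)) * chirality γ).trace =
      2 * (∑ l, t l * s l) * (X ^ (k + 1) * chirality γ).trace := by
    have : (T * S + S * T) * X ^ (k + 1) * chirality γ =
        (-2 * ∑ l, t l * s l) • (X ^ (k + 1) * chirality γ) := by
      rw [h.linear_anticomm, smul_mul_assoc, one_mul, smul_mul_assoc]
    have h2 := congrArg Matrix.trace this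
    rw [Matrix.trace_smul, smul_eq_mul, add_mul, add_mul, Matrix.trace_add] at h2
    rw [mul_sub, sub_mul, Matrix.trace_sub, ← mul_assoc, cyc, ← mul_assoc, ← mul_assoc]
    linear_combination (-1 : ℂ) * h2
  rw [e1]
  have e3 : (b • 1 + S) * (X ^ (k + 1) + (X ^ (k + 1) * T - T * X ^ (k + 1)) + e) * chirality γ =
      b • (X ^ (k + 1) * chirality γ) + b • ((X ^ (k + 1) * T - T * X ^ (k + 1)) * chirality γ)
      + b • (e * chirality γ) + S * X ^ (k + 1) * chirality γ
      + S * (X ^ (k + 1) * T - T * X ^ (k + 1)) * chirality γ + S * e * chirality γ := by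
    simp only [add_mul, mul_add, smul_mul_assoc, one_mul]
    abel
  rw [e3]
  simp only [Matrix.trace_add, Matrix.trace_smul, z1, z2, z3, z5, z6, smul_eq_mul]
  ring

theorem CliffordRel.trace_top (h : CliffordRel γ) (hm : 0 < m)
    {X : Matrix (Fin (2 ^ m)) (Fin (2 ^ m)) ℂ} (hX : X ∈ Fil γ 2) (s t : Fin (2 * m) → ℂ)
    (hXt : ∀ t : Fin (2 * m) → ℂ, X * (∑ l, t l • γ l) - (∑ l, t l • γ l) * X ∈ Fil γ 1)
    (b : ℂ) :
    ((b • 1 + ∑ l, s l • γ l) * (X + (X * (∑ l, t l • γ l) - (∑ l, t l • γ l) * X)) ^ m *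
        chirality γ).trace =
      (b + 2 * ∑ l, t l * s l) * (X ^ m * chirality γ).trace := by
  obtain ⟨k, hk⟩ : ∃ k, m = k + 1 := ⟨m - 1, by omega⟩
  have key := h.trace_top_aux k hk hX s t hXt b
  rwa [← hk] at key

/-- The trace of the leading term of the heat-kernel-like expansion. -/
theorem CliffordRel.trace_main_of_ne_zero (h : CliffordRel γ) (hm : 0 < m)
    (F : Fin (2 * m) → Fin (2 * m) → ℂ) (hF : ∀ μ ν, F ν μ = -F μ ν) (b r κ : ℂ)
    (c s : Fin (2 * m) → ℂ) (hc : ∀ l, c l ≠ 0) :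
    ((b • 1 + ∑ l, s l • γ l) *
        (κ • ((1 / 2 : ℂ) • (∑ μ, ∑ ν, (F μ ν * (c μ * c ν)) • (γ μ * γ ν)) +
          r • ∑ μ, ∑ ν, (F μ ν * (c μ * s ν)) • γ μ)) ^ m * chirality γ).trace =
      κ ^ m * (-Complex.I) ^ m *
        (b * ∏ l, c l - r * ∑ l, s l ^ 2 * ∏ k ∈ Finset.univ.erase l, c k) *
        ∑ f : Fin (2 * m) → Fin (2 * m), (epsilon f : ℂ) *
          ∏ j : Fin m, F (f ⟨2 * j, by omega⟩) (f ⟨2 * j + 1, by omega⟩) := by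
  have hΩ : ∀ μ ν, F ν μ * (c ν * c μ) = -(F μ ν * (c μ * c ν)) := by
    intro μ ν; rw [hF]; ring
  set X := (1 / 2 : ℂ) • (∑ μ, ∑ ν, (F μ ν * (c μ * c ν)) • (γ μ * γ ν)) with hX
  have hX2 : X ∈ Fil γ 2 := Submodule.smul_mem _ _ (bilinear_mem_Fil _)
  have hXt : ∀ t : Fin (2 * m) → ℂ, X * (∑ l, t l • γ l) - (∑ l, t l • γ l) * X =
      (1 / 2 : ℂ) • ∑ μ, ∑ ν, (-4 * ((F μ ν * (c μ * c ν)) * t ν)) • γ μ := by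
    intro t
    rw [← h.commutator_bilinear (fun μ ν => F μ ν * (c μ * c ν)) hΩ t, hX, smul_mul_assoc,
      mul_smul_comm, smul_sub]
  -- The linear part of the curvature is a commutator with the quadratic part. The choice t_l =
  -- -(r/2) s_l / c_l compensates both the factor 1/2 and the -4 of `commutator_bilinear`; this is
  -- where c_l ≠ 0 is used.
  have hY : r • ∑ μ, ∑ ν, (F μ ν * (c μ * s ν)) • γ μ =
      X * (∑ l, (-(r / 2) * (s l / c l)) • γ l) - (∑ l, (-(r / 2) * (s l / c l)) • γ l) * X := by
    rw [hXt, Finset.smul_sum, Finset.smul_sum]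
    refine Finset.sum_congr rfl fun μ _ => ?_
    rw [Finset.smul_sum, Finset.smul_sum]
    refine Finset.sum_congr rfl fun ν _ => ?_
    rw [smul_smul, smul_smul]
    congr 1
    field_simp [hc ν]
    ring
  have hXm : (X ^ m * chirality γ).trace = (-Complex.I) ^ m * (∏ l, c l) *
      ∑ f : Fin (2 * m) → Fin (2 * m), (epsilon f : ℂ) *
          ∏ j : Fin m, F (f ⟨2 * j, by omega⟩) (f ⟨2 * j + 1, by omega⟩) := by
    rw [hX, smul_pow, pow_sum_pairs, smul_mul_assoc, Finset.sum_mul, Matrix.trace_smul,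
      Matrix.trace_sum, Finset.mul_sum, smul_eq_mul, Finset.mul_sum]
    refine Finset.sum_congr rfl fun f _ => ?_
    rw [smul_mul_assoc, Matrix.trace_smul, h.trace_ofFn, smul_eq_mul, Finset.prod_mul_distrib]
    -- When ε_f ≠ 0 the multi-index f runs over every direction exactly once, so the cosine factors
    -- collect into the full product independently of f.
    by_cases hf : Function.Bijective f
    · have e1 : ∀ (k : ℕ) (g : Fin (2 * k) → ℂ),
          ∏ j : Fin k, g ⟨2 * j, by omega⟩ * g ⟨2 * j + 1, by omega⟩ = ∏ i, g i := by
        intro k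
        induction k with
        | zero => intro g; simp
        | succ k ih =>
          intro g
          rw [Fin.prod_univ_castSucc]
          refine Eq.trans ?_ (Fin.prod_univ_castSucc (n := 2 * k + 1) g).symm
          rw [Fin.prod_univ_castSucc (n := 2 * k), mul_assoc]
          congr 1
          exact ih fun i => g i.castSucc.castSucc
      rw [e1 m fun i => c (f i), hf.prod_comp fun i => c i, one_div, inv_pow]
      have : (2 : ℂ) ^ m ≠ 0 := pow_ne_zero m two_ne_zero
      field_simp
    · rw [epsilon, dif_neg hf]
      simp
  rw [smul_pow, mul_smul_comm, smul_mul_assoc, Matrix.trace_smul, hY,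
    h.trace_top hm hX2 s _ (fun t => ?_) b, hXm, smul_eq_mul]
  · have e2 : b * ∏ l, c l - r * ∑ l, s l ^ 2 * ∏ k ∈ Finset.univ.erase l, c k =
        (b + 2 * ∑ l, -(r / 2) * (s l / c l) * s l) * ∏ l, c l := by
      rw [add_mul, sub_eq_add_neg, ← neg_mul, Finset.mul_sum, Finset.mul_sum, Finset.sum_mul]
      congr 1
      refine Finset.sum_congr rfl fun l _ => ?_
      rw [← Finset.mul_prod_erase _ c (Finset.mem_univ l)]
      field_simp [hc l]
    rw [e2]
    ring
  · rw [hXt]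
    exact Submodule.smul_mem _ _ (sum_mem fun μ _ => sum_mem fun ν _ =>
      Submodule.smul_mem _ _ (gamma_mem_Fil μ))

/-- Both sides are polynomial, hence continuous, in the c_l. Shifting all of them by z makes them
nonzero off a finite set of z, and the identity extends to z = 0 by density. -/
theorem CliffordRel.trace_main (h : CliffordRel γ) (hm : 0 < m)
    (F : Fin (2 * m) → Fin (2 * m) → ℂ) (hF : ∀ μ ν, F ν μ = -F μ ν) (b r κ : ℂ)
    (c s : Fin (2 * m) → ℂ) :
    ((b • 1 + ∑ l, s l • γ l) *
        (κ • ((1 / 2 : ℂ) • (∑ μ, ∑ ν, (F μ ν * (c μ * c ν)) • (γ μ * γ ν)) +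
          r • ∑ μ, ∑ ν, (F μ ν * (c μ * s ν)) • γ μ)) ^ m * chirality γ).trace =
      κ ^ m * (-Complex.I) ^ m *
        (b * ∏ l, c l - r * ∑ l, s l ^ 2 * ∏ k ∈ Finset.univ.erase l, c k) *
        ∑ f : Fin (2 * m) → Fin (2 * m), (epsilon f : ℂ) *
          ∏ j : Fin m, F (f ⟨2 * j, by omega⟩) (f ⟨2 * j + 1, by omega⟩) := by
  let L : ℂ → ℂ := fun z => ((b • 1 + ∑ l, s l • γ l) *
        (κ • ((1 / 2 : ℂ) • (∑ μ, ∑ ν, (F μ ν * ((c μ + z) * (c ν + z))) • (γ μ * γ ν)) +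
          r • ∑ μ, ∑ ν, (F μ ν * ((c μ + z) * s ν)) • γ μ)) ^ m * chirality γ).trace
  let R : ℂ → ℂ := fun z => κ ^ m * (-Complex.I) ^ m *
        (b * ∏ l, (c l + z) - r * ∑ l, s l ^ 2 * ∏ k ∈ Finset.univ.erase l, (c k + z)) *
        ∑ f : Fin (2 * m) → Fin (2 * m), (epsilon f : ℂ) *
          ∏ j : Fin m, F (f ⟨2 * j, by omega⟩) (f ⟨2 * j + 1, by omega⟩)
  have hL : Continuous L := by
    refine Continuous.matrix_trace ?_
    fun_prop
  have hR : Continuous R := by fun_prop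
  have hd : Dense (Set.range fun l => -c l)ᶜ :=
    (Set.finite_range _).countable.dense_compl ℂ
  have hLR : L = R := hL.ext_on hd hR fun z hz =>
    h.trace_main_of_ne_zero hm F hF b r κ (fun l => c l + z) s fun l hl =>
      hz ⟨l, (eq_neg_of_add_eq_zero_right hl).symm⟩
  simpa [L, R] using congrFun hLR 0

end Clifford
end
end LatticeFermion

namespace LatticeFermion
noncomputable section
open scoped Kronecker Matrix ComplexConjugate ComplexOrder

/-! ### The Ward identity and coercivity of the action operator -/

section Reduction

variable {m N : ℕ}

theorem sub_kronecker {l n : Type*} (B B' : Matrix l l ℂ) (C : Matrix n n ℂ) :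
    (B - B') ⊗ₖ C = B ⊗ₖ C - B' ⊗ₖ C := by
  ext ⟨i, j⟩ ⟨k, p⟩
  simp [Matrix.kroneckerMap_apply, sub_mul]

theorem act_act (K K' : Matrix (Comp m N) (Comp m N) ℂ) (u : Comp m N → Grassmann m N) :
    act K (act K' u) = act (K * K') u := by
  ext i
  simp only [act, Finset.smul_sum, smul_smul]
  rw [Finset.sum_comm]
  refine Finset.sum_congr rfl fun k _ => ?_
  rw [← Finset.sum_smul, Matrix.mul_apply]

theorem sum_fibrePairing (f : Site (2 * m) N → ℂ) (v u : Comp m N → Grassmann m N) :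
    ∑ x, f x • fibrePairing v u x = ∑ i : Comp m N, f i.1 • (v i * u i) := by
  rw [Fintype.sum_prod_type]
  exact Finset.sum_congr rfl fun x _ => by rw [fibrePairing, Finset.smul_sum]

theorem sum_fibrePairing_act (f : Site (2 * m) N → ℂ) (K : Matrix (Comp m N) (Comp m N) ℂ) :
    ∑ x, f x • fibrePairing (psiBar m N) (act K (psi m N)) x =
      bilinear (Matrix.diagonal (fun i : Comp m N => f i.1) * K) := by
  rw [sum_fibrePairing, bilinear_apply]
  refine Finset.sum_congr rfl fun i _ => ?_
  rw [act, Finset.mul_sum, Finset.smul_sum]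
  refine Finset.sum_congr rfl fun j _ => ?_
  rw [mul_smul_comm, smul_smul, Matrix.diagonal_mul]
  rfl

theorem sum_fibrePairing_actBar (f : Site (2 * m) N → ℂ)
    (T K : Matrix (Comp m N) (Comp m N) ℂ) :
    ∑ x, f x • fibrePairing (actBar T (psiBar m N)) (act K (psi m N)) x =
      bilinear (Tᴴ * Matrix.diagonal (fun i : Comp m N => f i.1) * K) := by
  rw [sum_fibrePairing, bilinear_apply]
  simp only [act, actBar, Finset.sum_mul_sum, Finset.smul_sum]
  rw [Finset.sum_comm]
  refine Finset.sum_congr rfl fun j _ => ?_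
  rw [Finset.sum_comm]
  refine Finset.sum_congr rfl fun k _ => ?_
  rw [mul_assoc, Matrix.mul_apply, Finset.sum_smul]
  refine Finset.sum_congr rfl fun i _ => ?_
  rw [smul_mul_smul_comm, smul_smul, Matrix.diagonal_mul, Matrix.conjTranspose_apply]
  congr 1
  change f i.1 * (star (T i j) * K i k) = _
  ring

variable (L M r Q : ℝ) (A : Fin (2 * m) → (Fin (2 * m) → ℝ) → ℝ)
  (γ : Fin (2 * m) → Matrix (Fin (2 ^ m)) (Fin (2 ^ m)) ℂ) (N : ℕ) [NeZero N]

theorem action_eq_bilinear :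
    action L M r Q A γ N = bilinear ((spacing L N : ℂ) ^ (2 * m) • actionOp L M r Q A γ N) := by
  have := sum_fibrePairing_act (fun _ => 1) (actionOp L M r Q A γ N)
  simp only [one_smul] at this
  rw [action, this, map_smul]
  simp

/-- The weight a^d enters the action and the observable alike, so it cancels between the inverse and
the insertion. -/
theorem expectation_bilinear (hL : 0 < L) (hH : IsUnit (actionOp L M r Q A γ N).det)
    (K : Matrix (Comp m N) (Comp m N) ℂ) :
    expectation L M r Q A γ N ((spacing L N : ℂ) ^ (2 * m) • bilinear K) =
      -((actionOp L M r Q A γ N)⁻¹ * K).trace := by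
  have ha : (spacing L N : ℂ) ^ (2 * m) ≠ 0 := by
    refine pow_ne_zero _ ?_
    rw [spacing]
    exact_mod_cast (div_pos hL (Nat.cast_pos.mpr (NeZero.pos N))).ne'
  have hdet : IsUnit ((spacing L N : ℂ) ^ (2 * m) • actionOp L M r Q A γ N).det := by
    rw [Matrix.det_smul]
    exact (IsUnit.pow _ (isUnit_iff_ne_zero.mpr ha)).mul hH
  rw [expectation, action_eq_bilinear, ← map_smul, berezin_exp_mul_bilinear hdet]
  have hinv : ((spacing L N : ℂ) ^ (2 * m) • actionOp L M r Q A γ N)⁻¹ =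
      ((spacing L N : ℂ) ^ (2 * m))⁻¹ • (actionOp L M r Q A γ N)⁻¹ := by
    refine Matrix.inv_eq_left_inv ?_
    rw [smul_mul_smul_comm, inv_mul_cancel₀ ha, Matrix.nonsing_inv_mul _ hH, one_smul]
  rw [hinv, smul_mul_smul_comm, inv_mul_cancel₀ ha, one_smul]

variable {N}

theorem prev_next {d : ℕ} (x : Site d N) (μ : Fin d) : prev (next x μ) μ = x := by
  simp [prev, next]

theorem next_prev {d : ℕ} (x : Site d N) (μ : Fin d) : next (prev x μ) μ = x := by
  simp [prev, next]

/-- Translation of sites by one step. -/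
def nextEquiv {d : ℕ} (N : ℕ) [NeZero N] (μ : Fin d) : Site d N ≃ Site d N where
  toFun x := next x μ
  invFun x := prev x μ
  left_inv x := prev_next x μ
  right_inv x := next_prev x μ

theorem translation_mul_diagonal {d : ℕ} (A : Fin d → (Fin d → ℝ) → ℝ) (f : Site d N → ℂ)
    (μ : Fin d) : translation L Q A N μ * Matrix.diagonal f =
      Matrix.diagonal (fun x => f (next x μ)) * translation L Q A N μ := by
  ext x y
  rw [Matrix.mul_diagonal, Matrix.diagonal_mul, translation, Matrix.of_apply]
  split_ifs with h
  · rw [h, mul_comm]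
  · simp

theorem diagonal_mul_translation_conjTranspose {d : ℕ} (A : Fin d → (Fin d → ℝ) → ℝ)
    (f : Site d N → ℂ) (μ : Fin d) :
    (translation L Q A N μ)ᴴ * Matrix.diagonal (fun x => f (next x μ)) =
      Matrix.diagonal f * (translation L Q A N μ)ᴴ := by
  ext x y
  rw [Matrix.mul_diagonal, Matrix.diagonal_mul, Matrix.conjTranspose_apply, translation,
    Matrix.of_apply]
  split_ifs with h
  · rw [h, mul_comm]
  · simp

omit [NeZero N] in
theorem diagonal_fst_eq (f : Site (2 * m) N → ℂ) :
    Matrix.diagonal (fun i : Comp m N => f i.1) =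
      Matrix.diagonal f ⊗ₖ (1 : Matrix (Fin (2 ^ m)) (Fin (2 ^ m)) ℂ) := by
  rw [← Matrix.diagonal_one, Matrix.diagonal_kronecker_diagonal]
  simp

theorem sum_smul_current (μ : Fin (2 * m)) (f : Site (2 * m) N → ℂ) :
    ∑ x, f x • current L Q A γ N μ x =
      bilinear ((1 / 2 : ℂ) • ((Matrix.diagonal f * translation L Q A N μ +
        (translation L Q A N μ)ᴴ * Matrix.diagonal f) ⊗ₖ (chirality γ * γ μ))) := by
  simp only [current, smul_add, Finset.sum_add_distrib, smul_comm _ (1 / 2 : ℂ)]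
  rw [← Finset.smul_sum, ← Finset.smul_sum, act_act, sum_fibrePairing_act,
    sum_fibrePairing_actBar, ← smul_add, map_smul, ← map_add, diagonal_fst_eq, spinOp,
    spinTranslation, Matrix.conjTranspose_kronecker, Matrix.add_kronecker]
  simp only [← Matrix.mul_kronecker_mul, Matrix.conjTranspose_one, one_mul, mul_one]

/-- The divergence, smeared with a function on sites, as a bilinear expression. -/
theorem sum_smul_divergence (f : Site (2 * m) N → ℂ) :
    ∑ x, f x • divergence L M Q A γ N x =
      bilinear (-∑ μ, (derivOp L Q A N μ * Matrix.diagonal f -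
          Matrix.diagonal f * derivOp L Q A N μ) ⊗ₖ (chirality γ * γ μ)
        - (2 * (M : ℂ) * Complex.I) • (Matrix.diagonal f ⊗ₖ chirality γ)) := by
  simp only [divergence, smul_sub, Finset.sum_sub_distrib]
  rw [map_sub, map_smul, map_neg, map_sum]
  congr 1
  · simp only [smul_comm _ (1 / (spacing L N : ℂ)), Finset.smul_sum]
    have hc : ∀ g : Site (2 * m) N → Fin (2 * m) → Grassmann m N,
        ∑ x, ∑ μ, g x μ = ∑ μ, ∑ x, g x μ := fun g => Finset.sum_comm
    rw [hc, hc, ← Finset.sum_sub_distrib, ← Finset.sum_neg_distrib]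
    refine Finset.sum_congr rfl fun μ _ => ?_
    -- Summation by parts on the lattice: reindexing the backward current moves the difference onto
    -- the test function, where it becomes a commutator with D_μ.
    rw [← (nextEquiv N μ).sum_comp (fun x => _ • _ • current L Q A γ N μ (prev x μ))]
    simp only [nextEquiv, Equiv.coe_fn_mk, prev_next]
    rw [← Finset.smul_sum, ← Finset.smul_sum, sum_smul_current,
      sum_smul_current L Q A γ μ (fun x => f (next x μ)), ← map_smul, ← map_smul, ← map_sub,
      ← map_neg, ← translation_mul_diagonal, diagonal_mul_translation_conjTranspose]
    congr 1
    rw [smul_smul, smul_smul, ← smul_sub, ← sub_kronecker, ← Matrix.smul_kronecker, derivOp,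
      smul_mul_assoc, mul_smul_comm, ← smul_sub, ← neg_one_smul ℂ, ← Matrix.smul_kronecker,
      smul_smul]
    congr 1
    rw [show (-1 : ℂ) * (1 / (2 * (spacing L N : ℂ))) = -(1 / (spacing L N : ℂ) * (1 / 2)) by
      ring, neg_smul, ← smul_neg]
    congr 1
    noncomm_ring
  · simp only [smul_comm _ (2 * (M : ℂ) * Complex.I)]
    rw [← Finset.smul_sum, sum_fibrePairing_act, diagonal_fst_eq, spinOp]
    simp only [← Matrix.mul_kronecker_mul, one_mul, mul_one]

theorem kronecker_sum_left {ι l n : Type*} [Fintype ι] (B : ι → Matrix l l ℂ) (C : Matrix n n ℂ) :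
    (∑ i, B i) ⊗ₖ C = ∑ i, B i ⊗ₖ C := by
  ext ⟨i, j⟩ ⟨k, p⟩
  simp [Matrix.kroneckerMap_apply, Matrix.sum_apply, Finset.sum_mul]

/-- Failure of chirality to anticommute with the action is due to the mass and Wilson terms. -/
theorem divergence_operator_eq (hγγ : CliffordRel γ) (Ξ : Matrix (Site (2 * m) N) (Site (2 * m) N) ℂ) :
    -∑ μ, (derivOp L Q A N μ * Ξ - Ξ * derivOp L Q A N μ) ⊗ₖ (chirality γ * γ μ)
        - (2 * (M : ℂ) * Complex.I) • (Ξ ⊗ₖ chirality γ) =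
      -Complex.I • (actionOp L M r Q A γ N * (Ξ ⊗ₖ chirality γ) +
          (Ξ ⊗ₖ chirality γ) * actionOp L M r Q A γ N)
        - (Complex.I * ((r : ℂ) / (2 * (spacing L N : ℂ)))) •
          ((wilsonOp L Q A N * Ξ + Ξ * wilsonOp L Q A N) ⊗ₖ chirality γ) := by
  set H1 := diracOp L Q A γ N with hH1
  have e1 : H1 * (Ξ ⊗ₖ chirality γ) + (Ξ ⊗ₖ chirality γ) * H1 =
      -∑ μ, (derivOp L Q A N μ * Ξ - Ξ * derivOp L Q A N μ) ⊗ₖ (chirality γ * γ μ) := by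
    rw [hH1, diracOp, Finset.sum_mul, Finset.mul_sum, ← Finset.sum_add_distrib,
      ← Finset.sum_neg_distrib]
    refine Finset.sum_congr rfl fun μ _ => ?_
    rw [← Matrix.mul_kronecker_mul, ← Matrix.mul_kronecker_mul, hγγ.mul_chirality,
      sub_kronecker, ← neg_one_smul ℂ (chirality γ * γ μ), Matrix.kronecker_smul,
      neg_one_smul]
    abel
  rw [← e1, actionOp, ← hH1, Matrix.add_kronecker]
  simp only [add_mul, sub_mul, mul_add, mul_sub, smul_mul_assoc, mul_smul_comm, one_mul, mul_one,
    ← Matrix.mul_kronecker_mul]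
  simp only [smul_add, smul_sub, smul_smul]
  have hI : -Complex.I * Complex.I = 1 := by simp
  rw [hI, one_smul, one_smul]
  module

theorem CliffordRel.trace_chirality (hγγ : CliffordRel γ) (hm : 0 < m) :
    (chirality γ).trace = 0 := by
  have := hγγ.trace_Fil (j := 0) (by omega) (one_mem_Fil 0)
  rwa [one_mul] at this

/-- The Ward identity: only the Wilson term contributes to the divergence. -/
theorem expectation_smearedDivergence (hm : 0 < m) (hL : 0 < L) (hγγ : CliffordRel γ)
    (hH : IsUnit (actionOp L M r Q A γ N).det) (ξ : (Fin (2 * m) → ℝ) → ℝ) :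
    expectation L M r Q A γ N (smearedDivergence L M Q A γ ξ N) =
      Complex.I * ((r : ℂ) / (2 * (spacing L N : ℂ))) *
        ((actionOp L M r Q A γ N)⁻¹ *
          ((wilsonOp L Q A N * Matrix.diagonal (fun x => ((ξ (position L N x) : ℝ) : ℂ)) +
            Matrix.diagonal (fun x => ((ξ (position L N x) : ℝ) : ℂ)) * wilsonOp L Q A N) ⊗ₖ
              chirality γ)).trace := by
  rw [smearedDivergence, sum_smul_divergence, expectation_bilinear L M r Q A γ N hL hH,
    divergence_operator_eq L M r Q A γ hγγ]
  set H := actionOp L M r Q A γ N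
  set Ξ : Matrix (Site (2 * m) N) (Site (2 * m) N) ℂ :=
    Matrix.diagonal (fun x => ((ξ (position L N x) : ℝ) : ℂ))
  -- The anticommutator cancels H⁻¹ on either side and leaves tr(Ξ) tr(γ_{d+1}) twice, which is
  -- zero.
  have h1 : (H⁻¹ * (H * (Ξ ⊗ₖ chirality γ) + (Ξ ⊗ₖ chirality γ) * H)).trace = 0 := by
    rw [mul_add, ← mul_assoc, Matrix.nonsing_inv_mul _ hH, one_mul, Matrix.trace_add,
      Matrix.trace_mul_comm H⁻¹, mul_assoc, Matrix.mul_nonsing_inv _ hH, mul_one,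
      Matrix.trace_kronecker, hγγ.trace_chirality γ hm, mul_zero, add_zero]
  rw [mul_sub, mul_smul_comm, mul_smul_comm, Matrix.trace_sub, Matrix.trace_smul,
    Matrix.trace_smul, h1, smul_zero, zero_sub, neg_neg, smul_eq_mul]

omit [NeZero N] in
theorem link_mul_star {d : ℕ} (A : Fin d → (Fin d → ℝ) → ℝ) (μ : Fin d) (x : Site d N) :
    star (link L Q A N μ x) * link L Q A N μ x = 1 := by
  rw [link]
  set I := ∫ s in (0 : ℝ)..spacing L N, A μ (position L N x + Pi.single μ s)
  change (starRingEnd ℂ) _ * _ = 1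
  rw [← Complex.exp_conj, ← Complex.exp_add]
  simp

theorem wrapSign_mul_self {d N : ℕ} (x : Site d N) (μ : Fin d) :
    wrapSign x μ * wrapSign x μ = 1 := by
  rw [wrapSign]; split_ifs <;> simp

theorem star_wrapSign {d N : ℕ} (x : Site d N) (μ : Fin d) :
    star (wrapSign x μ) = wrapSign x μ := by
  rw [wrapSign]; split_ifs <;> simp

theorem translation_unitary {d : ℕ} (A : Fin d → (Fin d → ℝ) → ℝ) (μ : Fin d) :
    (translation L Q A N μ)ᴴ * translation L Q A N μ = 1 := by
  ext x y
  rw [Matrix.mul_apply, ← (nextEquiv N μ).symm.sum_comp,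
    Finset.sum_eq_single x]
  · rw [Matrix.conjTranspose_apply, translation, Matrix.of_apply, Matrix.of_apply]
    simp only [nextEquiv, Equiv.coe_fn_symm_mk, next_prev]
    rw [if_pos trivial, Matrix.one_apply]
    split_ifs with h1 h2 h2
    · rw [star_mul, star_wrapSign, mul_comm (wrapSign _ _), mul_mul_mul_comm, link_mul_star,
        wrapSign_mul_self, one_mul]
    · exact absurd h1.symm h2
    · exact absurd h2.symm h1
    · simp
  · intro z _ hz
    rw [Matrix.conjTranspose_apply, translation, Matrix.of_apply, Matrix.of_apply]
    simp only [nextEquiv, Equiv.coe_fn_symm_mk, next_prev]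
    rw [if_neg (Ne.symm hz), star_zero, zero_mul]
  · simp

theorem spacing_pos (hL : 0 < L) : 0 < spacing L N :=
  div_pos hL (Nat.cast_pos.mpr (NeZero.pos N))

/-- Unitarity of the translation gives 2 - T - T* = (1 - T)*(1 - T). -/
theorem neg_wilsonOp_kronecker_posSemidef :
    ((-wilsonOp L Q A N) ⊗ₖ (1 : Matrix (Fin (2 ^ m)) (Fin (2 ^ m)) ℂ)).PosSemidef := by
  rw [wilsonOp, neg_neg, kronecker_sum_left]
  refine Matrix.posSemidef_sum _ fun μ _ => ?_
  have : ((2 : ℂ) • (1 : Matrix (Site (2 * m) N) (Site (2 * m) N) ℂ)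
      - translation L Q A N μ - (translation L Q A N μ)ᴴ) ⊗ₖ
        (1 : Matrix (Fin (2 ^ m)) (Fin (2 ^ m)) ℂ) =
      ((1 - translation L Q A N μ) ⊗ₖ (1 : Matrix (Fin (2 ^ m)) (Fin (2 ^ m)) ℂ))ᴴ *
        ((1 - translation L Q A N μ) ⊗ₖ (1 : Matrix (Fin (2 ^ m)) (Fin (2 ^ m)) ℂ)) := by
    rw [Matrix.conjTranspose_kronecker, ← Matrix.mul_kronecker_mul, Matrix.conjTranspose_one,
      one_mul]
    congr 1
    rw [Matrix.conjTranspose_sub, Matrix.conjTranspose_one, sub_mul, mul_sub, mul_sub,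
      translation_unitary, one_mul, one_mul, mul_one, two_smul]
    abel
  rw [this]
  exact Matrix.posSemidef_conjTranspose_mul_self _

theorem derivOp_conjTranspose {d : ℕ} (A : Fin d → (Fin d → ℝ) → ℝ) (μ : Fin d) :
    (derivOp L Q A N μ)ᴴ = -derivOp L Q A N μ := by
  rw [derivOp, Matrix.conjTranspose_smul, Matrix.conjTranspose_sub,
    Matrix.conjTranspose_conjTranspose, ← smul_neg, neg_sub]
  congr 1
  simp

theorem diracOp_conjTranspose (hγ : ∀ μ, (γ μ).conjTranspose = -γ μ) :
    (diracOp L Q A γ N)ᴴ = diracOp L Q A γ N := by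
  rw [diracOp, Matrix.conjTranspose_sum]
  refine Finset.sum_congr rfl fun μ _ => ?_
  rw [Matrix.conjTranspose_kronecker, derivOp_conjTranspose, hγ, ← neg_one_smul ℂ,
    ← neg_one_smul ℂ (γ μ), Matrix.smul_kronecker, Matrix.kronecker_smul, smul_smul]
  simp

/-- D_μ and γ_μ are both anti-hermitian, so the Dirac operator is hermitian and i times it drops out
of H + H*. Only the mass and the nonnegative Wilson term remain. -/
theorem actionOp_add_conjTranspose (hγ : ∀ μ, (γ μ).conjTranspose = -γ μ) :
    actionOp L M r Q A γ N + (actionOp L M r Q A γ N)ᴴ - ((2 * M : ℝ) : ℂ) • 1 =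
      ((r / spacing L N : ℝ) : ℂ) •
        ((-wilsonOp L Q A N) ⊗ₖ (1 : Matrix (Fin (2 ^ m)) (Fin (2 ^ m)) ℂ)) := by
  have hW := (neg_wilsonOp_kronecker_posSemidef (m := m) (N := N) L Q A).1
  have e : (-wilsonOp L Q A N) ⊗ₖ (1 : Matrix (Fin (2 ^ m)) (Fin (2 ^ m)) ℂ) =
      -(wilsonOp L Q A N ⊗ₖ (1 : Matrix (Fin (2 ^ m)) (Fin (2 ^ m)) ℂ)) := by
    rw [← neg_one_smul ℂ, Matrix.smul_kronecker, neg_one_smul]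
  rw [e] at hW ⊢
  have hW' : (wilsonOp L Q A N ⊗ₖ (1 : Matrix (Fin (2 ^ m)) (Fin (2 ^ m)) ℂ))ᴴ =
      wilsonOp L Q A N ⊗ₖ (1 : Matrix (Fin (2 ^ m)) (Fin (2 ^ m)) ℂ) := by
    rw [Matrix.IsHermitian, Matrix.conjTranspose_neg] at hW
    exact neg_injective hW
  rw [actionOp, Matrix.conjTranspose_sub, Matrix.conjTranspose_add, Matrix.conjTranspose_smul,
    Matrix.conjTranspose_smul, Matrix.conjTranspose_smul, hW', diracOp_conjTranspose L Q A γ hγ,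
    Matrix.conjTranspose_one]
  have h1 : star ((r : ℂ) / (2 * (spacing L N : ℂ))) = (r : ℂ) / (2 * (spacing L N : ℂ)) := by
    have : (r : ℂ) / (2 * (spacing L N : ℂ)) = ((r / (2 * spacing L N) : ℝ) : ℂ) := by push_cast; rfl
    rw [this]
    exact Complex.conj_ofReal _
  have h2 : star (M : ℂ) = M := Complex.conj_ofReal M
  have h3 : star Complex.I = -Complex.I := Complex.conj_I
  have h4 : ((r / spacing L N : ℝ) : ℂ) = 2 * ((r : ℂ) / (2 * (spacing L N : ℂ))) := by
    push_cast
    field_simp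
  rw [h1, h2, h3, h4]
  push_cast
  module

/-- The real part of the action operator is at least `M`. -/
theorem actionOp_coercive (hL : 0 < L) (hr : 0 < r) (hγ : ∀ μ, (γ μ).conjTranspose = -γ μ)
    (u : Comp m N → ℂ) :
    M * ‖WithLp.toLp 2 u‖ ^ 2 ≤ (star u ⬝ᵥ (actionOp L M r Q A γ N *ᵥ u)).re := by
  set H := actionOp L M r Q A γ N with hH
  have hP : (((r / spacing L N : ℝ) : ℂ) •
        ((-wilsonOp L Q A N) ⊗ₖ (1 : Matrix (Fin (2 ^ m)) (Fin (2 ^ m)) ℂ))).PosSemidef := by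
    refine (neg_wilsonOp_kronecker_posSemidef (m := m) (N := N) L Q A).smul ?_
    exact_mod_cast (div_pos hr (spacing_pos L hL)).le
  rw [← actionOp_add_conjTranspose L M r Q A γ hγ, ← hH] at hP
  have h0 := hP.re_dotProduct_nonneg u
  rw [Matrix.sub_mulVec, Matrix.add_mulVec, dotProduct_sub, dotProduct_add, Matrix.smul_mulVec,
    Matrix.one_mulVec, dotProduct_smul] at h0
  have h1 : star u ⬝ᵥ (Hᴴ *ᵥ u) = star (star u ⬝ᵥ (H *ᵥ u)) := by
    rw [← Matrix.star_dotProduct, Matrix.star_mulVec, Matrix.dotProduct_mulVec]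
  have h2 : star u ⬝ᵥ u = ((‖WithLp.toLp 2 u‖ ^ 2 : ℝ) : ℂ) := by
    rw [EuclideanSpace.norm_sq_eq]
    simp [dotProduct, Complex.conj_mul']
  rw [h1, h2] at h0
  simp at h0
  rw [← Complex.ofReal_pow, Complex.ofReal_re] at h0
  linarith

theorem actionOp_isUnit_det (hL : 0 < L) (hM : 0 < M) (hr : 0 < r)
    (hγ : ∀ μ, (γ μ).conjTranspose = -γ μ) : IsUnit (actionOp L M r Q A γ N).det := by
  rw [← Matrix.isUnit_iff_isUnit_det, ← Matrix.mulVec_injective_iff_isUnit]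
  intro u v huv
  have h := actionOp_coercive L M r Q A γ hL hr hγ (u - v)
  rw [Matrix.mulVec_sub, huv, sub_self, dotProduct_zero, Complex.zero_re] at h
  have h3 : ‖WithLp.toLp 2 (u - v)‖ ^ 2 ≤ 0 := by nlinarith
  have h4 : WithLp.toLp 2 (u - v) = 0 := by
    rw [← norm_eq_zero]
    exact pow_eq_zero_iff two_ne_zero |>.mp (le_antisymm h3 (sq_nonneg _))
  exact sub_eq_zero.mp ((WithLp.toLp_eq_zero 2).mp h4)

theorem norm_dotProduct_le {ι : Type*} [Fintype ι] (e w : ι → ℂ) :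
    ‖star e ⬝ᵥ w‖ ≤ ‖WithLp.toLp 2 e‖ * ‖WithLp.toLp 2 w‖ := by
  have := norm_inner_le_norm (𝕜 := ℂ) (WithLp.toLp 2 e) (WithLp.toLp 2 w)
  rw [EuclideanSpace.inner_eq_star_dotProduct, dotProduct_comm] at this
  exact this

/-- Coercivity and Cauchy–Schwarz give ‖H⁻¹w‖ ≤ ‖w‖/M, uniformly in the lattice spacing and the
gauge field. This controls the tail of the Neumann series. -/
theorem norm_actionOp_inv_le (hL : 0 < L) (hM : 0 < M) (hr : 0 < r)
    (hγ : ∀ μ, (γ μ).conjTranspose = -γ μ) (e w : Comp m N → ℂ) :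
    ‖star e ⬝ᵥ ((actionOp L M r Q A γ N)⁻¹ *ᵥ w)‖ ≤
      ‖WithLp.toLp 2 e‖ * ‖WithLp.toLp 2 w‖ / M := by
  have hU := actionOp_isUnit_det L M r Q A γ hL hM hr hγ (N := N)
  set H := actionOp L M r Q A γ N with hH
  set v := H⁻¹ *ᵥ w with hv
  have hw : H *ᵥ v = w := by
    rw [hv, Matrix.mulVec_mulVec, Matrix.mul_nonsing_inv _ hU, Matrix.one_mulVec]
  have h1 := actionOp_coercive L M r Q A γ hL hr hγ v
  rw [← hH, hw] at h1
  have h2 := (Complex.re_le_norm _).trans (norm_dotProduct_le v w)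
  have h3 : ‖WithLp.toLp 2 v‖ ≤ ‖WithLp.toLp 2 w‖ / M := by
    rw [le_div_iff₀ hM]
    rcases (norm_nonneg (WithLp.toLp 2 v)).eq_or_lt with h0 | h0
    · rw [← h0, zero_mul]; exact norm_nonneg _
    · nlinarith
  refine (norm_dotProduct_le e v).trans ?_
  rw [mul_div_assoc]
  exact mul_le_mul_of_nonneg_left h3 (norm_nonneg _)

end Reduction
end
end LatticeFermion

namespace LatticeFermion
noncomputable section
open scoped Kronecker Matrix ComplexConjugate

/-! ### Smooth families in the lattice spacing and covariant differences -/

section SmoothFamilies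

open scoped ContDiff Topology

/-- Differentiation under the integral sign, iterated. The codomain is quantified inside the
induction because each derivative takes values in a new space of linear maps. -/
theorem contDiff_nat_integral {E : Type} [NormedAddCommGroup E] [NormedSpace ℝ E]
    [ProperSpace E] (n : ℕ) :
    ∀ {F : Type} [NormedAddCommGroup F] [NormedSpace ℝ F] [CompleteSpace F] (f : E × ℝ → F),
      ContDiff ℝ ∞ f → ContDiff ℝ n (fun x => ∫ t in (0 : ℝ)..1, f (x, t)) := by
  induction n with
  | zero =>
    intro F _ _ _ f hf
    rw [Nat.cast_zero, contDiff_zero]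
    have hc : Continuous f := hf.continuous
    exact intervalIntegral.continuous_parametric_intervalIntegral_of_continuous' (by fun_prop) 0 1
  | succ n ih =>
    intro F _ _ _ f hf
    rw [Nat.cast_add, Nat.cast_one, contDiff_succ_iff_hasFDerivAt]
    let f' : E × ℝ → E →L[ℝ] F := fun p => (fderiv ℝ f p).comp (ContinuousLinearMap.inl ℝ E ℝ)
    have hf' : ContDiff ℝ ∞ f' :=
      (hf.fderiv_right (m := ∞) (by simp)).clm_comp contDiff_const
    refine ⟨fun x => ∫ t in (0 : ℝ)..1, f' (x, t), ih f' hf', fun x => ?_⟩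
    have hc : Continuous f := hf.continuous
    have hc' : Continuous f' := hf'.continuous
    obtain ⟨C, hC⟩ := ((isCompact_closedBall x 1).prod
      (isCompact_Icc (a := (0 : ℝ)) (b := 1))).exists_bound_of_continuousOn hc'.continuousOn
    refine intervalIntegral.hasFDerivAt_integral_of_dominated_of_fderiv_le (bound := fun _ => C)
      (F := fun x t => f (x, t)) (F' := fun x t => f' (x, t)) (Metric.closedBall_mem_nhds x one_pos)
      ?_ ?_ ?_ ?_ ?_ ?_
    · refine Filter.Eventually.of_forall fun y => ?_
      exact Continuous.aestronglyMeasurable (by fun_prop)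
    · exact Continuous.intervalIntegrable (by fun_prop) _ _
    · exact Continuous.aestronglyMeasurable (by fun_prop)
    · refine Filter.Eventually.of_forall fun t ht y hy => hC (y, t) ⟨hy, ?_⟩
      rw [Set.uIoc_of_le zero_le_one] at ht
      exact ⟨ht.1.le, ht.2⟩
    · exact intervalIntegrable_const
    · refine Filter.Eventually.of_forall fun t _ y _ => ?_
      have h1 : HasFDerivAt f (fderiv ℝ f (y, t)) (y, t) :=
        (hf.differentiable (by simp)).differentiableAt.hasFDerivAt
      exact h1.comp y (hasFDerivAt_prodMk_left y t)

theorem contDiff_integral {E F : Type} [NormedAddCommGroup E] [NormedSpace ℝ E]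
    [ProperSpace E] [NormedAddCommGroup F] [NormedSpace ℝ F] [CompleteSpace F] {f : E × ℝ → F}
    (hf : ContDiff ℝ ∞ f) : ContDiff ℝ ∞ (fun x => ∫ t in (0 : ℝ)..1, f (x, t)) :=
  contDiff_infty.mpr fun n => contDiff_nat_integral n f hf

variable {d : ℕ}

/-- A smooth family, parametrized by the lattice spacing, of functions on the torus. -/
structure SmoothFamily (L : ℝ) (g : ℝ × (Fin d → ℝ) → ℂ) : Prop where
  contDiff : ContDiff ℝ ∞ g
  periodic : ∀ (μ : Fin d) (a : ℝ) (x : Fin d → ℝ), g (a, x + Pi.single μ L) = g (a, x)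

/-- The difference quotient `(g(a, x) - g(0, x)) / a`, extended smoothly to `a = 0`. -/
def divParam (g : ℝ × (Fin d → ℝ) → ℂ) (p : ℝ × (Fin d → ℝ)) : ℂ :=
  ∫ t in (0 : ℝ)..1, fderiv ℝ g (t * p.1, p.2) (1, 0)

variable {L : ℝ} {g h : ℝ × (Fin d → ℝ) → ℂ}

theorem SmoothFamily.fderiv_periodic (hg : SmoothFamily L g) (μ : Fin d) (a : ℝ)
    (x : Fin d → ℝ) : fderiv ℝ g (a, x + Pi.single μ L) = fderiv ℝ g (a, x) := by
  have h1 : (fun p : ℝ × (Fin d → ℝ) => g (p + (0, Pi.single μ L))) = g := by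
    ext p
    have h0 : p + (0, Pi.single μ L) = (p.1, p.2 + Pi.single μ L) := by ext <;> simp
    rw [h0]
    exact hg.periodic μ p.1 p.2
  have h2 := fderiv_comp_add_right (𝕜 := ℝ) (f := g) (x := (a, x)) (0, Pi.single μ L)
  rw [h1] at h2
  rw [h2]
  simp

theorem SmoothFamily.divParam (hg : SmoothFamily L g) : SmoothFamily L (divParam g) where
  contDiff := by
    have h1 : ContDiff ℝ ∞ (fderiv ℝ g) := hg.contDiff.fderiv_right (by simp)
    refine contDiff_integral (f := fun q : (ℝ × (Fin d → ℝ)) × ℝ =>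
      fderiv ℝ g (q.2 * q.1.1, q.1.2) (1, 0)) ?_
    exact ContDiff.clm_apply (h1.comp (by fun_prop)) contDiff_const
  periodic μ a x := by
    simp only [LatticeFermion.divParam, hg.fderiv_periodic]

/-- Hadamard's lemma in the variable a: integrate the derivative along the segment from 0 to a. It
makes the Taylor remainder another smooth periodic family, so expansions in a can be iterated. -/
theorem SmoothFamily.eq_add_divParam (hg : SmoothFamily L g) (a : ℝ) (x : Fin d → ℝ) :
    g (a, x) = g (0, x) + a * LatticeFermion.divParam g (a, x) := by
  have hd : ∀ t : ℝ, HasDerivAt (fun t : ℝ => g (t * a, x))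
      (fderiv ℝ g (t * a, x) (a, 0)) t := by
    intro t
    have h1 : HasFDerivAt g (fderiv ℝ g (t * a, x)) (t * a, x) :=
      (hg.contDiff.differentiable (by simp)).differentiableAt.hasFDerivAt
    have h2 : HasDerivAt (fun t : ℝ => (t * a, x)) (a, (0 : Fin d → ℝ)) t := by
      have := (hasDerivAt_id t).mul_const a
      rw [one_mul] at this
      exact this.prodMk (hasDerivAt_const t x)
    exact h1.comp_hasDerivAt t h2
  have hc : Continuous fun t : ℝ => fderiv ℝ g (t * a, x) (a, 0) := by
    have h1 : Continuous (fderiv ℝ g) := (hg.contDiff.fderiv_right (m := ∞) (by simp)).continuous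
    fun_prop
  have h3 := intervalIntegral.integral_eq_sub_of_hasDerivAt (a := 0) (b := 1)
    (fun t _ => hd t) (hc.intervalIntegrable _ _)
  rw [one_mul, zero_mul] at h3
  have h4 : ∀ t : ℝ, fderiv ℝ g (t * a, x) (a, 0) = a * fderiv ℝ g (t * a, x) (1, 0) := by
    intro t
    have : ((a, 0) : ℝ × (Fin d → ℝ)) = a • (1, 0) := by simp
    rw [this, map_smul]
    simp
  simp only [h4] at h3
  rw [intervalIntegral.integral_const_mul] at h3
  rw [LatticeFermion.divParam, h3]
  ring

theorem SmoothFamily.divParam_zero (x : Fin d → ℝ) :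
    LatticeFermion.divParam g (0, x) = fderiv ℝ g (0, x) (1, 0) := by
  simp [LatticeFermion.divParam]

theorem SmoothFamily.const (c : ℂ) : SmoothFamily L (fun _ : ℝ × (Fin d → ℝ) => c) :=
  ⟨contDiff_const, fun _ _ _ => rfl⟩

theorem SmoothFamily.add (hg : SmoothFamily L g) (hh : SmoothFamily L h) :
    SmoothFamily L (fun p => g p + h p) :=
  ⟨hg.contDiff.add hh.contDiff, fun μ a x => by rw [hg.periodic, hh.periodic]⟩

theorem SmoothFamily.sub (hg : SmoothFamily L g) (hh : SmoothFamily L h) :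
    SmoothFamily L (fun p => g p - h p) :=
  ⟨hg.contDiff.sub hh.contDiff, fun μ a x => by rw [hg.periodic, hh.periodic]⟩

theorem SmoothFamily.mul (hg : SmoothFamily L g) (hh : SmoothFamily L h) :
    SmoothFamily L (fun p => g p * h p) :=
  ⟨hg.contDiff.mul hh.contDiff, fun μ a x => by rw [hg.periodic, hh.periodic]⟩

theorem SmoothFamily.bounded (hg : SmoothFamily L g) :
    ∃ C, ∀ a ∈ Set.Icc 0 L, ∀ x ∈ Set.univ.pi fun _ : Fin d => Set.Icc 0 L, ‖g (a, x)‖ ≤ C := by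
  obtain ⟨C, hC⟩ := ((isCompact_Icc (a := (0 : ℝ)) (b := L)).prod
    (isCompact_univ_pi fun _ : Fin d => isCompact_Icc (a := (0 : ℝ)) (b := L))).exists_bound_of_continuousOn
      hg.contDiff.continuous.continuousOn
  exact ⟨C, fun a ha x hx => hC (a, x) ⟨ha, hx⟩⟩

theorem SmoothOnTorus.smoothFamily {f : (Fin d → ℝ) → ℝ} (hf : SmoothOnTorus L f) :
    SmoothFamily L (fun p : ℝ × (Fin d → ℝ) => ((f p.2 : ℝ) : ℂ)) where
  contDiff := Complex.ofRealCLM.contDiff.comp (hf.1.comp contDiff_snd)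
  periodic μ a x := by rw [hf.2]

theorem SmoothOnTorus.fderiv_apply {f : (Fin d → ℝ) → ℝ} (hf : SmoothOnTorus L f)
    (v : Fin d → ℝ) : SmoothOnTorus L (fun x => fderiv ℝ f x v) where
  left := ContDiff.clm_apply (hf.1.fderiv_right (by simp)) contDiff_const
  right μ x := by
    have h1 : (fun y => f (y + Pi.single μ L)) = f := funext fun y => hf.2 μ y
    have h2 := fderiv_comp_add_right (𝕜 := ℝ) (f := f) (x := x) (Pi.single μ L)
    rw [h1] at h2
    exact congrArg (fun φ => φ v) h2.symm

theorem smoothFamily_fieldStrength {A : Fin d → (Fin d → ℝ) → ℝ}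
    (hA : ∀ μ, SmoothOnTorus L (A μ)) (μ ν : Fin d) :
    SmoothFamily L (fun p : ℝ × (Fin d → ℝ) => ((fieldStrength A μ ν p.2 : ℝ) : ℂ)) := by
  refine SmoothOnTorus.smoothFamily ⟨?_, fun l x => ?_⟩
  · exact ((hA ν).fderiv_apply _).1.sub ((hA μ).fderiv_apply _).1
  · simp only [fieldStrength]
    exact congrArg₂ (· - ·) (((hA ν).fderiv_apply _).2 l x) (((hA μ).fderiv_apply _).2 l x)

/-- The parallel transport along the segment of (signed) length `b` in direction `μ`. -/
def transport (Q : ℝ) (A : Fin d → (Fin d → ℝ) → ℝ) (μ : Fin d) (b : ℝ) (x : Fin d → ℝ) : ℂ :=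
  Complex.exp (-Complex.I * Q * ((∫ s in (0 : ℝ)..b, A μ (x + Pi.single μ s) : ℝ) : ℂ))

variable (Q : ℝ) {A : Fin d → (Fin d → ℝ) → ℝ}

theorem continuous_shift (μ : Fin d) : Continuous fun s : ℝ => (Pi.single μ s : Fin d → ℝ) :=
  continuous_pi fun i => by
    by_cases h : i = μ
    · subst h; simpa using continuous_id'
    · simp only [Pi.single_eq_of_ne h]; exact continuous_const

theorem contDiff_single (μ : Fin d) : ContDiff ℝ ∞ fun s : ℝ => (Pi.single μ s : Fin d → ℝ) :=
  (ContinuousLinearMap.single ℝ (fun _ : Fin d => ℝ) μ).contDiff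

theorem smoothFamily_transport (hA : ∀ μ, SmoothOnTorus L (A μ)) (μ : Fin d) (σ : ℝ) :
    SmoothFamily L (fun p : ℝ × (Fin d → ℝ) => transport Q A μ (σ * p.1) p.2) where
  contDiff := by
    -- Rescaling to the fixed interval [0, 1] puts all the dependence on a into the integrand, where
    -- smoothness of parametric integrals applies.
    have e : ∀ p : ℝ × (Fin d → ℝ), ∫ s in (0 : ℝ)..σ * p.1, A μ (p.2 + Pi.single μ s) =
        (σ * p.1) * ∫ t in (0 : ℝ)..1, A μ (p.2 + Pi.single μ (σ * p.1 * t)) := by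
      intro p
      have := intervalIntegral.mul_integral_comp_mul_left (a := 0) (b := 1)
        (f := fun s => A μ (p.2 + Pi.single μ s)) (c := σ * p.1)
      rw [this, mul_zero, mul_one]
    simp only [transport, e]
    have h1 : ContDiff ℝ ∞ fun p : ℝ × (Fin d → ℝ) =>
        ∫ t in (0 : ℝ)..1, A μ (p.2 + Pi.single μ (σ * p.1 * t)) := by
      refine contDiff_integral (f := fun q : (ℝ × (Fin d → ℝ)) × ℝ =>
        A μ (q.1.2 + Pi.single μ (σ * q.1.1 * q.2))) ((hA μ).1.comp ?_)
      exact ContDiff.add (by fun_prop) ((contDiff_single μ).comp (by fun_prop))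
    refine ContDiff.cexp (contDiff_const.mul (Complex.ofRealCLM.contDiff.comp ?_))
    exact ContDiff.mul (by fun_prop) h1
  periodic ν a x := by
    simp only [transport]
    congr 4
    ext s
    rw [add_right_comm, (hA μ).2]

/-- The covariant translation by `σ a` in direction `μ`. -/
def famTrans (Q : ℝ) (A : Fin d → (Fin d → ℝ) → ℝ) (μ : Fin d) (σ : ℝ)
    (g : ℝ × (Fin d → ℝ) → ℂ) (p : ℝ × (Fin d → ℝ)) : ℂ :=
  transport Q A μ (σ * p.1) p.2 * g (p.1, p.2 + Pi.single μ (σ * p.1))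

theorem SmoothFamily.famTrans (hA : ∀ μ, SmoothOnTorus L (A μ)) (hg : SmoothFamily L g)
    (μ : Fin d) (σ : ℝ) : SmoothFamily L (famTrans Q A μ σ g) := by
  refine SmoothFamily.mul (smoothFamily_transport Q hA μ σ) ⟨hg.contDiff.comp ?_, fun ν a x => ?_⟩
  · exact contDiff_fst.prodMk (contDiff_snd.add ((contDiff_single μ).comp (by fun_prop)))
  · simp only
    rw [add_right_comm, hg.periodic]

/-- The covariant difference quotient in direction `μ`. -/
def famDiff (Q : ℝ) (A : Fin d → (Fin d → ℝ) → ℝ) (μ : Fin d) (σ : ℝ)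
    (g : ℝ × (Fin d → ℝ) → ℂ) : ℝ × (Fin d → ℝ) → ℂ :=
  divParam (fun p => LatticeFermion.famTrans Q A μ σ g p - g p)

theorem SmoothFamily.famDiff (hA : ∀ μ, SmoothOnTorus L (A μ)) (hg : SmoothFamily L g)
    (μ : Fin d) (σ : ℝ) : SmoothFamily L (famDiff Q A μ σ g) :=
  ((hg.famTrans Q hA μ σ).sub hg).divParam

theorem transport_zero (μ : Fin d) (x : Fin d → ℝ) : transport Q A μ 0 x = 1 := by
  simp [transport]

theorem famTrans_zero (μ : Fin d) (σ : ℝ) (x : Fin d → ℝ) :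
    famTrans Q A μ σ g (0, x) = g (0, x) := by
  simp [LatticeFermion.famTrans, transport_zero]

theorem SmoothFamily.famTrans_eq (hA : ∀ μ, SmoothOnTorus L (A μ)) (hg : SmoothFamily L g)
    (μ : Fin d) (σ a : ℝ) (x : Fin d → ℝ) :
    LatticeFermion.famTrans Q A μ σ g (a, x) =
      g (a, x) + a * LatticeFermion.famDiff Q A μ σ g (a, x) := by
  have := ((hg.famTrans Q hA μ σ).sub hg).eq_add_divParam a x
  rw [famTrans_zero, sub_self, zero_add] at this
  rw [LatticeFermion.famDiff, ← this]
  ring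

/-- The covariant derivative in the continuum. -/
def covDeriv (Q : ℝ) (A : Fin d → (Fin d → ℝ) → ℝ) (μ : Fin d) (f : (Fin d → ℝ) → ℂ)
    (x : Fin d → ℝ) : ℂ :=
  fderiv ℝ f x (Pi.single μ 1) - Complex.I * Q * A μ x * f x

/-- Differentiate the covariant translation at a = 0: the shift contributes σ∂_μ and the parallel
transport contributes -iQσA_μ. -/
theorem SmoothFamily.famDiff_zero (hA : ∀ μ, SmoothOnTorus L (A μ)) (hg : SmoothFamily L g)
    (μ : Fin d) (σ : ℝ) (x : Fin d → ℝ) :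
    LatticeFermion.famDiff Q A μ σ g (0, x) = σ * covDeriv Q A μ (fun y => g (0, y)) x := by
  have hdg : HasFDerivAt g (fderiv ℝ g (0, x)) (0, x) :=
    (hg.contDiff.differentiable (by simp)).differentiableAt.hasFDerivAt
  have hG := (hg.famTrans Q hA μ σ).sub hg
  have hdG := ((hG.contDiff.differentiable (by simp)).differentiableAt (x := (0, x))).hasFDerivAt
  have hpath : HasDerivAt (fun t : ℝ => (t, x)) ((1 : ℝ), (0 : Fin d → ℝ)) 0 :=
    (hasDerivAt_id (0 : ℝ)).prodMk (hasDerivAt_const 0 x)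
  have h1 := hdG.comp_hasDerivAt (0 : ℝ) hpath
  have hσ : HasDerivAt (fun t : ℝ => σ * t) σ 0 := by
    simpa using (hasDerivAt_id (0 : ℝ)).const_mul σ
  have hshift : HasDerivAt (fun t : ℝ => x + Pi.single μ (σ * t)) (Pi.single μ σ) 0 := by
    refine HasDerivAt.const_add x ?_
    exact (ContinuousLinearMap.single ℝ (fun _ : Fin d => ℝ) μ).hasFDerivAt.comp_hasDerivAt 0 hσ
  have hpath2 : HasDerivAt (fun t : ℝ => (t, x + Pi.single μ (σ * t)))
      ((1 : ℝ), (Pi.single μ σ : Fin d → ℝ)) 0 := (hasDerivAt_id (0 : ℝ)).prodMk hshift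
  have h2 : HasDerivAt (fun t : ℝ => g (t, x + Pi.single μ (σ * t)))
      (fderiv ℝ g (0, x) (1, Pi.single μ σ)) 0 := by
    refine HasFDerivAt.comp_hasDerivAt (0 : ℝ) ?_ hpath2
    simpa using hdg
  have h3 : HasDerivAt (fun t : ℝ => g (t, x)) (fderiv ℝ g (0, x) (1, 0)) 0 :=
    hdg.comp_hasDerivAt (0 : ℝ) hpath
  have hAc : Continuous fun s : ℝ => A μ (x + Pi.single μ s) :=
    (hA μ).1.continuous.comp (continuous_const.add (continuous_shift μ))
  have h4 : HasDerivAt (fun b : ℝ => ∫ s in (0 : ℝ)..b, A μ (x + Pi.single μ s)) (A μ x) (σ * 0) := by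
    have := intervalIntegral.integral_hasDerivAt_right (hAc.intervalIntegrable 0 (σ * 0))
      (hAc.stronglyMeasurableAtFilter _ _) hAc.continuousAt
    simpa using this
  have h5 : HasDerivAt (fun t : ℝ => transport Q A μ (σ * t) x)
      (-Complex.I * Q * (A μ x * σ : ℝ)) 0 := by
    have h6 := ((h4.comp (0 : ℝ) hσ).ofReal_comp.const_mul (-Complex.I * Q)).cexp
    simpa [transport] using h6
  have h7 := (h5.mul h2).sub h3
  have h8 := h1.unique h7
  rw [LatticeFermion.famDiff, divParam_zero, h8, covDeriv]
  have h9 : fderiv ℝ (fun y => g (0, y)) x (Pi.single μ 1) = fderiv ℝ g (0, x) (0, Pi.single μ 1) := by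
    have := hdg.comp x (hasFDerivAt_prodMk_right (0 : ℝ) x)
    rw [show (fun y => g (0, y)) = g ∘ fun y => ((0 : ℝ), y) from rfl, this.fderiv]
    simp
  have h10 : ((1 : ℝ), (Pi.single μ σ : Fin d → ℝ)) =
      (1, 0) + σ • ((0 : ℝ), (Pi.single μ 1 : Fin d → ℝ)) := by
    rw [Prod.smul_mk, Prod.mk_add_mk, ← Pi.single_smul]
    simp
  rw [h9, h10, map_add, map_smul]
  simp [transport_zero]
  ring

theorem fderiv_covDeriv (hA : ∀ μ, SmoothOnTorus L (A μ)) {f : (Fin d → ℝ) → ℂ}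
    (hf : ContDiff ℝ ∞ f) (ν : Fin d) (x v : Fin d → ℝ) :
    fderiv ℝ (covDeriv Q A ν f) x v = fderiv ℝ (fderiv ℝ f) x v (Pi.single ν 1) -
      Complex.I * Q * ((fderiv ℝ (A ν) x v : ℝ) * f x + A ν x * fderiv ℝ f x v) := by
  have hf1 : HasFDerivAt f (fderiv ℝ f x) x :=
    (hf.differentiable (by simp)).differentiableAt.hasFDerivAt
  have hf2 : HasFDerivAt (fderiv ℝ f) (fderiv ℝ (fderiv ℝ f) x) x :=
    ((hf.fderiv_right (m := ∞) (by simp)).differentiable (by simp)).differentiableAt.hasFDerivAt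
  have hA1 : HasFDerivAt (A ν) (fderiv ℝ (A ν) x) x :=
    ((hA ν).1.differentiable (by simp)).differentiableAt.hasFDerivAt
  have hA2 : HasFDerivAt (fun y => ((A ν y : ℝ) : ℂ))
      (Complex.ofRealCLM.comp (fderiv ℝ (A ν) x)) x :=
    Complex.ofRealCLM.hasFDerivAt.comp x hA1
  have h := (hf2.clm_apply (hasFDerivAt_const (Pi.single ν (1 : ℝ)) x)).sub
    ((hA2.const_mul (Complex.I * Q)).mul hf1)
  have e : fderiv ℝ (covDeriv Q A ν f) x = _ := h.fderiv
  rw [e]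
  simp
  ring

theorem covDeriv_commutator (hA : ∀ μ, SmoothOnTorus L (A μ)) {f : (Fin d → ℝ) → ℂ}
    (hf : ContDiff ℝ ∞ f) (μ ν : Fin d) (x : Fin d → ℝ) :
    covDeriv Q A μ (covDeriv Q A ν f) x - covDeriv Q A ν (covDeriv Q A μ f) x =
      -Complex.I * Q * fieldStrength A μ ν x * f x := by
  have hs : fderiv ℝ (fderiv ℝ f) x (Pi.single μ 1) (Pi.single ν 1) =
      fderiv ℝ (fderiv ℝ f) x (Pi.single ν 1) (Pi.single μ 1) :=
    (hf.contDiffAt.isSymmSndFDerivAt (by simp; exact WithTop.coe_le_coe.mpr le_top)).eq _ _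
  have e : ∀ (μ : Fin d) (f : (Fin d → ℝ) → ℂ), covDeriv Q A μ f x =
      fderiv ℝ f x (Pi.single μ 1) - Complex.I * Q * A μ x * f x := fun _ _ => rfl
  rw [e μ (covDeriv Q A ν f), e ν (covDeriv Q A μ f), fderiv_covDeriv Q hA hf,
    fderiv_covDeriv Q hA hf, hs]
  simp only [covDeriv, fieldStrength]
  push_cast
  ring

/-- Curvature is the failure of parallel transports around a small plaquette to commute. With T = 1
+ aD the commutator is a² times that of the difference quotients, whose value at a = 0 is the
continuum commutator -iQF. -/
theorem SmoothFamily.famTrans_commutator (hA : ∀ μ, SmoothOnTorus L (A μ))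
    (hg : SmoothFamily L g) (μ ν : Fin d) (σ τ : ℝ) :
    ∃ k, SmoothFamily L k ∧ ∀ a x,
      LatticeFermion.famTrans Q A μ σ (LatticeFermion.famTrans Q A ν τ g) (a, x) -
        LatticeFermion.famTrans Q A ν τ (LatticeFermion.famTrans Q A μ σ g) (a, x) =
      (a : ℂ) ^ 2 * (σ * τ * (-Complex.I * Q * fieldStrength A μ ν x) * g (a, x) +
        a * k (a, x)) := by
  have key : ∀ (μ ν : Fin d) (σ τ : ℝ) (a : ℝ) (x : Fin d → ℝ),
      LatticeFermion.famTrans Q A μ σ (LatticeFermion.famTrans Q A ν τ g) (a, x) =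
        g (a, x) + a * LatticeFermion.famDiff Q A μ σ g (a, x) +
        a * (LatticeFermion.famDiff Q A ν τ g (a, x) +
          a * LatticeFermion.famDiff Q A μ σ (LatticeFermion.famDiff Q A ν τ g) (a, x)) := by
    intro μ ν σ τ a x
    rw [← hg.famTrans_eq Q hA, ← (hg.famDiff Q hA ν τ).famTrans_eq Q hA]
    simp only [LatticeFermion.famTrans]
    have := hg.famTrans_eq Q hA ν τ a (x + Pi.single μ (σ * a))
    simp only [LatticeFermion.famTrans] at this
    rw [this]
    ring
  -- This family vanishes at a = 0 by `covDeriv_commutator`, so Hadamard's lemma extracts the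
  -- further factor a; the quotient is the witness.
  have hk : SmoothFamily L (fun p : ℝ × (Fin d → ℝ) =>
      LatticeFermion.famDiff Q A μ σ (LatticeFermion.famDiff Q A ν τ g) p -
      LatticeFermion.famDiff Q A ν τ (LatticeFermion.famDiff Q A μ σ g) p -
      σ * τ * (-Complex.I * Q) * (fieldStrength A μ ν p.2 * g p)) :=
    (((hg.famDiff Q hA ν τ).famDiff Q hA μ σ).sub ((hg.famDiff Q hA μ σ).famDiff Q hA ν τ)).sub
      ((SmoothFamily.const _).mul ((smoothFamily_fieldStrength hA μ ν).mul hg))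
  refine ⟨_, hk.divParam, fun a x => ?_⟩
  have h0 := hk.eq_add_divParam a x
  have hg0 : ContDiff ℝ ∞ fun y => g (0, y) :=
    hg.contDiff.comp (contDiff_const.prodMk contDiff_id)
  have hc := covDeriv_commutator Q hA hg0 μ ν x
  have hD : ∀ (ν : Fin d) (τ : ℝ), (fun y => LatticeFermion.famDiff Q A ν τ g (0, y)) =
      fun y => (τ : ℂ) * covDeriv Q A ν (fun y => g (0, y)) y := fun ν τ =>
    funext fun y => hg.famDiff_zero Q hA ν τ y
  have hlin : ∀ (μ ν : Fin d) (τ : ℝ),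
      covDeriv Q A μ (fun y => (τ : ℂ) * covDeriv Q A ν (fun y => g (0, y)) y) x =
        τ * covDeriv Q A μ (covDeriv Q A ν fun y => g (0, y)) x := by
    intro μ ν τ
    have hd : DifferentiableAt ℝ (covDeriv Q A ν fun y => g (0, y)) x := by
      have h1 : ContDiff ℝ ∞ (fderiv ℝ fun y => g (0, y)) := hg0.fderiv_right (by simp)
      have h2 : ContDiff ℝ ∞ (fun y => ((A ν y : ℝ) : ℂ)) :=
        Complex.ofRealCLM.contDiff.comp (hA ν).1
      have h3 : ContDiff ℝ ∞ (covDeriv Q A ν fun y => g (0, y)) :=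
        (h1.clm_apply contDiff_const).sub ((contDiff_const.mul h2).mul hg0)
      exact (h3.differentiable (by simp)).differentiableAt
    have e : ∀ f : (Fin d → ℝ) → ℂ, covDeriv Q A μ f x =
      fderiv ℝ f x (Pi.single μ 1) - Complex.I * Q * A μ x * f x := fun _ => rfl
    rw [e, e (covDeriv Q A ν fun y => g (0, y)), fderiv_const_mul hd]
    simp only [smul_apply, smul_eq_mul]
    ring
  rw [(hg.famDiff Q hA ν τ).famDiff_zero Q hA, (hg.famDiff Q hA μ σ).famDiff_zero Q hA, hD, hD,
    hlin, hlin] at h0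
  rw [key, key]
  linear_combination (a : ℂ) ^ 2 * h0 + (a : ℂ) ^ 2 * σ * τ * hc

end SmoothFamilies
end
end LatticeFermion

namespace LatticeFermion
noncomputable section
open scoped Kronecker Matrix ComplexConjugate

/-! ### Symbol classes graded by powers of a and ρ and by gamma degree -/

section Symbols

variable {d m : ℕ} (L M r : ℝ)

/-- The free Wilson mass term at spacing `a` and lattice momentum `q`. -/
def wilsonMass (q : Fin d → ℝ) : ℝ := ∑ ν, (1 - Real.cos (q ν))

/-- The free value of the mass and Wilson terms. -/
def freeMass (a : ℝ) (q : Fin d → ℝ) : ℝ := M * a + r * wilsonMass q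

/-- The free value of the square of the lattice Dirac operator. -/
def freeSq (a : ℝ) (q : Fin d → ℝ) : ℝ := freeMass M r a q ^ 2 + ∑ ν, Real.sin (q ν) ^ 2

/-- The size of the free lattice Dirac operator. -/
def rho (a : ℝ) (q : Fin d → ℝ) : ℝ := Real.sqrt (freeSq M r a q)

theorem wilsonMass_nonneg (q : Fin d → ℝ) : 0 ≤ wilsonMass q :=
  Finset.sum_nonneg fun _ _ => sub_nonneg.mpr (Real.cos_le_one _)

variable {M r} in
theorem freeMass_ge (hr : 0 < r) (a : ℝ) (q : Fin d → ℝ) :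
    M * a ≤ freeMass M r a q :=
  le_add_of_nonneg_right (mul_nonneg hr.le (wilsonMass_nonneg q))

theorem freeSq_nonneg (a : ℝ) (q : Fin d → ℝ) : 0 ≤ freeSq M r a q :=
  add_nonneg (sq_nonneg _) (Finset.sum_nonneg fun _ _ => sq_nonneg _)

theorem rho_sq (a : ℝ) (q : Fin d → ℝ) : rho M r a q ^ 2 = freeSq M r a q :=
  Real.sq_sqrt (freeSq_nonneg M r a q)

theorem rho_nonneg (a : ℝ) (q : Fin d → ℝ) : 0 ≤ rho M r a q := Real.sqrt_nonneg _

theorem abs_freeMass_le (a : ℝ) (q : Fin d → ℝ) : |freeMass M r a q| ≤ rho M r a q :=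
  Real.abs_le_sqrt (le_add_of_nonneg_right (Finset.sum_nonneg fun _ _ => sq_nonneg _))

theorem abs_sin_le_rho (a : ℝ) (q : Fin d → ℝ) (μ : Fin d) :
    |Real.sin (q μ)| ≤ rho M r a q := by
  refine Real.abs_le_sqrt ?_
  have := Finset.single_le_sum (f := fun ν => Real.sin (q ν) ^ 2) (fun ν _ => sq_nonneg _)
    (Finset.mem_univ μ)
  exact this.trans (le_add_of_nonneg_left (sq_nonneg _))

variable {M r}

/-- The mass keeps ρ from falling below Ma, including at q = 0. All exchanges of powers of a for
powers of ρ rest on this. -/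
theorem mul_le_rho (hr : 0 < r) (a : ℝ) (q : Fin d → ℝ) : M * a ≤ rho M r a q :=
  (freeMass_ge hr a q).trans ((le_abs_self _).trans (abs_freeMass_le M r a q))

theorem rho_pos (hM : 0 < M) (hr : 0 < r) {a : ℝ} (ha : 0 < a) (q : Fin d → ℝ) :
    0 < rho M r a q :=
  (mul_pos hM ha).trans_le (mul_le_rho hr a q)

/-- The Wilson term removes the doublers. Near cos q = -1 the sine vanishes, but sin² + r²(1 - cos)²
≥ min(1, r²)((1 - cos)(1 + cos) + (1 - cos)²), and the right-hand bracket is 2(1 - cos). -/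
theorem one_sub_cos_le_rho_sq (hM : 0 < M) (hr : 0 < r) {a : ℝ} (ha : 0 < a) (q : Fin d → ℝ)
    (μ : Fin d) : 2 * min 1 (r ^ 2) * (1 - Real.cos (q μ)) ≤ rho M r a q ^ 2 := by
  rw [rho_sq, freeSq]
  have h1 : Real.sin (q μ) ^ 2 ≤ ∑ ν, Real.sin (q ν) ^ 2 :=
    Finset.single_le_sum (f := fun ν => Real.sin (q ν) ^ 2) (fun ν _ => sq_nonneg _)
      (Finset.mem_univ μ)
  have h2 : r * (1 - Real.cos (q μ)) ≤ freeMass M r a q := by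
    have : 1 - Real.cos (q μ) ≤ wilsonMass q :=
      Finset.single_le_sum (f := fun ν => 1 - Real.cos (q ν))
        (fun ν _ => sub_nonneg.mpr (Real.cos_le_one _)) (Finset.mem_univ μ)
    have h3 := mul_le_mul_of_nonneg_left this hr.le
    rw [freeMass]
    linarith [mul_pos hM ha]
  have h4 : 0 ≤ 1 - Real.cos (q μ) := sub_nonneg.mpr (Real.cos_le_one _)
  have h5 : (r * (1 - Real.cos (q μ))) ^ 2 ≤ freeMass M r a q ^ 2 :=
    pow_le_pow_left₀ (mul_nonneg hr.le h4) h2 2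
  have h6 := Real.sin_sq_add_cos_sq (q μ)
  have h7 : 0 ≤ 1 + Real.cos (q μ) := by linarith [Real.neg_one_le_cos (q μ)]
  have h8 : min 1 (r ^ 2) * ((1 - Real.cos (q μ)) * (1 + Real.cos (q μ))) ≤
      1 * ((1 - Real.cos (q μ)) * (1 + Real.cos (q μ))) :=
    mul_le_mul_of_nonneg_right (min_le_left _ _) (mul_nonneg h4 h7)
  have h9 : min 1 (r ^ 2) * (1 - Real.cos (q μ)) ^ 2 ≤ r ^ 2 * (1 - Real.cos (q μ)) ^ 2 :=
    mul_le_mul_of_nonneg_right (min_le_right _ _) (sq_nonneg _)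
  nlinarith

theorem wilsonMass_le (hM : 0 < M) (hr : 0 < r) {a : ℝ} (ha : 0 < a) (q : Fin d → ℝ) :
    wilsonMass q ≤ d / (2 * min 1 (r ^ 2)) * rho M r a q ^ 2 := by
  have h0 : 0 < 2 * min 1 (r ^ 2) := by positivity
  have : ∀ μ, 1 - Real.cos (q μ) ≤ rho M r a q ^ 2 / (2 * min 1 (r ^ 2)) := fun μ => by
    rw [le_div_iff₀ h0, mul_comm]
    exact one_sub_cos_le_rho_sq hM hr ha q μ
  calc wilsonMass q ≤ ∑ _ : Fin d, rho M r a q ^ 2 / (2 * min 1 (r ^ 2)) :=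
        Finset.sum_le_sum fun μ _ => this μ
    _ = _ := by
      rw [Finset.sum_const, Finset.card_univ, Fintype.card_fin, nsmul_eq_mul]
      ring

theorem rho_le (hM : 0 < M) (hr : 0 < r) {a : ℝ} (ha : 0 < a) (haL : a ≤ L) (q : Fin d → ℝ) :
    rho M r a q ≤ M * L + 2 * r * d + d := by
  have h1 : wilsonMass q ≤ 2 * d := by
    calc wilsonMass q ≤ ∑ _ : Fin d, (2 : ℝ) :=
          Finset.sum_le_sum fun μ _ => by linarith [Real.neg_one_le_cos (q μ)]
      _ = _ := by simp [mul_comm]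
  have h2 : ∑ ν, Real.sin (q ν) ^ 2 ≤ d := by
    calc ∑ ν, Real.sin (q ν) ^ 2 ≤ ∑ _ : Fin d, (1 : ℝ) :=
          Finset.sum_le_sum fun μ _ => Real.sin_sq_le_one _
      _ = _ := by simp
  have h3 : freeMass M r a q ≤ M * L + 2 * r * d := by
    rw [freeMass]
    nlinarith
  have h4 : 0 ≤ freeMass M r a q := (mul_pos hM ha).le.trans (freeMass_ge hr a q)
  have hd : (d : ℝ) ≤ (d : ℝ) ^ 2 := by
    rcases Nat.eq_zero_or_pos d with h | h
    · simp [h]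
    · have : (1 : ℝ) ≤ d := by exact_mod_cast h
      nlinarith
  have h5 := pow_le_pow_left₀ h4 h3 2
  have h6 : 0 ≤ M * L + 2 * r * d := h4.trans h3
  have h7 : (0 : ℝ) ≤ d := Nat.cast_nonneg d
  refine Real.sqrt_le_iff.mpr ⟨add_nonneg h6 h7, ?_⟩
  rw [freeSq]
  nlinarith [mul_nonneg h6 h7]

/-- Coefficients of order `a ^ t * ρ ^ n`. -/
def Coef (L M r : ℝ) (t n : ℕ) (c : ℝ → (Fin d → ℝ) → ℂ) : Prop :=
  ∃ C : ℝ, ∀ a, 0 < a → a ≤ L → ∀ q, ‖c a q‖ ≤ C * (a ^ t * rho M r a q ^ n)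

variable {L}

theorem Coef.mul {t n t' n' : ℕ} {c c' : ℝ → (Fin d → ℝ) → ℂ} (h : Coef L M r t n c)
    (h' : Coef L M r t' n' c') : Coef L M r (t + t') (n + n') (fun a q => c a q * c' a q) := by
  obtain ⟨C, hC⟩ := h
  obtain ⟨C', hC'⟩ := h'
  refine ⟨C * C', fun a ha haL q => ?_⟩
  rw [norm_mul]
  calc ‖c a q‖ * ‖c' a q‖ ≤ (C * (a ^ t * rho M r a q ^ n)) * (C' * (a ^ t' * rho M r a q ^ n')) :=
        mul_le_mul (hC a ha haL q) (hC' a ha haL q) (norm_nonneg _)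
          ((norm_nonneg _).trans (hC a ha haL q))
    _ = _ := by ring

theorem order_exchange (hM : 0 < M) (hr : 0 < r) (k t n : ℕ) {a : ℝ} (ha : 0 < a)
    (q : Fin d → ℝ) : a ^ (t + k) * rho M r a q ^ n ≤
      (M⁻¹) ^ k * (a ^ t * rho M r a q ^ (n + k)) := by
  have h1 : a ≤ M⁻¹ * rho M r a q := by
    rw [← div_eq_inv_mul, le_div_iff₀ hM, mul_comm]
    exact mul_le_rho hr a q
  have h2 := pow_le_pow_left₀ ha.le h1 k
  have h3 : 0 ≤ a ^ t * rho M r a q ^ n :=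
    mul_nonneg (pow_nonneg ha.le _) (pow_nonneg (rho_nonneg M r a q) _)
  calc a ^ (t + k) * rho M r a q ^ n = a ^ k * (a ^ t * rho M r a q ^ n) := by ring
    _ ≤ (M⁻¹ * rho M r a q) ^ k * (a ^ t * rho M r a q ^ n) := mul_le_mul_of_nonneg_right h2 h3
    _ = _ := by ring

/-- The bound `f = O(a ^ t * ρ ^ n)` weakened by exchanging powers of `a` for powers of `ρ`. -/
theorem bound_exchange (hM : 0 < M) (hr : 0 < r) {k t n : ℕ} {a C y : ℝ} (ha : 0 < a)
    (q : Fin d → ℝ) (h : y ≤ C * (a ^ (t + k) * rho M r a q ^ n)) :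
    y ≤ (|C| * (M⁻¹) ^ k) * (a ^ t * rho M r a q ^ (n + k)) := by
  have h3 : 0 ≤ a ^ (t + k) * rho M r a q ^ n :=
    mul_nonneg (pow_nonneg ha.le _) (pow_nonneg (rho_nonneg M r a q) _)
  calc y ≤ C * (a ^ (t + k) * rho M r a q ^ n) := h
    _ ≤ |C| * (a ^ (t + k) * rho M r a q ^ n) := mul_le_mul_of_nonneg_right (le_abs_self C) h3
    _ ≤ |C| * ((M⁻¹) ^ k * (a ^ t * rho M r a q ^ (n + k))) :=
      mul_le_mul_of_nonneg_left (order_exchange hM hr k t n ha q) (abs_nonneg C)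
    _ = _ := by ring

theorem Coef.exchange (hM : 0 < M) (hr : 0 < r) {k t n : ℕ} {c : ℝ → (Fin d → ℝ) → ℂ}
    (h : Coef L M r (t + k) n c) : Coef L M r t (n + k) c := by
  obtain ⟨C, hC⟩ := h
  exact ⟨|C| * (M⁻¹) ^ k, fun a ha haL q => bound_exchange hM hr ha q (hC a ha haL q)⟩

theorem Coef.weaken (hM : 0 < M) (hr : 0 < r) {t n : ℕ} {c : ℝ → (Fin d → ℝ) → ℂ}
    (h : Coef L M r t (n + 1) c) : Coef L M r t n c := by
  obtain ⟨C, hC⟩ := h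
  refine ⟨|C| * (M * L + 2 * r * d + d), fun a ha haL q => (hC a ha haL q).trans ?_⟩
  have h0 := rho_nonneg M r a q
  have h3 : 0 ≤ a ^ t * rho M r a q ^ n := mul_nonneg (pow_nonneg ha.le _) (pow_nonneg h0 _)
  calc C * (a ^ t * rho M r a q ^ (n + 1)) = (C * rho M r a q) * (a ^ t * rho M r a q ^ n) := by
        ring
    _ ≤ (|C| * (M * L + 2 * r * d + d)) * (a ^ t * rho M r a q ^ n) := by
        refine mul_le_mul_of_nonneg_right ?_ h3
        exact mul_le_mul (le_abs_self C) (rho_le L hM hr ha haL q) h0 (abs_nonneg C)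

theorem Coef.const (z : ℂ) : Coef (d := d) L M r 0 0 (fun _ _ => z) :=
  ⟨‖z‖, fun a _ _ q => by simp⟩

theorem Coef.spacing_pow (k : ℕ) : Coef (d := d) L M r k 0 (fun a _ => (a : ℂ) ^ k) :=
  ⟨1, fun a ha _ q => by
    rw [norm_pow, Complex.norm_real, Real.norm_of_nonneg ha.le]; simp⟩

theorem Coef.spacing : Coef (d := d) L M r 1 0 (fun a _ => (a : ℂ)) := by
  simpa using Coef.spacing_pow (d := d) (L := L) (M := M) (r := r) 1

theorem Coef.sin (μ : Fin d) : Coef L M r 0 1 (fun _ q => (Real.sin (q μ) : ℂ)) :=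
  ⟨1, fun a _ _ q => by
    rw [Complex.norm_real, Real.norm_eq_abs]
    simpa using abs_sin_le_rho M r a q μ⟩

theorem Coef.freeMass : Coef (d := d) L M r 0 1 (fun a q => (freeMass M r a q : ℂ)) :=
  ⟨1, fun a _ _ q => by
    rw [Complex.norm_real, Real.norm_eq_abs]
    simpa using abs_freeMass_le M r a q⟩

theorem Coef.wilsonMass (hM : 0 < M) (hr : 0 < r) :
    Coef (d := d) L M r 0 2 (fun _ q => (wilsonMass q : ℂ)) :=
  ⟨d / (2 * min 1 (r ^ 2)), fun a ha _ q => by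
    rw [Complex.norm_real, Real.norm_of_nonneg (wilsonMass_nonneg q), pow_zero, one_mul]
    exact wilsonMass_le hM hr ha q⟩

theorem Coef.exp (σ : ℝ) (μ : Fin d) :
    Coef L M r 0 0 (fun _ q => Complex.exp (Complex.I * (σ * q μ : ℝ))) :=
  ⟨1, fun a _ _ q => by
    beta_reduce
    rw [mul_comm Complex.I, Complex.norm_exp_ofReal_mul_I]; simp⟩

/-- Matrix-valued functions of the lattice spacing `a`, the lattice momentum `q` and `x`. -/
abbrev Field (m : ℕ) : Type :=
  ℝ → (Fin (2 * m) → ℝ) → (Fin (2 * m) → ℝ) → Matrix (Fin (2 ^ m)) (Fin (2 ^ m)) ℂ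

/-- The elementary symbol `c(a, q) g(a, x) Γ`. -/
def elem (c : ℝ → (Fin (2 * m) → ℝ) → ℂ) (g : ℝ × (Fin (2 * m) → ℝ) → ℂ)
    (Γ : Matrix (Fin (2 ^ m)) (Fin (2 ^ m)) ℂ) : Field m :=
  fun a q x => (c a q * g (a, x)) • Γ

theorem elem_apply (c : ℝ → (Fin (2 * m) → ℝ) → ℂ) (g : ℝ × (Fin (2 * m) → ℝ) → ℂ)
    (Γ : Matrix (Fin (2 ^ m)) (Fin (2 ^ m)) ℂ) (a : ℝ) (q x : Fin (2 * m) → ℝ) :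
    elem c g Γ a q x = (c a q * g (a, x)) • Γ := rfl

variable (L M r) in
/-- Symbols of order `a ^ t * ρ ^ n` that involve at most `j` gamma matrices. -/
def Sym (γ : Fin (2 * m) → Matrix (Fin (2 ^ m)) (Fin (2 ^ m)) ℂ) (t n j : ℕ) :
    Submodule ℂ (Field m) :=
  Submodule.span ℂ {f | ∃ c g Γ, Coef L M r t n c ∧ SmoothFamily L g ∧ Γ ∈ Fil γ j ∧ f = elem c g Γ}

variable {γ : Fin (2 * m) → Matrix (Fin (2 ^ m)) (Fin (2 ^ m)) ℂ}

theorem elem_mem_Sym {t n j : ℕ} {c : ℝ → (Fin (2 * m) → ℝ) → ℂ}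
    {g : ℝ × (Fin (2 * m) → ℝ) → ℂ} {Γ : Matrix (Fin (2 ^ m)) (Fin (2 ^ m)) ℂ}
    (hc : Coef L M r t n c) (hg : SmoothFamily L g) (hΓ : Γ ∈ Fil γ j) :
    elem c g Γ ∈ Sym L M r γ t n j :=
  Submodule.subset_span ⟨c, g, Γ, hc, hg, hΓ, rfl⟩

theorem Sym_le {t n j : ℕ} {W : Submodule ℂ (Field m)}
    (h : ∀ c g Γ, Coef L M r t n c → SmoothFamily L g → Γ ∈ Fil γ j → elem c g Γ ∈ W) :
    Sym L M r γ t n j ≤ W :=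
  Submodule.span_le.mpr (by rintro _ ⟨c, g, Γ, hc, hg, hΓ, rfl⟩; exact h c g Γ hc hg hΓ)

theorem Sym_exchange (hM : 0 < M) (hr : 0 < r) (k t n j : ℕ) :
    Sym L M r γ (t + k) n j ≤ Sym L M r γ t (n + k) j :=
  Sym_le fun _ _ _ hc hg hΓ => elem_mem_Sym (hc.exchange hM hr) hg hΓ

theorem Sym_weaken (hM : 0 < M) (hr : 0 < r) (t n j : ℕ) :
    Sym L M r γ t (n + 1) j ≤ Sym L M r γ t n j :=
  Sym_le fun _ _ _ hc hg hΓ => elem_mem_Sym (hc.weaken hM hr) hg hΓ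

theorem Sym_mono {t n i j : ℕ} (h : i ≤ j) : Sym L M r γ t n i ≤ Sym L M r γ t n j :=
  Sym_le fun _ _ _ hc hg hΓ => elem_mem_Sym hc hg (Fil_mono h hΓ)

variable (L M r γ) in
/-- Operators that raise the orders of symbols. -/
def OpOrd (t n j : ℕ) : Submodule ℂ (Module.End ℂ (Field m)) where
  carrier := {Φ | ∀ t' n' j', ∀ f ∈ Sym L M r γ t' n' j', Φ f ∈ Sym L M r γ (t' + t) (n' + n) (j' + j)}
  add_mem' h h' t' n' j' f hf := add_mem (h t' n' j' f hf) (h' t' n' j' f hf)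
  zero_mem' _ _ _ _ _ := zero_mem _
  smul_mem' c _ h t' n' j' f hf := Submodule.smul_mem _ c (h t' n' j' f hf)

theorem OpOrd_of_elem {t n j : ℕ} {Φ : Module.End ℂ (Field m)}
    (h : ∀ t' n' j' c g Γ, Coef L M r t' n' c → SmoothFamily L g → Γ ∈ Fil γ j' →
      Φ (elem c g Γ) ∈ Sym L M r γ (t' + t) (n' + n) (j' + j)) : Φ ∈ OpOrd L M r γ t n j :=
  fun t' n' j' f hf => by
    have : Sym L M r γ t' n' j' ≤ (Sym L M r γ (t' + t) (n' + n) (j' + j)).comap Φ :=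
      Sym_le fun c g Γ hc hg hΓ => h t' n' j' c g Γ hc hg hΓ
    exact this hf

theorem OpOrd.mul {t n j t' n' j' : ℕ} {Φ Ψ : Module.End ℂ (Field m)}
    (h : Φ ∈ OpOrd L M r γ t n j) (h' : Ψ ∈ OpOrd L M r γ t' n' j') :
    Φ * Ψ ∈ OpOrd L M r γ (t + t') (n + n') (j + j') := by
  intro t'' n'' j'' f hf
  have := h _ _ _ _ (h' t'' n'' j'' f hf)
  rw [Module.End.mul_apply]
  convert this using 1
  congr 1 <;> omega

theorem OpOrd.exchange (hM : 0 < M) (hr : 0 < r) (k : ℕ) {t n j : ℕ}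
    {Φ : Module.End ℂ (Field m)} (h : Φ ∈ OpOrd L M r γ (t + k) n j) :
    Φ ∈ OpOrd L M r γ t (n + k) j := by
  intro t' n' j' f hf
  have := h t' n' j' f hf
  rw [← add_assoc] at this
  rw [← add_assoc]
  exact Sym_exchange hM hr k _ _ _ this

theorem OpOrd.weaken (hM : 0 < M) (hr : 0 < r) {t n j : ℕ}
    {Φ : Module.End ℂ (Field m)} (h : Φ ∈ OpOrd L M r γ t (n + 1) j) :
    Φ ∈ OpOrd L M r γ t n j := by
  intro t' n' j' f hf
  have := h t' n' j' f hf
  rw [← add_assoc] at this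
  exact Sym_weaken hM hr _ _ _ this

theorem OpOrd.mono {t n i j : ℕ} (hij : i ≤ j) {Φ : Module.End ℂ (Field m)}
    (h : Φ ∈ OpOrd L M r γ t n i) : Φ ∈ OpOrd L M r γ t n j := fun t' n' j' f hf =>
  Sym_mono (by omega) (h t' n' j' f hf)

/-- Multiplication by a function of `a`, `q` and `x`. -/
def mulFun (c : ℝ → (Fin (2 * m) → ℝ) → (Fin (2 * m) → ℝ) → ℂ) : Module.End ℂ (Field m) where
  toFun f a q x := c a q x • f a q x
  map_add' f f' := by ext; simp [mul_add]
  map_smul' z f := by ext; simp; ring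

theorem mulFun_apply (c : ℝ → (Fin (2 * m) → ℝ) → (Fin (2 * m) → ℝ) → ℂ) (f : Field m) (a : ℝ)
    (q x : Fin (2 * m) → ℝ) : mulFun c f a q x = c a q x • f a q x := rfl

/-- Multiplication by a function of `a` and `q`. -/
def mulCoef (c : ℝ → (Fin (2 * m) → ℝ) → ℂ) : Module.End ℂ (Field m) :=
  mulFun fun a q _ => c a q

/-- Multiplication by a constant matrix from the left. -/
def mulMat (X : Matrix (Fin (2 ^ m)) (Fin (2 ^ m)) ℂ) : Module.End ℂ (Field m) where
  toFun f a q x := X * f a q x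
  map_add' f f' := by ext1 a; ext1 q; ext1 x; simp [mul_add]
  map_smul' z f := by ext1 a; ext1 q; ext1 x; simp

/-- The covariant translation by `σ a` in direction `μ`, conjugated by a plane wave. -/
def symTrans (Q : ℝ) (A : Fin (2 * m) → (Fin (2 * m) → ℝ) → ℝ) (μ : Fin (2 * m)) (σ : ℝ) :
    Module.End ℂ (Field m) where
  toFun f a q x := (Complex.exp (Complex.I * (σ * q μ : ℝ)) * transport Q A μ (σ * a) x) •
    f a q (x + Pi.single μ (σ * a))
  map_add' f f' := by ext; simp [mul_add]
  map_smul' z f := by ext; simp; ring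

theorem mulFun_elem (c' : ℝ → (Fin (2 * m) → ℝ) → ℂ) (g' : ℝ × (Fin (2 * m) → ℝ) → ℂ)
    (c : ℝ → (Fin (2 * m) → ℝ) → ℂ) (g : ℝ × (Fin (2 * m) → ℝ) → ℂ)
    (Γ : Matrix (Fin (2 ^ m)) (Fin (2 ^ m)) ℂ) :
    mulFun (fun a q x => c' a q * g' (a, x)) (elem c g Γ) =
      elem (fun a q => c a q * c' a q) (fun p => g' p * g p) Γ := by
  funext a q x
  rw [mulFun_apply, elem_apply, elem_apply, smul_smul]
  refine congrArg (· • Γ) ?_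
  ring

theorem mulFun_mem_OpOrd {t n : ℕ} {c : ℝ → (Fin (2 * m) → ℝ) → ℂ}
    {g : ℝ × (Fin (2 * m) → ℝ) → ℂ} (hc : Coef L M r t n c) (hg : SmoothFamily L g) :
    mulFun (fun a q x => c a q * g (a, x)) ∈ OpOrd L M r γ t n 0 :=
  OpOrd_of_elem fun _ _ _ c' g' Γ hc' hg' hΓ => by
    rw [mulFun_elem]
    exact elem_mem_Sym (hc'.mul hc) (hg.mul hg') hΓ

theorem mulCoef_mem_OpOrd {t n : ℕ} {c : ℝ → (Fin (2 * m) → ℝ) → ℂ} (hc : Coef L M r t n c) :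
    mulCoef c ∈ OpOrd L M r γ t n 0 := by
  have := mulFun_mem_OpOrd (γ := γ) hc (SmoothFamily.const (L := L) 1)
  simpa [mulCoef] using this

theorem mulMat_mem_OpOrd {i : ℕ} {X : Matrix (Fin (2 ^ m)) (Fin (2 ^ m)) ℂ} (hX : X ∈ Fil γ i) :
    mulMat X ∈ OpOrd L M r γ 0 0 i :=
  OpOrd_of_elem fun t' n' j' c' g' Γ hc' hg' hΓ => by
    have : mulMat X (elem c' g' Γ) = elem c' g' (X * Γ) := by
      funext a q x
      change X * (_ • Γ) = _ • (X * Γ)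
      rw [mul_smul_comm]
    rw [this]
    exact elem_mem_Sym hc' hg' (Fil_mono (by omega) (mul_mem_Fil hX hΓ))

variable {Q : ℝ} {A : Fin (2 * m) → (Fin (2 * m) → ℝ) → ℝ}

theorem symTrans_apply (μ : Fin (2 * m)) (σ : ℝ) (f : Field m) (a : ℝ)
    (q x : Fin (2 * m) → ℝ) : symTrans Q A μ σ f a q x =
      (Complex.exp (Complex.I * (σ * q μ : ℝ)) * transport Q A μ (σ * a) x) •
        f a q (x + Pi.single μ (σ * a)) := rfl

theorem symTrans_elem (μ : Fin (2 * m)) (σ : ℝ)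
    (c : ℝ → (Fin (2 * m) → ℝ) → ℂ) (g : ℝ × (Fin (2 * m) → ℝ) → ℂ)
    (Γ : Matrix (Fin (2 ^ m)) (Fin (2 ^ m)) ℂ) :
    symTrans Q A μ σ (elem c g Γ) =
      elem (fun a q => c a q * Complex.exp (Complex.I * (σ * q μ : ℝ))) (famTrans Q A μ σ g) Γ := by
  funext a q x
  rw [symTrans_apply, elem_apply, elem_apply, famTrans, smul_smul]
  refine congrArg (· • Γ) ?_
  ring

variable (hA : ∀ μ, SmoothOnTorus L (A μ))
include hA

/-- On a smooth family a covariant translation differs from the identity by a times its difference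
quotient; the plane wave contributes only a phase. -/
theorem symTrans_sub_mem_OpOrd (μ : Fin (2 * m)) (σ : ℝ) :
    symTrans Q A μ σ - mulCoef (fun _ q => Complex.exp (Complex.I * (σ * q μ : ℝ))) ∈
      OpOrd L M r γ 1 0 0 :=
  OpOrd_of_elem fun t' n' j' c' g' Γ hc' hg' hΓ => by
    have : (symTrans Q A μ σ - mulCoef (fun _ q => Complex.exp (Complex.I * (σ * q μ : ℝ))))
        (elem c' g' Γ) = elem (fun a q => c' a q * (Complex.exp (Complex.I * (σ * q μ : ℝ)) * a))
          (famDiff Q A μ σ g') Γ := by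
      rw [LinearMap.sub_apply, symTrans_elem]
      funext a q x
      rw [Pi.sub_apply, Pi.sub_apply, Pi.sub_apply, mulCoef, mulFun_apply, elem_apply, elem_apply,
        elem_apply, hg'.famTrans_eq Q hA, smul_smul, ← sub_smul]
      refine congrArg (· • Γ) ?_
      ring
    rw [this]
    refine elem_mem_Sym ?_ (hg'.famDiff Q hA μ σ) hΓ
    simpa using hc'.mul ((Coef.exp σ μ).mul Coef.spacing)

end Symbols
end
end LatticeFermion

namespace LatticeFermion
noncomputable section
open scoped Kronecker Matrix ComplexConjugate

/-! ### The square of a Dirac-type operator -/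

section DiracSquare

/-- The square of a Dirac-type operator. -/
theorem dirac_square {𝓡 ι : Type*} [Ring 𝓡] [Algebra ℂ 𝓡] [Fintype ι] [DecidableEq ι]
    (G S : ι → 𝓡) (b : 𝓡) (hGS : ∀ μ ν, G μ * S ν = S ν * G μ) (hGb : ∀ μ, G μ * b = b * G μ)
    (hG : ∀ μ ν, G μ * G ν + G ν * G μ = if μ = ν then (-2 : ℂ) • 1 else 0) :
    (b + Complex.I • ∑ μ, G μ * S μ) * (b - Complex.I • ∑ μ, G μ * S μ) =
      (b * b - ∑ μ, S μ * S μ) +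
        ((1 / 2 : ℂ) • (∑ μ, ∑ ν, G μ * G ν * (S μ * S ν - S ν * S μ)) +
          Complex.I • ∑ μ, G μ * (S μ * b - b * S μ)) := by
  set D := ∑ μ, G μ * S μ with hD
  have h1 : ∑ μ, G μ * (S μ * b - b * S μ) = D * b - b * D := by
    rw [hD, Finset.sum_mul, Finset.mul_sum, ← Finset.sum_sub_distrib]
    refine Finset.sum_congr rfl fun μ _ => ?_
    rw [mul_sub, ← mul_assoc, ← mul_assoc, ← mul_assoc, hGb]
  have h2 : D * D = ∑ μ, ∑ ν, G μ * G ν * (S μ * S ν) := by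
    rw [hD, Finset.sum_mul_sum]
    refine Finset.sum_congr rfl fun μ _ => Finset.sum_congr rfl fun ν _ => ?_
    rw [mul_assoc, mul_assoc, ← mul_assoc (S μ), ← hGS ν μ, mul_assoc]
  -- The Clifford relation swaps the gamma factors, so this reordered double sum is -D² apart from
  -- diagonal terms. Half the difference of D² and this sum therefore isolates the commutators of
  -- the S_μ.
  have h3 : ∑ μ, ∑ ν, G μ * G ν * (S ν * S μ) = -(D * D) - (2 : ℂ) • ∑ μ, S μ * S μ := by
    have h4 : ∀ μ ν, G μ * G ν * (S ν * S μ) =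
        (if μ = ν then (-2 : ℂ) • (S ν * S μ) else 0) - G ν * G μ * (S ν * S μ) := by
      intro μ ν
      rw [eq_sub_iff_add_eq, ← add_mul, hG]
      split_ifs <;> simp
    have h5 : ∑ μ, ∑ ν, G ν * G μ * (S ν * S μ) = D * D := by rw [Finset.sum_comm, h2]
    simp only [h4, Finset.sum_sub_distrib, Finset.sum_ite_eq, Finset.mem_univ, if_true]
    rw [h5, ← Finset.smul_sum, neg_smul]
    abel
  simp only [mul_sub (_ * _) (_ * _) (_ * _), Finset.sum_sub_distrib]
  rw [h3, ← h2]
  have h6 : ∑ μ, (G μ * (S μ * b) - G μ * (b * S μ)) = D * b - b * D := by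
    rw [← h1]; exact Finset.sum_congr rfl fun μ _ => (mul_sub _ _ _).symm
  rw [h1]
  simp only [add_mul, mul_sub, smul_mul_assoc, mul_smul_comm, smul_sub, smul_add, smul_smul,
    Complex.I_mul_I]
  module

end DiracSquare

/-! ### Orders of the action operator and its square on symbols -/

section Operators

variable {m : ℕ} (M r Q : ℝ) (A : Fin (2 * m) → (Fin (2 * m) → ℝ) → ℝ)
  (γ : Fin (2 * m) → Matrix (Fin (2 ^ m)) (Fin (2 ^ m)) ℂ)

/-- The symmetric covariant difference operator on symbols, times the lattice spacing. -/
def sSym (μ : Fin (2 * m)) : Module.End ℂ (Field m) :=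
  (1 / 2 : ℂ) • (symTrans Q A μ 1 - symTrans Q A μ (-1))

/-- The Wilson operator on symbols. -/
def wSym : Module.End ℂ (Field m) :=
  ∑ μ, (symTrans Q A μ 1 + symTrans Q A μ (-1) - (2 : ℂ) • (1 : Module.End ℂ (Field m)))

/-- The mass and Wilson terms on symbols, times the lattice spacing. -/
def bSym : Module.End ℂ (Field m) :=
  mulCoef (fun a _ => ((M * a : ℝ) : ℂ)) - ((r / 2 : ℝ) : ℂ) • wSym Q A

/-- The action operator on symbols, times the lattice spacing. -/
def hSym : Module.End ℂ (Field m) :=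
  bSym M r Q A + Complex.I • ∑ μ, mulMat (γ μ) * sSym Q A μ

/-- The adjoint of the action operator on symbols. -/
def hSymAdj : Module.End ℂ (Field m) :=
  bSym M r Q A - Complex.I • ∑ μ, mulMat (γ μ) * sSym Q A μ

/-- The part of the square of the action operator that is not its free value. -/
def remSym : Module.End ℂ (Field m) :=
  hSym M r Q A γ * hSymAdj M r Q A γ - mulCoef (fun a q => (freeSq M r a q : ℂ))

/-- The part of the square of the action operator without gamma matrices and free value. -/
def scalarSym : Module.End ℂ (Field m) :=
  bSym M r Q A * bSym M r Q A - ∑ μ, sSym Q A μ * sSym Q A μ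
    - mulCoef (fun a q => (freeSq M r a q : ℂ))

/-- The part of the square of the action operator that contains commutators. -/
def curvSym : Module.End ℂ (Field m) :=
  (1 / 2 : ℂ) • (∑ μ, ∑ ν, mulMat (γ μ) * mulMat (γ ν) *
      (sSym Q A μ * sSym Q A ν - sSym Q A ν * sSym Q A μ)) +
    Complex.I • ∑ μ, mulMat (γ μ) * (sSym Q A μ * bSym M r Q A - bSym M r Q A * sSym Q A μ)

/-- Multiplication by a coefficient times a component of the field strength. -/
def fieldMul (μ ν : Fin (2 * m)) (z : (Fin (2 * m) → ℝ) → ℂ) : Module.End ℂ (Field m) :=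
  mulFun fun a q x => ((a : ℂ) ^ 2 * z q) * (-Complex.I * Q * fieldStrength A μ ν x)

/-- The leading part of `curvSym`. -/
def leadSym : Module.End ℂ (Field m) :=
  (1 / 2 : ℂ) • (∑ μ, ∑ ν, mulMat (γ μ) * mulMat (γ ν) *
      fieldMul Q A μ ν (fun q => Real.cos (q μ) * Real.cos (q ν))) +
    Complex.I • ∑ μ, mulMat (γ μ) *
      ∑ ν, fieldMul Q A μ ν (fun q => -r * Complex.I * (Real.cos (q μ) * Real.sin (q ν)))

variable {M r Q A γ}

theorem mulMat_mul_mulMat (X Y : Matrix (Fin (2 ^ m)) (Fin (2 ^ m)) ℂ) :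
    mulMat X * mulMat Y = mulMat (X * Y) := by
  ext1 f; funext a q x; exact (mul_assoc X Y (f a q x)).symm

theorem mulMat_symTrans (X : Matrix (Fin (2 ^ m)) (Fin (2 ^ m)) ℂ) (μ : Fin (2 * m)) (σ : ℝ) :
    mulMat X * symTrans Q A μ σ = symTrans Q A μ σ * mulMat X := by
  ext1 f; funext a q x
  exact mul_smul_comm _ X _

theorem mulMat_mulCoef (X : Matrix (Fin (2 ^ m)) (Fin (2 ^ m)) ℂ)
    (c : ℝ → (Fin (2 * m) → ℝ) → ℂ) : mulMat X * mulCoef c = mulCoef c * mulMat X := by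
  ext1 f; funext a q x
  exact mul_smul_comm _ X _

theorem mulCoef_symTrans (c : ℝ → (Fin (2 * m) → ℝ) → ℂ) (μ : Fin (2 * m)) (σ : ℝ) :
    mulCoef c * symTrans Q A μ σ = symTrans Q A μ σ * mulCoef c := by
  ext1 f; funext a q x
  rw [Module.End.mul_apply, Module.End.mul_apply, mulCoef, mulFun_apply, symTrans_apply,
    symTrans_apply, mulFun_apply, smul_comm]

theorem mulMat_sSym (X : Matrix (Fin (2 ^ m)) (Fin (2 ^ m)) ℂ) (μ : Fin (2 * m)) :
    mulMat X * sSym Q A μ = sSym Q A μ * mulMat X := by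
  rw [sSym, mul_smul_comm, smul_mul_assoc, mul_sub, sub_mul, mulMat_symTrans, mulMat_symTrans]

theorem mulMat_wSym (X : Matrix (Fin (2 ^ m)) (Fin (2 ^ m)) ℂ) :
    mulMat X * wSym Q A = wSym Q A * mulMat X := by
  rw [wSym, Finset.mul_sum, Finset.sum_mul]
  refine Finset.sum_congr rfl fun μ _ => ?_
  rw [mul_sub, sub_mul, mul_add, add_mul, mulMat_symTrans, mulMat_symTrans, mul_smul_comm,
    smul_mul_assoc, one_mul, mul_one]

theorem mulMat_bSym (X : Matrix (Fin (2 ^ m)) (Fin (2 ^ m)) ℂ) :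
    mulMat X * bSym M r Q A = bSym M r Q A * mulMat X := by
  rw [bSym, mul_sub, sub_mul, mulMat_mulCoef, mul_smul_comm, smul_mul_assoc, mulMat_wSym]

theorem mulCoef_sSym (c : ℝ → (Fin (2 * m) → ℝ) → ℂ) (μ : Fin (2 * m)) :
    mulCoef c * sSym Q A μ = sSym Q A μ * mulCoef c := by
  rw [sSym, mul_smul_comm, smul_mul_assoc, mul_sub, sub_mul, mulCoef_symTrans, mulCoef_symTrans]

theorem mulCoef_mul (c c' : ℝ → (Fin (2 * m) → ℝ) → ℂ) :
    mulCoef c * mulCoef c' = mulCoef (m := m) fun a q => c a q * c' a q := by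
  ext1 f; funext a q x
  rw [Module.End.mul_apply, mulCoef, mulCoef, mulCoef, mulFun_apply, mulFun_apply, mulFun_apply,
    smul_smul]

theorem remSym_eq (hγγ : CliffordRel γ) :
    remSym M r Q A γ = scalarSym M r Q A + curvSym M r Q A γ := by
  have hG : ∀ μ ν, mulMat (γ μ) * mulMat (γ ν) + mulMat (γ ν) * mulMat (γ μ) =
      if μ = ν then (-2 : ℂ) • (1 : Module.End ℂ (Field m)) else 0 := by
    intro μ ν
    have : mulMat (γ μ) * mulMat (γ ν) + mulMat (γ ν) * mulMat (γ μ) =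
        mulMat (γ μ * γ ν + γ ν * γ μ) := by
      rw [mulMat_mul_mulMat, mulMat_mul_mulMat]
      ext1 f; funext a q x; exact (add_mul _ _ _).symm
    rw [this, hγγ]
    split_ifs
    · ext1 f; funext a q x
      exact (smul_mul_assoc (-2 : ℂ) 1 (f a q x)).trans (by rw [one_mul]; rfl)
    · ext1 f; funext a q x; exact zero_mul _
  rw [remSym, hSym, hSymAdj, dirac_square _ _ _ (fun μ ν => mulMat_sSym _ _)
    (fun μ => mulMat_bSym _) hG, scalarSym, curvSym]
  abel

theorem exp_one_mul_I (t : ℝ) : Complex.exp (Complex.I * ((1 : ℝ) * t : ℝ)) =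
    Real.cos t + Real.sin t * Complex.I := by
  rw [one_mul, mul_comm, Complex.exp_mul_I, ← Complex.ofReal_cos, ← Complex.ofReal_sin]

theorem exp_neg_one_mul_I (t : ℝ) : Complex.exp (Complex.I * ((-1 : ℝ) * t : ℝ)) =
    Real.cos t - Real.sin t * Complex.I := by
  rw [mul_comm, Complex.exp_mul_I, ← Complex.ofReal_cos, ← Complex.ofReal_sin, neg_one_mul,
    Real.cos_neg, Real.sin_neg, Complex.ofReal_neg, neg_mul, ← sub_eq_add_neg]

theorem Coef.cos {L : ℝ} (μ : Fin (2 * m)) : Coef L M r 0 0 (fun _ q => (Real.cos (q μ) : ℂ)) :=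
  ⟨1, fun a _ _ q => by
    rw [Complex.norm_real, Real.norm_eq_abs]
    simpa using Real.abs_cos_le_one (q μ)⟩

theorem Coef.sin_bounded {L : ℝ} (μ : Fin (2 * m)) :
    Coef L M r 0 0 (fun _ q => (Real.sin (q μ) : ℂ)) :=
  ⟨1, fun a _ _ q => by
    rw [Complex.norm_real, Real.norm_eq_abs]
    simpa using Real.abs_sin_le_one (q μ)⟩

section Orders

variable {L : ℝ} (hM : 0 < M) (hr : 0 < r) (hA : ∀ μ, SmoothOnTorus L (A μ))

theorem OpOrd.mul_of_eq {t n j t' n' j' T K J : ℕ} {Φ Ψ : Module.End ℂ (Field m)}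
    (h : Φ ∈ OpOrd L M r γ t n j) (h' : Ψ ∈ OpOrd L M r γ t' n' j') (hT : t + t' = T := by rfl)
    (hK : n + n' = K := by rfl) (hJ : j + j' = J := by rfl) : Φ * Ψ ∈ OpOrd L M r γ T K J :=
  hT ▸ hK ▸ hJ ▸ OpOrd.mul h h'

include hA in
theorem sSym_sub_mem (μ : Fin (2 * m)) :
    sSym Q A μ - mulCoef (fun _ q => Complex.I * Real.sin (q μ)) ∈ OpOrd L M r γ 1 0 0 := by
  have e : sSym Q A μ - mulCoef (fun _ q => Complex.I * Real.sin (q μ)) =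
      (1 / 2 : ℂ) • ((symTrans Q A μ 1 -
          mulCoef (fun _ q => Complex.exp (Complex.I * ((1 : ℝ) * q μ : ℝ)))) -
        (symTrans Q A μ (-1) -
          mulCoef (fun _ q => Complex.exp (Complex.I * ((-1 : ℝ) * q μ : ℝ))))) := by
    have : (mulCoef (fun _ q => Complex.I * Real.sin (q μ)) : Module.End ℂ (Field m)) =
        (1 / 2 : ℂ) • (mulCoef (fun _ q => Complex.exp (Complex.I * ((1 : ℝ) * q μ : ℝ))) -
          mulCoef (fun _ q => Complex.exp (Complex.I * ((-1 : ℝ) * q μ : ℝ)))) := by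
      ext1 f; funext a q x
      change (Complex.I * Real.sin (q μ)) • f a q x = (1 / 2 : ℂ) •
        (Complex.exp (Complex.I * ((1 : ℝ) * q μ : ℝ)) • f a q x -
          Complex.exp (Complex.I * ((-1 : ℝ) * q μ : ℝ)) • f a q x)
      rw [← sub_smul, smul_smul]
      refine congrArg (· • f a q x) ?_
      rw [Complex.ofReal_sin, Complex.sin]
      push_cast
      rw [show Complex.I * (1 * (q μ : ℂ)) = q μ * Complex.I by ring,
        show Complex.I * (-1 * (q μ : ℂ)) = -q μ * Complex.I by ring]
      linear_combination (Complex.exp (-q μ * Complex.I) - Complex.exp (q μ * Complex.I)) / 2 *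
        Complex.I_mul_I
    rw [this, sSym]
    module
  rw [e]
  exact Submodule.smul_mem _ _ (sub_mem (symTrans_sub_mem_OpOrd hA μ 1)
    (symTrans_sub_mem_OpOrd hA μ (-1)))

include hM hr hA in
theorem sSym_mem (μ : Fin (2 * m)) : sSym Q A μ ∈ OpOrd L M r γ 0 1 0 := by
  have h1 : sSym Q A μ - mulCoef (fun _ q => Complex.I * Real.sin (q μ)) ∈ OpOrd L M r γ 0 1 0 :=
    OpOrd.exchange hM hr 1 (t := 0) (n := 0) (by rw [zero_add]; exact sSym_sub_mem hA μ)
  have h2 : mulCoef (fun _ q => Complex.I * Real.sin (q μ)) ∈ OpOrd L M r γ 0 1 0 :=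
    mulCoef_mem_OpOrd ((Coef.const Complex.I).mul (Coef.sin μ))
  simpa using add_mem h1 h2

include hM hr hA in
-- The forward and backward difference quotients are opposite at a = 0. The first-order term is
-- therefore a times e^{iq} - e^{-iq} = 2i sin q, which is O(aρ); the O(a²) rest becomes O(aρ) after
-- one exchange.
theorem symTrans_laplace_mem (μ : Fin (2 * m)) :
    symTrans Q A μ 1 + symTrans Q A μ (-1) - mulCoef (fun _ q => (2 * Real.cos (q μ) : ℝ)) ∈
      OpOrd L M r γ 1 1 0 :=
  OpOrd_of_elem fun t' n' j' c g Γ hc hg hΓ => by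
    have hk : SmoothFamily L (fun p => famDiff Q A μ 1 g p + famDiff Q A μ (-1) g p) :=
      (hg.famDiff Q hA μ 1).add (hg.famDiff Q hA μ (-1))
    -- The sum of the two quotients vanishes at a = 0, since their values there are the covariant
    -- derivative with coefficients 1 and -1.
    have hk0 : ∀ a x, famDiff Q A μ 1 g (a, x) + famDiff Q A μ (-1) g (a, x) =
        a * divParam (fun p => famDiff Q A μ 1 g p + famDiff Q A μ (-1) g p) (a, x) := by
      intro a x
      have h := hk.eq_add_divParam a x
      rw [hg.famDiff_zero Q hA, hg.famDiff_zero Q hA] at h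
      rw [h]
      push_cast
      ring
    have e : (symTrans Q A μ 1 + symTrans Q A μ (-1) -
        mulCoef (fun _ q => (2 * Real.cos (q μ) : ℝ))) (elem c g Γ) =
        elem (fun a q => c a q * ((a : ℂ) * (2 * Complex.I * Real.sin (q μ))))
          (famDiff Q A μ 1 g) Γ +
        elem (fun a q => c a q * ((a : ℂ) ^ 2 * Complex.exp (Complex.I * ((-1 : ℝ) * q μ : ℝ))))
          (divParam (fun p => famDiff Q A μ 1 g p + famDiff Q A μ (-1) g p)) Γ := by
      rw [LinearMap.sub_apply, LinearMap.add_apply, symTrans_elem, symTrans_elem]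
      funext a q x
      rw [Pi.sub_apply, Pi.sub_apply, Pi.sub_apply, Pi.add_apply, Pi.add_apply, Pi.add_apply,
        Pi.add_apply, Pi.add_apply, Pi.add_apply, mulCoef, mulFun_apply, elem_apply, elem_apply,
        elem_apply, elem_apply, elem_apply, hg.famTrans_eq Q hA, hg.famTrans_eq Q hA, smul_smul,
        ← add_smul, ← sub_smul, ← add_smul]
      refine congrArg (· • Γ) ?_
      have h1 := hk0 a x
      rw [exp_one_mul_I, exp_neg_one_mul_I]
      rw [Complex.ofReal_mul, Complex.ofReal_ofNat]
      linear_combination c a q * a * (Real.cos (q μ) - Real.sin (q μ) * Complex.I) * h1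
    rw [e]
    refine add_mem (elem_mem_Sym ?_ (hg.famDiff Q hA μ 1) hΓ)
      (Sym_exchange hM hr 1 (t' + 1) (n' + 0) (j' + 0) (elem_mem_Sym ?_ hk.divParam hΓ))
    · have := hc.mul (Coef.spacing.mul (((Coef.const 2).mul (Coef.const Complex.I)).mul
        (Coef.sin μ)))
      simpa using this
    · have := hc.mul ((Coef.spacing_pow 2).mul (Coef.exp (-1) μ))
      simpa using this

include hM hr hA in
theorem wSym_sub_mem :
    wSym Q A - mulCoef (fun _ q => -2 * (wilsonMass q : ℂ)) ∈ OpOrd L M r γ 1 1 0 := by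
  have e : wSym Q A - mulCoef (fun _ q => -2 * (wilsonMass q : ℂ)) =
      ∑ μ, (symTrans Q A μ 1 + symTrans Q A μ (-1) -
        mulCoef (fun _ q => (2 * Real.cos (q μ) : ℝ))) := by
    have : (mulCoef (fun _ q => -2 * (wilsonMass q : ℂ)) : Module.End ℂ (Field m)) =
        ∑ μ : Fin (2 * m), (mulCoef (fun _ q => (2 * Real.cos (q μ) : ℝ)) - (2 : ℂ) • 1) := by
      ext1 f; funext a q x
      rw [LinearMap.sum_apply, Finset.sum_apply, Finset.sum_apply, Finset.sum_apply]
      have : ∀ μ, ((mulCoef (fun _ q => (2 * Real.cos (q μ) : ℝ)) - (2 : ℂ) • 1 :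
          Module.End ℂ (Field m)) f) a q x = ((2 * Real.cos (q μ) : ℝ) - 2 : ℂ) • f a q x :=
        fun μ => (sub_smul _ _ _).symm
      simp only [this]
      rw [← Finset.sum_smul, mulCoef, mulFun_apply, wilsonMass]
      refine congrArg (· • f a q x) ?_
      push_cast
      rw [Finset.mul_sum]
      refine Finset.sum_congr rfl fun μ _ => ?_
      ring
    rw [this, wSym, ← Finset.sum_sub_distrib]
    refine Finset.sum_congr rfl fun μ _ => ?_
    abel
  rw [e]
  exact sum_mem fun μ _ => symTrans_laplace_mem hM hr hA μ

include hM hr hA in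
theorem bSym_sub_mem :
    bSym M r Q A - mulCoef (fun a q => (freeMass M r a q : ℂ)) ∈ OpOrd L M r γ 1 0 0 := by
  have e : bSym M r Q A - mulCoef (fun a q => (freeMass M r a q : ℂ)) =
      -((r / 2 : ℝ) : ℂ) • (wSym Q A - mulCoef (fun _ q => -2 * (wilsonMass q : ℂ))) := by
    have : (mulCoef (fun a q => (freeMass M r a q : ℂ)) : Module.End ℂ (Field m)) =
        mulCoef (fun a _ => ((M * a : ℝ) : ℂ)) -
          ((r / 2 : ℝ) : ℂ) • mulCoef (fun _ q => -2 * (wilsonMass q : ℂ)) := by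
      ext1 f; funext a q x
      change (freeMass M r a q : ℂ) • f a q x = ((M * a : ℝ) : ℂ) • f a q x -
        ((r / 2 : ℝ) : ℂ) • ((-2 * (wilsonMass q : ℂ)) • f a q x)
      rw [smul_smul, ← sub_smul]
      refine congrArg (· • f a q x) ?_
      rw [freeMass]
      push_cast
      ring
    rw [this, bSym]
    module
  rw [e]
  exact Submodule.smul_mem _ _ (OpOrd.weaken hM hr (wSym_sub_mem hM hr hA))

include hM hr hA in
theorem bSym_mem : bSym M r Q A ∈ OpOrd L M r γ 0 1 0 := by
  have h1 : bSym M r Q A - mulCoef (fun a q => (freeMass M r a q : ℂ)) ∈ OpOrd L M r γ 0 1 0 :=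
    OpOrd.exchange hM hr 1 (t := 0) (n := 0) (by rw [zero_add]; exact bSym_sub_mem hM hr hA)
  have h2 : mulCoef (fun a q => (freeMass M r a q : ℂ)) ∈ OpOrd L M r γ 0 1 0 :=
    mulCoef_mem_OpOrd Coef.freeMass
  simpa using add_mem h1 h2

include hM hr hA in
-- A difference of squares, b² - b₀² = b₀(b - b₀) + (b - b₀)b, and likewise for each s_μ. One factor
-- is O(ρ) and the other is O(a).
theorem scalarSym_mem : scalarSym M r Q A ∈ OpOrd L M r γ 1 1 0 := by
  set b0 : Module.End ℂ (Field m) := mulCoef (fun a q => (freeMass M r a q : ℂ))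
  set s0 : Fin (2 * m) → Module.End ℂ (Field m) := fun μ =>
    mulCoef (fun _ q => Complex.I * Real.sin (q μ))
  have e0 : (mulCoef (fun a q => (freeSq M r a q : ℂ)) : Module.End ℂ (Field m)) =
      b0 * b0 - ∑ μ, s0 μ * s0 μ := by
    simp only [b0, s0, mulCoef_mul]
    ext1 f; funext a q x
    rw [LinearMap.sub_apply, LinearMap.sum_apply, Pi.sub_apply, Pi.sub_apply, Pi.sub_apply,
      Finset.sum_apply, Finset.sum_apply, Finset.sum_apply]
    simp only [mulCoef, mulFun_apply]
    rw [← Finset.sum_smul, ← sub_smul]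
    refine congrArg (· • f a q x) ?_
    rw [freeSq]
    push_cast
    rw [sq, sub_eq_add_neg, ← Finset.sum_neg_distrib]
    congr 1
    refine Finset.sum_congr rfl fun μ _ => ?_
    linear_combination (Complex.sin (q μ)) ^ 2 * Complex.I_mul_I
  have e : scalarSym M r Q A = (b0 * (bSym M r Q A - b0) + (bSym M r Q A - b0) * bSym M r Q A) -
      ∑ μ, (s0 μ * (sSym Q A μ - s0 μ) + (sSym Q A μ - s0 μ) * sSym Q A μ) := by
    rw [scalarSym, e0]
    have : ∀ μ, s0 μ * (sSym Q A μ - s0 μ) + (sSym Q A μ - s0 μ) * sSym Q A μ =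
        sSym Q A μ * sSym Q A μ - s0 μ * s0 μ := fun μ => by rw [mul_sub, sub_mul]; abel
    simp only [this, Finset.sum_sub_distrib]
    rw [mul_sub, sub_mul]
    abel
  rw [e]
  have hb0 : b0 ∈ OpOrd L M r γ 0 1 0 := mulCoef_mem_OpOrd Coef.freeMass
  have hs0 : ∀ μ, s0 μ ∈ OpOrd L M r γ 0 1 0 := fun μ =>
    mulCoef_mem_OpOrd ((Coef.const Complex.I).mul (Coef.sin μ))
  have h1 : b0 * (bSym M r Q A - b0) ∈ OpOrd L M r γ 1 1 0 := by
    exact OpOrd.mul_of_eq hb0 (bSym_sub_mem hM hr hA)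
  have h2 : (bSym M r Q A - b0) * bSym M r Q A ∈ OpOrd L M r γ 1 1 0 := by
    exact OpOrd.mul_of_eq (bSym_sub_mem hM hr hA) (bSym_mem hM hr hA)
  have h3 : ∀ μ, s0 μ * (sSym Q A μ - s0 μ) ∈ OpOrd L M r γ 1 1 0 := fun μ => by
    exact OpOrd.mul_of_eq (hs0 μ) (sSym_sub_mem hA μ)
  have h4 : ∀ μ, (sSym Q A μ - s0 μ) * sSym Q A μ ∈ OpOrd L M r γ 1 1 0 := fun μ => by
    exact OpOrd.mul_of_eq (sSym_sub_mem hA μ) (sSym_mem hM hr hA μ)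
  exact sub_mem (add_mem h1 h2) (sum_mem fun μ _ => add_mem (h3 μ) (h4 μ))

include hA in
-- The phases of the plane wave commute and factor out, so the only source of noncommutativity is
-- the gauge field: a² times the field strength, up to order a³.
theorem symTrans_commutator_mem (μ ν : Fin (2 * m)) (σ τ : ℝ) :
    symTrans Q A μ σ * symTrans Q A ν τ - symTrans Q A ν τ * symTrans Q A μ σ -
      fieldMul Q A μ ν (fun q => σ * τ * (Complex.exp (Complex.I * (σ * q μ : ℝ)) *
        Complex.exp (Complex.I * (τ * q ν : ℝ)))) ∈ OpOrd L M r γ 3 0 0 :=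
  OpOrd_of_elem fun t' n' j' c g Γ hc hg hΓ => by
    obtain ⟨k, hk, hkeq⟩ := hg.famTrans_commutator Q hA μ ν σ τ
    have e : (symTrans Q A μ σ * symTrans Q A ν τ - symTrans Q A ν τ * symTrans Q A μ σ -
        fieldMul Q A μ ν (fun q => σ * τ * (Complex.exp (Complex.I * (σ * q μ : ℝ)) *
          Complex.exp (Complex.I * (τ * q ν : ℝ))))) (elem c g Γ) =
        elem (fun a q => c a q * ((a : ℂ) ^ 3 * (Complex.exp (Complex.I * (σ * q μ : ℝ)) *
          Complex.exp (Complex.I * (τ * q ν : ℝ))))) k Γ := by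
      rw [LinearMap.sub_apply, LinearMap.sub_apply, Module.End.mul_apply, Module.End.mul_apply,
        symTrans_elem, symTrans_elem, symTrans_elem, symTrans_elem]
      funext a q x
      rw [Pi.sub_apply, Pi.sub_apply, Pi.sub_apply, Pi.sub_apply, Pi.sub_apply, Pi.sub_apply,
        fieldMul, mulFun_apply, elem_apply, elem_apply, elem_apply, elem_apply, smul_smul,
        ← sub_smul, ← sub_smul]
      refine congrArg (· • Γ) ?_
      linear_combination c a q * (Complex.exp (Complex.I * (σ * q μ : ℝ)) *
          Complex.exp (Complex.I * (τ * q ν : ℝ))) * hkeq a x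
    rw [e]
    refine elem_mem_Sym ?_ hk hΓ
    simpa using hc.mul ((Coef.spacing_pow 3).mul ((Coef.exp σ μ).mul (Coef.exp τ ν)))

theorem fieldMul_add (μ ν : Fin (2 * m)) (z z' : (Fin (2 * m) → ℝ) → ℂ) :
    fieldMul Q A μ ν z + fieldMul Q A μ ν z' = fieldMul Q A μ ν (fun q => z q + z' q) := by
  ext1 f; funext a q x
  rw [LinearMap.add_apply, Pi.add_apply, Pi.add_apply, Pi.add_apply, fieldMul, fieldMul, fieldMul,
    mulFun_apply, mulFun_apply, mulFun_apply, ← add_smul]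
  refine congrArg (· • f a q x) ?_
  ring

theorem smul_fieldMul (μ ν : Fin (2 * m)) (w : ℂ) (z : (Fin (2 * m) → ℝ) → ℂ) :
    w • fieldMul Q A μ ν z = fieldMul Q A μ ν (fun q => w * z q) := by
  ext1 f; funext a q x
  rw [LinearMap.smul_apply, Pi.smul_apply, Pi.smul_apply, Pi.smul_apply, fieldMul, fieldMul,
    mulFun_apply, mulFun_apply, smul_smul]
  refine congrArg (· • f a q x) ?_
  ring

include hA in
-- The four choices of signs enter with weight στ/4 from the two symmetric differences and with στ
-- from the oriented plaquette. The weights multiply to 1/4 and the phases add up to cos · cos.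
theorem sSym_commutator_mem (μ ν : Fin (2 * m)) :
    sSym Q A μ * sSym Q A ν - sSym Q A ν * sSym Q A μ -
      fieldMul Q A μ ν (fun q => Real.cos (q μ) * Real.cos (q ν)) ∈ OpOrd L M r γ 3 0 0 := by
  have hf : fieldMul Q A μ ν (fun q => Real.cos (q μ) * Real.cos (q ν)) =
      (1 / 4 : ℂ) • (fieldMul Q A μ ν (fun q => (1 : ℝ) * (1 : ℝ) *
          (Complex.exp (Complex.I * ((1 : ℝ) * q μ : ℝ)) *
            Complex.exp (Complex.I * ((1 : ℝ) * q ν : ℝ)))) +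
        (-1 : ℂ) • fieldMul Q A μ ν (fun q => (1 : ℝ) * (-1 : ℝ) *
          (Complex.exp (Complex.I * ((1 : ℝ) * q μ : ℝ)) *
            Complex.exp (Complex.I * ((-1 : ℝ) * q ν : ℝ)))) +
        (-1 : ℂ) • fieldMul Q A μ ν (fun q => (-1 : ℝ) * (1 : ℝ) *
          (Complex.exp (Complex.I * ((-1 : ℝ) * q μ : ℝ)) *
            Complex.exp (Complex.I * ((1 : ℝ) * q ν : ℝ)))) +
        fieldMul Q A μ ν (fun q => (-1 : ℝ) * (-1 : ℝ) *
          (Complex.exp (Complex.I * ((-1 : ℝ) * q μ : ℝ)) *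
            Complex.exp (Complex.I * ((-1 : ℝ) * q ν : ℝ))))) := by
    rw [smul_fieldMul, smul_fieldMul, fieldMul_add, fieldMul_add, fieldMul_add, smul_fieldMul]
    refine congrArg _ (funext fun q => ?_)
    rw [exp_one_mul_I, exp_one_mul_I, exp_neg_one_mul_I, exp_neg_one_mul_I]
    push_cast
    ring
  have e : sSym Q A μ * sSym Q A ν - sSym Q A ν * sSym Q A μ -
      fieldMul Q A μ ν (fun q => Real.cos (q μ) * Real.cos (q ν)) =
      (1 / 4 : ℂ) • ((symTrans Q A μ 1 * symTrans Q A ν 1 - symTrans Q A ν 1 * symTrans Q A μ 1 -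
        fieldMul Q A μ ν (fun q => (1 : ℝ) * (1 : ℝ) *
          (Complex.exp (Complex.I * ((1 : ℝ) * q μ : ℝ)) *
            Complex.exp (Complex.I * ((1 : ℝ) * q ν : ℝ))))) +
        (-1 : ℂ) • (symTrans Q A μ 1 * symTrans Q A ν (-1) -
          symTrans Q A ν (-1) * symTrans Q A μ 1 - fieldMul Q A μ ν (fun q => (1 : ℝ) * (-1 : ℝ) *
          (Complex.exp (Complex.I * ((1 : ℝ) * q μ : ℝ)) *
            Complex.exp (Complex.I * ((-1 : ℝ) * q ν : ℝ))))) +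
        (-1 : ℂ) • (symTrans Q A μ (-1) * symTrans Q A ν 1 -
          symTrans Q A ν 1 * symTrans Q A μ (-1) - fieldMul Q A μ ν (fun q => (-1 : ℝ) * (1 : ℝ) *
          (Complex.exp (Complex.I * ((-1 : ℝ) * q μ : ℝ)) *
            Complex.exp (Complex.I * ((1 : ℝ) * q ν : ℝ))))) +
        (symTrans Q A μ (-1) * symTrans Q A ν (-1) - symTrans Q A ν (-1) * symTrans Q A μ (-1) -
          fieldMul Q A μ ν (fun q => (-1 : ℝ) * (-1 : ℝ) *
          (Complex.exp (Complex.I * ((-1 : ℝ) * q μ : ℝ)) *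
            Complex.exp (Complex.I * ((-1 : ℝ) * q ν : ℝ)))))) := by
    rw [hf, sSym, sSym]
    simp only [smul_mul_assoc, mul_smul_comm, mul_sub, sub_mul]
    module
  rw [e]
  exact Submodule.smul_mem _ _ (add_mem (add_mem (add_mem (symTrans_commutator_mem hA μ ν 1 1)
    (Submodule.smul_mem _ _ (symTrans_commutator_mem hA μ ν 1 (-1))))
    (Submodule.smul_mem _ _ (symTrans_commutator_mem hA μ ν (-1) 1)))
    (symTrans_commutator_mem hA μ ν (-1) (-1)))

include hA in
-- Here only one of the two factors is a difference, so the orientation sign τ survives and the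
-- second cosine becomes i sin.
theorem sSym_symTrans_commutator_mem (μ ν : Fin (2 * m)) :
    sSym Q A μ * (symTrans Q A ν 1 + symTrans Q A ν (-1)) -
      (symTrans Q A ν 1 + symTrans Q A ν (-1)) * sSym Q A μ -
      fieldMul Q A μ ν (fun q => 2 * Complex.I * (Real.cos (q μ) * Real.sin (q ν))) ∈
        OpOrd L M r γ 3 0 0 := by
  have hf : fieldMul Q A μ ν (fun q => 2 * Complex.I * (Real.cos (q μ) * Real.sin (q ν))) =
      (1 / 2 : ℂ) • (fieldMul Q A μ ν (fun q => (1 : ℝ) * (1 : ℝ) *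
          (Complex.exp (Complex.I * ((1 : ℝ) * q μ : ℝ)) *
            Complex.exp (Complex.I * ((1 : ℝ) * q ν : ℝ)))) +
        fieldMul Q A μ ν (fun q => (1 : ℝ) * (-1 : ℝ) *
          (Complex.exp (Complex.I * ((1 : ℝ) * q μ : ℝ)) *
            Complex.exp (Complex.I * ((-1 : ℝ) * q ν : ℝ)))) +
        (-1 : ℂ) • fieldMul Q A μ ν (fun q => (-1 : ℝ) * (1 : ℝ) *
          (Complex.exp (Complex.I * ((-1 : ℝ) * q μ : ℝ)) *
            Complex.exp (Complex.I * ((1 : ℝ) * q ν : ℝ)))) +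
        (-1 : ℂ) • fieldMul Q A μ ν (fun q => (-1 : ℝ) * (-1 : ℝ) *
          (Complex.exp (Complex.I * ((-1 : ℝ) * q μ : ℝ)) *
            Complex.exp (Complex.I * ((-1 : ℝ) * q ν : ℝ))))) := by
    rw [smul_fieldMul, smul_fieldMul, fieldMul_add, fieldMul_add, fieldMul_add, smul_fieldMul]
    refine congrArg _ (funext fun q => ?_)
    rw [exp_one_mul_I, exp_one_mul_I, exp_neg_one_mul_I, exp_neg_one_mul_I]
    push_cast
    ring
  have e : sSym Q A μ * (symTrans Q A ν 1 + symTrans Q A ν (-1)) -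
      (symTrans Q A ν 1 + symTrans Q A ν (-1)) * sSym Q A μ -
      fieldMul Q A μ ν (fun q => 2 * Complex.I * (Real.cos (q μ) * Real.sin (q ν))) =
      (1 / 2 : ℂ) • ((symTrans Q A μ 1 * symTrans Q A ν 1 - symTrans Q A ν 1 * symTrans Q A μ 1 -
        fieldMul Q A μ ν (fun q => (1 : ℝ) * (1 : ℝ) *
          (Complex.exp (Complex.I * ((1 : ℝ) * q μ : ℝ)) *
            Complex.exp (Complex.I * ((1 : ℝ) * q ν : ℝ))))) +
        (symTrans Q A μ 1 * symTrans Q A ν (-1) -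
          symTrans Q A ν (-1) * symTrans Q A μ 1 - fieldMul Q A μ ν (fun q => (1 : ℝ) * (-1 : ℝ) *
          (Complex.exp (Complex.I * ((1 : ℝ) * q μ : ℝ)) *
            Complex.exp (Complex.I * ((-1 : ℝ) * q ν : ℝ))))) +
        (-1 : ℂ) • (symTrans Q A μ (-1) * symTrans Q A ν 1 -
          symTrans Q A ν 1 * symTrans Q A μ (-1) - fieldMul Q A μ ν (fun q => (-1 : ℝ) * (1 : ℝ) *
          (Complex.exp (Complex.I * ((-1 : ℝ) * q μ : ℝ)) *
            Complex.exp (Complex.I * ((1 : ℝ) * q ν : ℝ))))) +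
        (-1 : ℂ) • (symTrans Q A μ (-1) * symTrans Q A ν (-1) -
          symTrans Q A ν (-1) * symTrans Q A μ (-1) -
          fieldMul Q A μ ν (fun q => (-1 : ℝ) * (-1 : ℝ) *
          (Complex.exp (Complex.I * ((-1 : ℝ) * q μ : ℝ)) *
            Complex.exp (Complex.I * ((-1 : ℝ) * q ν : ℝ)))))) := by
    rw [hf, sSym]
    simp only [smul_mul_assoc, mul_smul_comm, mul_sub, sub_mul, mul_add, add_mul]
    module
  rw [e]
  exact Submodule.smul_mem _ _ (add_mem (add_mem (add_mem (symTrans_commutator_mem hA μ ν 1 1)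
    (symTrans_commutator_mem hA μ ν 1 (-1)))
    (Submodule.smul_mem _ _ (symTrans_commutator_mem hA μ ν (-1) 1)))
    (Submodule.smul_mem _ _ (symTrans_commutator_mem hA μ ν (-1) (-1))))

include hA in
theorem sSym_bSym_commutator_mem (μ : Fin (2 * m)) :
    sSym Q A μ * bSym M r Q A - bSym M r Q A * sSym Q A μ -
      ∑ ν, fieldMul Q A μ ν (fun q => -r * Complex.I * (Real.cos (q μ) * Real.sin (q ν))) ∈
        OpOrd L M r γ 3 0 0 := by
  have e : sSym Q A μ * bSym M r Q A - bSym M r Q A * sSym Q A μ -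
      ∑ ν, fieldMul Q A μ ν (fun q => -r * Complex.I * (Real.cos (q μ) * Real.sin (q ν))) =
      -((r / 2 : ℝ) : ℂ) • ∑ ν, (sSym Q A μ * (symTrans Q A ν 1 + symTrans Q A ν (-1)) -
        (symTrans Q A ν 1 + symTrans Q A ν (-1)) * sSym Q A μ -
        fieldMul Q A μ ν (fun q => 2 * Complex.I * (Real.cos (q μ) * Real.sin (q ν)))) := by
    have h1 : ∀ ν, fieldMul Q A μ ν
        (fun q => -r * Complex.I * (Real.cos (q μ) * Real.sin (q ν))) =
        -((r / 2 : ℝ) : ℂ) •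
          fieldMul Q A μ ν (fun q => 2 * Complex.I * (Real.cos (q μ) * Real.sin (q ν))) := by
      intro ν
      rw [smul_fieldMul]
      refine congrArg _ (funext fun q => ?_)
      push_cast
      ring
    have h2 : sSym Q A μ * wSym Q A - wSym Q A * sSym Q A μ =
        ∑ ν, (sSym Q A μ * (symTrans Q A ν 1 + symTrans Q A ν (-1)) -
        (symTrans Q A ν 1 + symTrans Q A ν (-1)) * sSym Q A μ) := by
      rw [wSym, Finset.mul_sum, Finset.sum_mul, ← Finset.sum_sub_distrib]
      refine Finset.sum_congr rfl fun ν _ => ?_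
      rw [mul_sub, sub_mul, mul_smul_comm, smul_mul_assoc, one_mul, mul_one]
      abel
    rw [Finset.sum_sub_distrib, ← h2, smul_sub, Finset.smul_sum]
    simp only [h1]
    rw [bSym, mul_sub, sub_mul, mulCoef_sSym, mul_smul_comm, smul_mul_assoc]
    module
  rw [e]
  exact Submodule.smul_mem _ _ (sum_mem fun ν _ => sSym_symTrans_commutator_mem hA μ ν)

include hA in
theorem curvSym_sub_mem : curvSym M r Q A γ - leadSym r Q A γ ∈ OpOrd L M r γ 3 0 2 := by
  have e : curvSym M r Q A γ - leadSym r Q A γ =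
      (1 / 2 : ℂ) • (∑ μ, ∑ ν, mulMat (γ μ) * mulMat (γ ν) *
        (sSym Q A μ * sSym Q A ν - sSym Q A ν * sSym Q A μ -
          fieldMul Q A μ ν (fun q => Real.cos (q μ) * Real.cos (q ν)))) +
      Complex.I • ∑ μ, mulMat (γ μ) * (sSym Q A μ * bSym M r Q A - bSym M r Q A * sSym Q A μ -
        ∑ ν, fieldMul Q A μ ν (fun q => -r * Complex.I * (Real.cos (q μ) * Real.sin (q ν)))) := by
    simp only [mul_sub (_ * _) _ (fieldMul _ _ _ _ _), mul_sub _ _ (∑ _, fieldMul _ _ _ _ _),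
      Finset.sum_sub_distrib, smul_sub]
    rw [curvSym, leadSym]
    abel
  rw [e]
  refine add_mem (Submodule.smul_mem _ _ (sum_mem fun μ _ => sum_mem fun ν _ => ?_))
    (Submodule.smul_mem _ _ (sum_mem fun μ _ => ?_))
  · exact OpOrd.mul_of_eq (OpOrd.mul_of_eq (mulMat_mem_OpOrd (gamma_mem_Fil μ))
      (mulMat_mem_OpOrd (gamma_mem_Fil ν)) rfl rfl rfl) (sSym_commutator_mem hA μ ν)
  · exact OpOrd.mono one_le_two (OpOrd.mul_of_eq (mulMat_mem_OpOrd (gamma_mem_Fil μ))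
      (sSym_bSym_commutator_mem hA μ) rfl rfl rfl)

include hA in
theorem fieldMul_mem (μ ν : Fin (2 * m)) {z : (Fin (2 * m) → ℝ) → ℂ}
    (hz : Coef L M r 0 0 (fun _ q => z q)) : fieldMul Q A μ ν z ∈ OpOrd L M r γ 2 0 0 := by
  have h1 : Coef L M r 2 0 (fun a q => (a : ℂ) ^ 2 * z q) := by
    simpa using (Coef.spacing_pow 2).mul hz
  have h2 : SmoothFamily L (fun p : ℝ × (Fin (2 * m) → ℝ) =>
      -Complex.I * Q * (fieldStrength A μ ν p.2 : ℂ)) :=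
    (SmoothFamily.const (-Complex.I * Q)).mul (smoothFamily_fieldStrength hA μ ν)
  have h3 := mulFun_mem_OpOrd (γ := γ) h1 h2
  exact h3

include hA in
theorem leadSym_mem : leadSym r Q A γ ∈ OpOrd L M r γ 2 0 2 := by
  have h1 : ∀ μ ν, Coef L M r 0 0
      (fun _ (q : Fin (2 * m) → ℝ) => (Real.cos (q μ) : ℂ) * (Real.cos (q ν) : ℂ)) :=
    fun μ ν => (Coef.cos μ).mul (Coef.cos ν)
  have h2 : ∀ μ ν, Coef L M r 0 0 (fun _ (q : Fin (2 * m) → ℝ) =>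
      -r * Complex.I * ((Real.cos (q μ) : ℂ) * (Real.sin (q ν) : ℂ))) :=
    fun μ ν => (Coef.const (-r * Complex.I)).mul ((Coef.cos μ).mul (Coef.sin_bounded ν))
  refine add_mem (Submodule.smul_mem _ _ (sum_mem fun μ _ => sum_mem fun ν _ => ?_))
    (Submodule.smul_mem _ _ (sum_mem fun μ _ => ?_))
  · exact OpOrd.mul_of_eq (OpOrd.mul_of_eq (mulMat_mem_OpOrd (gamma_mem_Fil μ))
      (mulMat_mem_OpOrd (gamma_mem_Fil ν)) rfl rfl rfl) (fieldMul_mem hA μ ν (h1 μ ν))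
  · exact OpOrd.mono one_le_two (OpOrd.mul_of_eq (mulMat_mem_OpOrd (gamma_mem_Fil μ))
      (sum_mem fun ν _ => fieldMul_mem hA μ ν (h2 μ ν)) rfl rfl rfl)

include hM hr hA in
theorem curvSym_mem : curvSym M r Q A γ ∈ OpOrd L M r γ 2 0 2 := by
  have h1 : curvSym M r Q A γ - leadSym r Q A γ ∈ OpOrd L M r γ 2 0 2 :=
    OpOrd.weaken hM hr (OpOrd.exchange hM hr 1 (t := 2) (n := 0) (curvSym_sub_mem hA))
  have := add_mem h1 (leadSym_mem (M := M) (r := r) (Q := Q) hA)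
  rwa [sub_add_cancel] at this

variable (r Q A γ) in
/-- The matrix by which `leadSym` multiplies, up to the square of the lattice spacing. -/
def leadMat (q x : Fin (2 * m) → ℝ) : Matrix (Fin (2 ^ m)) (Fin (2 ^ m)) ℂ :=
  (-Complex.I * Q) •
    ((1 / 2 : ℂ) • (∑ μ, ∑ ν, ((fieldStrength A μ ν x : ℂ) *
        ((Real.cos (q μ) : ℂ) * (Real.cos (q ν) : ℂ))) • (γ μ * γ ν)) +
      (r : ℂ) • ∑ μ, ∑ ν, ((fieldStrength A μ ν x : ℂ) *
        ((Real.cos (q μ) : ℂ) * (Real.sin (q ν) : ℂ))) • γ μ)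

theorem mulMat_apply (X : Matrix (Fin (2 ^ m)) (Fin (2 ^ m)) ℂ) (f : Field m) (a : ℝ)
    (q x : Fin (2 * m) → ℝ) : mulMat X f a q x = X * f a q x := rfl

/-- No translation is left at leading order, so this operator is pointwise multiplication by a
matrix and its powers are matrix powers at fixed q and x. -/
theorem leadSym_apply (f : Field m) (a : ℝ) (q x : Fin (2 * m) → ℝ) :
    leadSym r Q A γ f a q x = (a : ℂ) ^ 2 • (leadMat r Q A γ q x * f a q x) := by
  have h1 : ∀ μ ν, (mulMat (γ μ) * mulMat (γ ν) *
      fieldMul Q A μ ν (fun q => Real.cos (q μ) * Real.cos (q ν))) f a q x =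
      ((a : ℂ) ^ 2 * (-Complex.I * Q)) • (((fieldStrength A μ ν x : ℂ) *
        ((Real.cos (q μ) : ℂ) * (Real.cos (q ν) : ℂ))) • (γ μ * γ ν)) * f a q x := by
    intro μ ν
    rw [mulMat_mul_mulMat, Module.End.mul_apply, mulMat_apply, fieldMul, mulFun_apply, smul_smul,
      mul_smul_comm, smul_mul_assoc]
    refine congrArg (· • (γ μ * γ ν * f a q x)) ?_
    ring
  have h2 : ∀ μ, (mulMat (γ μ) * ∑ ν, fieldMul Q A μ ν
      (fun q => -r * Complex.I * (Real.cos (q μ) * Real.sin (q ν)))) f a q x =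
      ((a : ℂ) ^ 2 * (-Complex.I * Q) * (-Complex.I * r)) • (∑ ν, ((fieldStrength A μ ν x : ℂ) *
        ((Real.cos (q μ) : ℂ) * (Real.sin (q ν) : ℂ))) • γ μ) * f a q x := by
    intro μ
    rw [Finset.mul_sum, LinearMap.sum_apply, Finset.sum_apply, Finset.sum_apply, Finset.sum_apply,
      Finset.smul_sum, Finset.sum_mul]
    refine Finset.sum_congr rfl fun ν _ => ?_
    rw [Module.End.mul_apply, mulMat_apply, fieldMul, mulFun_apply, smul_smul,
      mul_smul_comm, smul_mul_assoc]
    refine congrArg (· • (γ μ * f a q x)) ?_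
    ring
  rw [leadSym, LinearMap.add_apply, LinearMap.smul_apply, LinearMap.smul_apply,
    LinearMap.sum_apply, LinearMap.sum_apply, Pi.add_apply, Pi.add_apply, Pi.add_apply,
    Pi.smul_apply, Pi.smul_apply, Pi.smul_apply, Pi.smul_apply, Pi.smul_apply, Pi.smul_apply,
    Finset.sum_apply, Finset.sum_apply, Finset.sum_apply, Finset.sum_apply, Finset.sum_apply,
    Finset.sum_apply]
  simp only [LinearMap.sum_apply, Finset.sum_apply, h1, h2]
  simp only [← Finset.sum_mul, ← Finset.smul_sum]
  rw [← smul_mul_assoc, ← smul_mul_assoc, ← add_mul, ← smul_mul_assoc, leadMat]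
  refine congrArg (· * f a q x) ?_
  rw [smul_smul, smul_smul, smul_smul, smul_add, smul_smul, smul_smul]
  congr 2
  · ring
  · linear_combination -(a : ℂ) ^ 2 * (-Complex.I * Q) * r * Complex.I_mul_I

theorem leadSym_pow_apply (k : ℕ) (f : Field m) (a : ℝ) (q x : Fin (2 * m) → ℝ) :
    (leadSym r Q A γ ^ k) f a q x = (a : ℂ) ^ (2 * k) • (leadMat r Q A γ q x ^ k * f a q x) := by
  induction k with
  | zero => simp
  | succ k ih =>
    rw [pow_succ', Module.End.mul_apply, leadSym_apply, ih, mul_smul_comm, smul_smul, ← pow_add,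
      ← mul_assoc, ← pow_succ', mul_add, mul_one, add_comm]

include hM hr hA in
theorem hSymAdj_mem : hSymAdj M r Q A γ ∈ OpOrd L M r γ 0 1 1 := by
  refine sub_mem (OpOrd.mono zero_le_one (bSym_mem hM hr hA))
    (Submodule.smul_mem _ _ (sum_mem fun μ _ => ?_))
  exact OpOrd.mul_of_eq (mulMat_mem_OpOrd (gamma_mem_Fil μ)) (sSym_mem hM hr hA μ)

variable (M r γ) in
/-- The free value of `hSymAdj`. -/
def freeAdj : Module.End ℂ (Field m) :=
  mulCoef (fun a q => (freeMass M r a q : ℂ)) -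
    Complex.I • ∑ μ, mulMat (γ μ) * mulCoef (fun _ q => Complex.I * Real.sin (q μ))

theorem freeAdj_apply (f : Field m) (a : ℝ) (q x : Fin (2 * m) → ℝ) :
    freeAdj M r γ f a q x =
      ((freeMass M r a q : ℂ) • 1 + ∑ μ, (Real.sin (q μ) : ℂ) • γ μ) * f a q x := by
  rw [freeAdj, LinearMap.sub_apply, LinearMap.smul_apply, LinearMap.sum_apply, Pi.sub_apply,
    Pi.sub_apply, Pi.sub_apply, Pi.smul_apply, Pi.smul_apply, Pi.smul_apply, Finset.sum_apply,
    Finset.sum_apply, Finset.sum_apply, add_mul, smul_mul_assoc, one_mul, Finset.sum_mul, mulCoef,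
    mulFun_apply, sub_eq_add_neg, Finset.smul_sum, ← Finset.sum_neg_distrib]
  refine congrArg _ (Finset.sum_congr rfl fun μ _ => ?_)
  rw [Module.End.mul_apply, mulMat_apply, mulCoef, mulFun_apply, mul_smul_comm, smul_mul_assoc,
    smul_smul, ← neg_smul]
  refine congrArg (· • (γ μ * f a q x)) ?_
  linear_combination -(Real.sin (q μ) : ℂ) * Complex.I_mul_I

include hM hr hA in
theorem hSymAdj_sub_mem : hSymAdj M r Q A γ - freeAdj M r γ ∈ OpOrd L M r γ 1 0 1 := by
  have e : hSymAdj M r Q A γ - freeAdj M r γ =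
      (bSym M r Q A - mulCoef (fun a q => (freeMass M r a q : ℂ))) -
        Complex.I • ∑ μ, mulMat (γ μ) *
          (sSym Q A μ - mulCoef (fun _ q => Complex.I * Real.sin (q μ))) := by
    simp only [mul_sub, Finset.sum_sub_distrib, smul_sub]
    rw [hSymAdj, freeAdj]
    abel
  rw [e]
  refine sub_mem (OpOrd.mono zero_le_one (bSym_sub_mem hM hr hA))
    (Submodule.smul_mem _ _ (sum_mem fun μ _ => ?_))
  exact OpOrd.mul_of_eq (mulMat_mem_OpOrd (gamma_mem_Fil μ)) (sSym_sub_mem hA μ)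

end Orders

end Operators
end
end LatticeFermion

namespace LatticeFermion
noncomputable section
open scoped Kronecker Matrix ComplexConjugate

/-! ### Expanding powers of the remainder by number of curvature factors -/

section Expansion

variable {m : ℕ} {L M r Q : ℝ} {A : Fin (2 * m) → (Fin (2 * m) → ℝ) → ℝ}
  {γ : Fin (2 * m) → Matrix (Fin (2 ^ m)) (Fin (2 ^ m)) ℂ}

/-- The elementary symbol of a function of `x`. -/
def scalarField (ξ : (Fin (2 * m) → ℝ) → ℝ) : Field m := fun _ _ x => ((ξ x : ℝ) : ℂ) • 1

variable (Q A) in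
/-- The symbol of the anticommutator of the Wilson operator with multiplication by `ξ`. -/
def sourceSym (ξ : (Fin (2 * m) → ℝ) → ℝ) : Field m :=
  wSym Q A (scalarField ξ) + mulFun (fun _ _ x => ((ξ x : ℝ) : ℂ)) (wSym Q A (scalarField fun _ => 1))

/-- The leading part of `sourceSym`. -/
def leadSource (ξ : (Fin (2 * m) → ℝ) → ℝ) : Field m :=
  fun _ q x => (-4 * (wilsonMass q : ℂ) * (ξ x : ℂ)) • 1

theorem scalarField_mem {ξ : (Fin (2 * m) → ℝ) → ℝ} (hξ : SmoothOnTorus L ξ) :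
    scalarField ξ ∈ Sym L M r γ 0 0 0 := by
  have h := elem_mem_Sym (Coef.const (L := L) (M := M) (r := r) 1) hξ.smoothFamily
    (one_mem_Fil (γ := γ) 0)
  have e : scalarField ξ = elem (fun _ _ => 1) (fun p => ((ξ p.2 : ℝ) : ℂ)) 1 := by
    funext a q x
    rw [elem_apply, one_mul, scalarField]
  rwa [e]

theorem smoothOnTorus_one : SmoothOnTorus (d := 2 * m) L (fun _ => 1) :=
  ⟨contDiff_const, fun _ _ => rfl⟩

variable (hM : 0 < M) (hr : 0 < r) (hA : ∀ μ, SmoothOnTorus L (A μ))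
  {ξ : (Fin (2 * m) → ℝ) → ℝ} (hξ : SmoothOnTorus L ξ)

include hM hr hξ in
theorem leadSource_mem : leadSource ξ ∈ Sym L M r γ 0 2 0 := by
  have h1 : Coef (d := 2 * m) L M r 0 2 (fun _ q => -4 * (wilsonMass q : ℂ)) := by
    have := (Coef.const (L := L) (-4)).mul (Coef.wilsonMass (d := 2 * m) (L := L) hM hr)
    rwa [zero_add, zero_add] at this
  exact elem_mem_Sym h1 hξ.smoothFamily (one_mem_Fil (γ := γ) 0)

include hM hr hA hξ in
theorem sourceSym_sub_mem : sourceSym Q A ξ - leadSource ξ ∈ Sym L M r γ 1 1 0 := by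
  have e : sourceSym Q A ξ - leadSource ξ =
      (wSym Q A - mulCoef (fun _ q => -2 * (wilsonMass q : ℂ)) : Module.End ℂ (Field m))
          (scalarField ξ) +
        mulFun (fun _ _ x => ((ξ x : ℝ) : ℂ))
          ((wSym Q A - mulCoef (fun _ q => -2 * (wilsonMass q : ℂ)) : Module.End ℂ (Field m))
            (scalarField fun _ => 1)) := by
    have h : leadSource ξ = mulCoef (fun _ q => -2 * (wilsonMass q : ℂ)) (scalarField ξ) +
        mulFun (fun _ _ x => ((ξ x : ℝ) : ℂ))
          (mulCoef (fun _ q => -2 * (wilsonMass q : ℂ)) (scalarField fun _ => 1)) := by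
      funext a q x
      rw [Pi.add_apply, Pi.add_apply, Pi.add_apply, mulCoef, mulFun_apply, mulFun_apply,
        mulFun_apply, scalarField, scalarField, leadSource, smul_smul, smul_smul, smul_smul,
        ← add_smul]
      refine congrArg (· • (1 : Matrix (Fin (2 ^ m)) (Fin (2 ^ m)) ℂ)) ?_
      push_cast
      ring
    rw [h, sourceSym, LinearMap.sub_apply, LinearMap.sub_apply, map_sub]
    abel
  have h1 := wSym_sub_mem (γ := γ) (Q := Q) hM hr hA
  have h2 : mulFun (fun _ _ x => ((ξ x : ℝ) : ℂ)) ∈ OpOrd L M r γ 0 0 0 := by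
    have := mulFun_mem_OpOrd (γ := γ) (Coef.const (L := L) (M := M) (r := r) 1) hξ.smoothFamily
    simpa using this
  rw [e]
  refine add_mem ?_ ?_
  · exact h1 0 0 0 _ (scalarField_mem hξ)
  · exact h2 1 1 0 _ (h1 0 0 0 _ (scalarField_mem smoothOnTorus_one))

include hM hr hA hξ in
theorem sourceSym_mem : sourceSym Q A ξ ∈ Sym L M r γ 0 2 0 := by
  have h1 : sourceSym Q A ξ - leadSource ξ ∈ Sym L M r γ 0 2 0 :=
    Sym_exchange hM hr 1 0 1 0 (sourceSym_sub_mem hM hr hA hξ)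
  have := add_mem h1 (leadSource_mem hM hr hξ)
  rwa [sub_add_cancel] at this

variable (L M r γ) in
/-- The span of the symbols that contain fewer than `k` factors of the curvature. -/
def partialSym (k : ℕ) : Submodule ℂ (Field m) :=
  ⨆ j : Fin k, Sym L M r γ (j + k) (k + 2 - j) (2 * j)

theorem Sym_le_partialSym {k j t n i : ℕ} (hj : j < k) (ht : t = j + k) (hn : n + j = k + 2)
    (hi : i = 2 * j) : Sym L M r γ t n i ≤ partialSym L M r γ k := by
  have h : Sym L M r γ (j + k) (k + 2 - j) (2 * j) ≤ partialSym L M r γ k :=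
    le_iSup (fun j : Fin k => Sym L M r γ (j + k) (k + 2 - j) (2 * j)) ⟨j, hj⟩
  have hn' : n = k + 2 - j := by omega
  rwa [ht, hn', hi]

include hM hr hA hξ

theorem curvSym_pow_mem (k : ℕ) :
    (curvSym M r Q A γ ^ k) (sourceSym Q A ξ) ∈ Sym L M r γ (2 * k) 2 (2 * k) := by
  induction k with
  | zero => exact sourceSym_mem hM hr hA hξ
  | succ k ih =>
    rw [pow_succ', Module.End.mul_apply]
    exact curvSym_mem hM hr hA _ _ _ _ ih

theorem leadSym_pow_mem (k : ℕ) :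
    (leadSym r Q A γ ^ k) (leadSource ξ) ∈ Sym L M r γ (2 * k) 2 (2 * k) := by
  induction k with
  | zero => exact leadSource_mem hM hr hξ
  | succ k ih =>
    rw [pow_succ', Module.End.mul_apply]
    exact leadSym_mem hA _ _ _ _ ih

/-- Telescoping: replacing the source or one curvature factor by its leading part gains one power of
a. The curvature replacement is weakened by one ρ to fit the common order. -/
theorem curvSym_pow_sub_mem (k : ℕ) : (curvSym M r Q A γ ^ k) (sourceSym Q A ξ) -
    (leadSym r Q A γ ^ k) (leadSource ξ) ∈ Sym L M r γ (2 * k + 1) 1 (2 * k) := by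
  induction k with
  | zero => exact sourceSym_sub_mem hM hr hA hξ
  | succ k ih =>
    have e : (curvSym M r Q A γ ^ (k + 1)) (sourceSym Q A ξ) -
        (leadSym r Q A γ ^ (k + 1)) (leadSource ξ) =
        curvSym M r Q A γ ((curvSym M r Q A γ ^ k) (sourceSym Q A ξ) -
          (leadSym r Q A γ ^ k) (leadSource ξ)) +
        (curvSym M r Q A γ - leadSym r Q A γ) ((leadSym r Q A γ ^ k) (leadSource ξ)) := by
      rw [pow_succ', pow_succ', Module.End.mul_apply, Module.End.mul_apply, map_sub,
        LinearMap.sub_apply]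
      abel
    rw [e]
    have h1 := curvSym_mem (Q := Q) hM hr hA _ _ _ _ ih
    have h2 := curvSym_sub_mem (M := M) (r := r) (Q := Q) hA _ _ _ _
      (leadSym_pow_mem (γ := γ) (Q := Q) hM hr hA hξ k)
    -- Replacing a curvature factor leaves ρ², one more power than the target class records.
    refine add_mem ?_ (Sym_weaken hM hr _ _ _ ?_)
    · convert h1 using 2 <;> omega
    · exact h2

/-- Expand (scalar + curvature)^k as a noncommutative sum and discard the pure curvature word. A
word with j < k curvature factors has a-order 2j + (k - j), ρ-order 2 + (k - j) and gamma degree 2j.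
-/
theorem remSym_pow_sub_mem (hγγ : CliffordRel γ) (k : ℕ) :
    (remSym M r Q A γ ^ k) (sourceSym Q A ξ) - (curvSym M r Q A γ ^ k) (sourceSym Q A ξ) ∈
      partialSym L M r γ k := by
  induction k with
  | zero => simp
  | succ k ih =>
    have e : (remSym M r Q A γ ^ (k + 1)) (sourceSym Q A ξ) -
        (curvSym M r Q A γ ^ (k + 1)) (sourceSym Q A ξ) =
        remSym M r Q A γ ((remSym M r Q A γ ^ k) (sourceSym Q A ξ) -
          (curvSym M r Q A γ ^ k) (sourceSym Q A ξ)) +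
        scalarSym M r Q A ((curvSym M r Q A γ ^ k) (sourceSym Q A ξ)) := by
      rw [pow_succ', pow_succ', Module.End.mul_apply, Module.End.mul_apply, map_sub,
        remSym_eq hγγ, LinearMap.add_apply, LinearMap.add_apply]
      abel
    rw [e]
    refine add_mem ?_ ?_
    · have : partialSym L M r γ k ≤ (partialSym L M r γ (k + 1)).comap (remSym M r Q A γ) := by
        refine iSup_le fun j f hf => ?_
        have hj := j.2
        rw [Submodule.mem_comap, remSym_eq hγγ, LinearMap.add_apply]
        refine add_mem ?_ ?_
        · exact Sym_le_partialSym (j := j) (by omega) (by omega) (by omega) (by omega)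
            (scalarSym_mem hM hr hA _ _ _ _ hf)
        · exact Sym_le_partialSym (j := j + 1) (by omega) (by omega) (by omega) (by omega)
            (curvSym_mem hM hr hA _ _ _ _ hf)
      exact this ih
    · exact Sym_le_partialSym (j := k) (by omega) (by omega) (by omega) (by omega)
        (scalarSym_mem hM hr hA _ _ _ _ (curvSym_pow_mem hM hr hA hξ k))

/-- A crude count in which a curvature factor is charged only (1,1,2). It suffices for the tail of
the series, where many factors are present. -/
theorem remSym_pow_mem (hγγ : CliffordRel γ) (k : ℕ) :
    (remSym M r Q A γ ^ k) (sourceSym Q A ξ) ∈ Sym L M r γ k (k + 2) (2 * k) := by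
  induction k with
  | zero => exact sourceSym_mem hM hr hA hξ
  | succ k ih =>
    rw [pow_succ', Module.End.mul_apply]
    have h1 : remSym M r Q A γ ∈ OpOrd L M r γ 1 1 2 := by
      rw [remSym_eq hγγ]
      exact add_mem (OpOrd.mono zero_le_two (scalarSym_mem hM hr hA))
        (OpOrd.exchange hM hr 1 (t := 1) (n := 0) (curvSym_mem hM hr hA))
    have := h1 _ _ _ _ ih
    convert this using 2
    omega

end Expansion

/-! ### Chiral traces of the terms of the series -/

section Bounds

variable {m : ℕ} (L M r : ℝ) (γ : Fin (2 * m) → Matrix (Fin (2 ^ m)) (Fin (2 ^ m)) ℂ)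

/-- Fields whose trace against the chirality matrix is small. -/
def TrBound (k : ℕ) : Submodule ℂ (Field m) where
  carrier := {f | ∃ C : ℝ, ∀ a, 0 < a → a ≤ L → ∀ q, ∀ x ∈ Set.univ.pi fun _ => Set.Icc 0 L,
    ‖(f a q x * chirality γ).trace‖ * rho M r a q ^ (2 * m) ≤
      C * (a ^ (2 * m + 1) * rho M r a q ^ (2 * k + 2))}
  add_mem' := by
    rintro f g ⟨C, hC⟩ ⟨D, hD⟩
    refine ⟨C + D, fun a ha haL q x hx => ?_⟩
    rw [Pi.add_apply, Pi.add_apply, Pi.add_apply, add_mul, Matrix.trace_add, add_mul]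
    refine le_trans ?_ (add_le_add (hC a ha haL q x hx) (hD a ha haL q x hx))
    rw [← add_mul]
    exact mul_le_mul_of_nonneg_right (norm_add_le _ _) (pow_nonneg (rho_nonneg M r a q) _)
  zero_mem' := ⟨0, fun a _ _ q x _ => by simp⟩
  smul_mem' := by
    rintro z f ⟨C, hC⟩
    refine ⟨‖z‖ * C, fun a ha haL q x hx => ?_⟩
    rw [Pi.smul_apply, Pi.smul_apply, Pi.smul_apply, Matrix.smul_mul, Matrix.trace_smul, norm_smul,
      mul_assoc, mul_assoc]
    exact mul_le_mul_of_nonneg_left (hC a ha haL q x hx) (norm_nonneg z)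

variable {L M r γ}

theorem Sym_le_TrBound_of_lt (h : CliffordRel γ) {t n j : ℕ} (k : ℕ) (hj : j < 2 * m) :
    Sym L M r γ t n j ≤ TrBound L M r γ k :=
  Sym_le fun c g Γ _ _ hΓ => ⟨0, fun a _ _ q x _ => by
    rw [elem_apply, Matrix.smul_mul, Matrix.trace_smul, h.trace_Fil hj hΓ]; simp⟩

/-- The weight t + n is 2k + 3 for the k-th term: 2 from the source, 2 from each remainder factor, 1
from the adjoint. The powers of a beyond 2m + 1 are exchanged for powers of ρ, which preserves this
weight. -/
theorem Sym_le_TrBound (hM : 0 < M) (hr : 0 < r) {t n j k : ℕ} (ht : 2 * m + 1 ≤ t)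
    (hn : t + n = 2 * k + 3) : Sym L M r γ t n j ≤ TrBound L M r γ k := by
  obtain ⟨i, rfl⟩ := Nat.exists_eq_add_of_le ht
  refine (Sym_exchange hM hr i _ _ _).trans (Sym_le fun c g Γ hc hg _ => ?_)
  obtain ⟨C, hC⟩ := hc
  obtain ⟨D, hD⟩ := hg.bounded
  refine ⟨C * D * ‖(Γ * chirality γ).trace‖, fun a ha haL q x hx => ?_⟩
  rw [elem_apply, Matrix.smul_mul, Matrix.trace_smul, norm_smul, norm_mul]
  have h1 := hC a ha haL q
  have h2 := hD a ⟨ha.le, haL⟩ x hx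
  calc ‖c a q‖ * ‖g (a, x)‖ * ‖(Γ * chirality γ).trace‖ * rho M r a q ^ (2 * m) ≤
      (C * (a ^ (2 * m + 1) * rho M r a q ^ (n + i))) * D * ‖(Γ * chirality γ).trace‖ *
        rho M r a q ^ (2 * m) :=
        mul_le_mul_of_nonneg_right (mul_le_mul_of_nonneg_right
          (mul_le_mul h1 h2 (norm_nonneg _) ((norm_nonneg _).trans h1)) (norm_nonneg _))
          (pow_nonneg (rho_nonneg M r a q) _)
    _ = _ := by
      rw [show 2 * k + 2 = n + i + 2 * m by omega, pow_add _ (n + i)]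
      ring

theorem Sym_entry_bounded {t n j : ℕ} {f : Field m} (hf : f ∈ Sym L M r γ t n j) :
    ∃ C : ℝ, ∀ a, 0 < a → a ≤ L → ∀ q, ∀ x ∈ Set.univ.pi fun _ => Set.Icc 0 L, ∀ s s',
      ‖f a q x s s'‖ ≤ C * (a ^ t * rho M r a q ^ n) := by
  induction hf using Submodule.span_induction with
  | mem f hf =>
    obtain ⟨c, g, Γ, ⟨C, hC⟩, hg, -, rfl⟩ := hf
    obtain ⟨D, hD⟩ := hg.bounded
    refine ⟨C * D * ∑ s, ∑ s', ‖Γ s s'‖, fun a ha haL q x hx s s' => ?_⟩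
    rw [elem_apply, Matrix.smul_apply, norm_smul, norm_mul]
    have h1 := hC a ha haL q
    have h2 := hD a ⟨ha.le, haL⟩ x hx
    have h3 : ‖Γ s s'‖ ≤ ∑ s, ∑ s', ‖Γ s s'‖ :=
      (Finset.single_le_sum (f := fun s' => ‖Γ s s'‖) (fun _ _ => norm_nonneg _)
        (Finset.mem_univ s')).trans
      (Finset.single_le_sum (f := fun s => ∑ s', ‖Γ s s'‖)
        (fun _ _ => Finset.sum_nonneg fun _ _ => norm_nonneg _) (Finset.mem_univ s))
    calc ‖c a q‖ * ‖g (a, x)‖ * ‖Γ s s'‖ ≤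
        (C * (a ^ t * rho M r a q ^ n)) * D * ∑ s, ∑ s', ‖Γ s s'‖ := by
          have h4 := mul_le_mul h1 h2 (norm_nonneg _) ((norm_nonneg _).trans h1)
          exact mul_le_mul h4 h3 (norm_nonneg _) ((by positivity : (0:ℝ) ≤ _).trans h4)
      _ = _ := by ring
  | zero => exact ⟨0, fun a _ _ q x _ s s' => by simp⟩
  | add f g _ _ hf hg =>
    obtain ⟨C, hC⟩ := hf
    obtain ⟨D, hD⟩ := hg
    refine ⟨C + D, fun a ha haL q x hx s s' => (norm_add_le _ _).trans ?_⟩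
    rw [add_mul]
    exact add_le_add (hC a ha haL q x hx s s') (hD a ha haL q x hx s s')
  | smul z f _ hf =>
    obtain ⟨C, hC⟩ := hf
    refine ⟨‖z‖ * C, fun a ha haL q x hx s s' => ?_⟩
    rw [Pi.smul_apply, Pi.smul_apply, Pi.smul_apply, Matrix.smul_apply, norm_smul, mul_assoc]
    exact mul_le_mul_of_nonneg_left (hC a ha haL q x hx s s') (norm_nonneg z)

variable {Q : ℝ} {A : Fin (2 * m) → (Fin (2 * m) → ℝ) → ℝ}

/-- In the expansion of the inverse, the chiral trace of every term but the leading one is small. -/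
theorem hSymAdj_remSym_pow_mem (hM : 0 < M) (hr : 0 < r) (hA : ∀ μ, SmoothOnTorus L (A μ))
    {ξ : (Fin (2 * m) → ℝ) → ℝ} (hξ : SmoothOnTorus L ξ) (hγγ : CliffordRel γ) (k : ℕ) :
    hSymAdj M r Q A γ ((remSym M r Q A γ ^ k) (sourceSym Q A ξ)) -
      (if k = m then freeAdj M r γ ((leadSym r Q A γ ^ m) (leadSource ξ)) else 0) ∈
        TrBound L M r γ k := by
  have hadj := hSymAdj_mem (γ := γ) (Q := Q) hM hr hA
  have h1 : hSymAdj M r Q A γ ((remSym M r Q A γ ^ k) (sourceSym Q A ξ) -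
      (curvSym M r Q A γ ^ k) (sourceSym Q A ξ)) ∈ TrBound L M r γ k := by
    have : partialSym L M r γ k ≤ (TrBound L M r γ k).comap (hSymAdj M r Q A γ) := by
      refine iSup_le fun j f hf => ?_
      have hj := j.2
      have h := hadj (j + k) (k + 2 - j) (2 * j) f hf
      rw [Submodule.mem_comap]
      -- With j < m curvature factors the gamma degree is at most 2j + 1 < 2m and the chiral trace
      -- vanishes. With j ≥ m, the strict inequality j < k makes the a-order j + k at least 2m + 1.
      rcases Nat.lt_or_ge j m with hjm | hjm
      · exact Sym_le_TrBound_of_lt hγγ k (by omega) h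
      · exact Sym_le_TrBound hM hr (by omega) (by omega) h
    have h3 := this (remSym_pow_sub_mem (Q := Q) hM hr hA hξ hγγ k)
    rwa [Submodule.mem_comap] at h3
  have h2 : hSymAdj M r Q A γ ((curvSym M r Q A γ ^ k) (sourceSym Q A ξ)) -
      (if k = m then freeAdj M r γ ((leadSym r Q A γ ^ m) (leadSource ξ)) else 0) ∈
        TrBound L M r γ k := by
    have h := hadj _ _ _ _ (curvSym_pow_mem (γ := γ) (Q := Q) hM hr hA hξ k)
    -- Pure curvature words: too few gamma matrices if k < m, at least two spare powers of a if k >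
    -- m. Only k = m needs its leading part subtracted.
    rcases lt_trichotomy k m with hk | rfl | hk
    · rw [if_neg hk.ne, sub_zero]
      exact Sym_le_TrBound_of_lt hγγ k (by omega) h
    · rw [if_pos rfl]
      have e : hSymAdj M r Q A γ ((curvSym M r Q A γ ^ k) (sourceSym Q A ξ)) -
          freeAdj M r γ ((leadSym r Q A γ ^ k) (leadSource ξ)) =
          hSymAdj M r Q A γ ((curvSym M r Q A γ ^ k) (sourceSym Q A ξ) -
            (leadSym r Q A γ ^ k) (leadSource ξ)) +
          (hSymAdj M r Q A γ - freeAdj M r γ) ((leadSym r Q A γ ^ k) (leadSource ξ)) := by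
        rw [map_sub, LinearMap.sub_apply]
        abel
      rw [e]
      refine add_mem ?_ ?_
      · exact Sym_le_TrBound hM hr (by omega) (by omega)
          (hadj _ _ _ _ (curvSym_pow_sub_mem (γ := γ) (Q := Q) hM hr hA hξ k))
      · exact Sym_le_TrBound hM hr (by omega) (by omega)
          (hSymAdj_sub_mem (Q := Q) hM hr hA _ _ _ _
            (leadSym_pow_mem (γ := γ) (Q := Q) hM hr hA hξ k))
    · rw [if_neg hk.ne', sub_zero]
      exact Sym_le_TrBound hM hr (by omega) (by omega) h
  have := add_mem h1 h2
  rw [map_sub] at this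
  convert this using 1
  abel

end Bounds
end
end LatticeFermion

namespace LatticeFermion
noncomputable section
open scoped Kronecker Matrix ComplexConjugate

/-! ### Anti-periodic plane waves -/

section Waves

variable {d N : ℕ}

/-- The plane wave with lattice momentum `q`. -/
def wave (q : Fin d → ℝ) (x : Site d N) : ℂ := ∏ μ, Complex.exp (Complex.I * (q μ * (x μ : ℕ) : ℝ))

/-- Lattice momenta of anti-periodic plane waves. -/
def AntiPeriodic (N : ℕ) (q : Fin d → ℝ) : Prop := ∀ μ, Complex.exp (Complex.I * (q μ * N : ℝ)) = -1

theorem star_wave_mul_self (q : Fin d → ℝ) (x : Site d N) : star (wave q x) * wave q x = 1 := by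
  rw [wave, star_prod, ← Finset.prod_mul_distrib]
  refine Finset.prod_eq_one fun μ _ => ?_
  change (starRingEnd ℂ) _ * _ = 1
  rw [← Complex.exp_conj, ← Complex.exp_add]
  simp

theorem norm_wave (q : Fin d → ℝ) (x : Site d N) : ‖wave q x‖ = 1 := by
  rw [wave, norm_prod]
  refine Finset.prod_eq_one fun μ _ => ?_
  rw [mul_comm, Complex.norm_exp_ofReal_mul_I]

variable [NeZero N]

theorem val_add_one_cases (x : Fin N) :
    ((x : ℕ) + 1 = N ∧ ((x + 1 : Fin N) : ℕ) = 0) ∨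
      ((x : ℕ) + 1 ≠ N ∧ ((x + 1 : Fin N) : ℕ) = x + 1) := by
  have h : ((x + 1 : Fin N) : ℕ) = (x + 1) % N := by
    rw [Fin.val_add, Fin.val_one', Nat.add_mod_mod]
  rw [h]
  have hx := x.2
  rcases eq_or_ne ((x : ℕ) + 1) N with h1 | h1
  · exact Or.inl ⟨h1, by rw [h1, Nat.mod_self]⟩
  · exact Or.inr ⟨h1, Nat.mod_eq_of_lt (by omega)⟩

/-- At the seam the wave falls back from phase qN to 0, and e^{iqN} = -1 is exactly the sign carried
by the anti-periodic field. Thus plane waves are eigenvectors of the free translation. -/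
theorem wrapSign_mul_wave_next {q : Fin d → ℝ} (hq : AntiPeriodic N q) (x : Site d N) (μ : Fin d) :
    wrapSign x μ * wave q (next x μ) = Complex.exp (Complex.I * (q μ : ℝ)) * wave q x := by
  rw [wave, wave, ← Finset.mul_prod_erase _ _ (Finset.mem_univ μ),
    ← Finset.mul_prod_erase _ (fun ν => Complex.exp (Complex.I * (q ν * (x ν : ℕ) : ℝ)))
      (Finset.mem_univ μ), ← mul_assoc, ← mul_assoc]
  congr 1
  · rw [next, Function.update_self, wrapSign, ← Complex.exp_add]
    rcases val_add_one_cases (x μ) with ⟨h1, h2⟩ | ⟨h1, h2⟩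
    · rw [if_pos h1, h2, ← hq μ, ← Complex.exp_add]
      congr 1
      have h3 : (N : ℂ) = (x μ : ℕ) + 1 := by exact_mod_cast h1.symm
      push_cast
      rw [h3]
      ring
    · rw [if_neg h1, h2, one_mul]
      congr 1
      push_cast
      ring
  · refine Finset.prod_congr rfl fun ν hν => ?_
    rw [next, Function.update_of_ne (Finset.ne_of_mem_erase hν)]

theorem position_next (L : ℝ) (x : Site d N) (μ : Fin d) :
    position L N (next x μ) = position L N x + Pi.single μ (spacing L N) ∨
      position L N (next x μ) + Pi.single μ L =
        position L N x + Pi.single μ (spacing L N) := by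
  have hN : (N : ℝ) ≠ 0 := Nat.cast_ne_zero.mpr (NeZero.ne N)
  rcases val_add_one_cases (x μ) with ⟨h1, h2⟩ | ⟨h1, h2⟩
  · right
    ext ν
    rcases eq_or_ne ν μ with rfl | hν
    · simp only [position, next, Pi.add_apply, Function.update_self, Pi.single_eq_same, h2]
      have h3 : ((x ν : ℕ) : ℝ) + 1 = N := by exact_mod_cast h1
      have h4 : spacing L N * N = L := by rw [spacing]; field_simp
      rw [← h3] at h4
      rw [Nat.cast_zero]
      linarith
    · simp [position, next, hν]
  · left
    ext ν
    rcases eq_or_ne ν μ with rfl | hν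
    · simp only [position, next, Pi.add_apply, Function.update_self, Pi.single_eq_same, h2]
      push_cast
      ring
    · simp [position, next, hν]

end Waves

/-! ### Lattice operators represented on symbols -/

section Intertwining

variable {m : ℕ} (L : ℝ) {N : ℕ}

/-- Fields that are periodic in `x`. -/
def PeriodicField (f : Field m) : Prop := ∀ a q x μ, f a q (x + Pi.single μ L) = f a q x

variable {L}

theorem Sym_periodic {M r : ℝ} {γ : Fin (2 * m) → Matrix (Fin (2 ^ m)) (Fin (2 ^ m)) ℂ}
    {t n j : ℕ} {f : Field m} (hf : f ∈ Sym L M r γ t n j) : PeriodicField L f := by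
  induction hf using Submodule.span_induction with
  | mem f hf =>
    obtain ⟨c, g, Γ, -, hg, -, rfl⟩ := hf
    intro a q x μ
    rw [elem_apply, elem_apply, hg.periodic]
  | zero => exact fun _ _ _ _ => rfl
  | add f g _ _ hf hg =>
    intro a q x μ
    exact congrArg₂ (· + ·) (hf a q x μ) (hg a q x μ)
  | smul z f _ hf =>
    intro a q x μ
    exact congrArg (z • ·) (hf a q x μ)

variable (L N) in
/-- The matrix of lattice spinor fields given by a symbol times a plane wave. -/
def waveMap (q : Fin (2 * m) → ℝ) : Field m →ₗ[ℂ] Matrix (Comp m N) (Fin (2 ^ m)) ℂ where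
  toFun f := Matrix.of fun i s => wave q i.1 * f (spacing L N) q (position L N i.1) i.2 s
  map_add' f g := by ext i s; simp [mul_add]
  map_smul' z f := by ext i s; simp; ring

theorem waveMap_apply (q : Fin (2 * m) → ℝ) (f : Field m) (i : Comp m N) (s : Fin (2 ^ m)) :
    waveMap L N q f i s = wave q i.1 * f (spacing L N) q (position L N i.1) i.2 s := rfl

variable (L) in
/-- An operator on symbols that represents an operator on lattice spinor fields. -/
def Represents (q : Fin (2 * m) → ℝ) (B : Matrix (Comp m N) (Comp m N) ℂ)
    (Ψ : Module.End ℂ (Field m)) : Prop :=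
  ∀ f, PeriodicField L f → PeriodicField L (Ψ f) ∧ B * waveMap L N q f = waveMap L N q (Ψ f)

variable {q : Fin (2 * m) → ℝ} {B B' : Matrix (Comp m N) (Comp m N) ℂ}
  {Ψ Ψ' : Module.End ℂ (Field m)}

theorem Represents.add (h : Represents L q B Ψ) (h' : Represents L q B' Ψ') :
    Represents L q (B + B') (Ψ + Ψ') := fun f hf =>
  ⟨fun a q x μ => congrArg₂ (· + ·) ((h f hf).1 a q x μ) ((h' f hf).1 a q x μ), by
    rw [Matrix.add_mul, (h f hf).2, (h' f hf).2, ← map_add, LinearMap.add_apply]⟩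

theorem Represents.smul (z : ℂ) (h : Represents L q B Ψ) :
    Represents L q (z • B) (z • Ψ) := fun f hf =>
  ⟨fun a q x μ => congrArg (z • ·) ((h f hf).1 a q x μ), by
    rw [Matrix.smul_mul, (h f hf).2, ← map_smul, LinearMap.smul_apply]⟩

theorem Represents.sub (h : Represents L q B Ψ) (h' : Represents L q B' Ψ') :
    Represents L q (B - B') (Ψ - Ψ') := by
  have := h.add (h'.smul (-1))
  have e : Ψ + (-1 : ℂ) • Ψ' = Ψ - Ψ' := by module
  rwa [neg_one_smul, ← sub_eq_add_neg, e] at this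

theorem Represents.mul (h : Represents L q B Ψ) (h' : Represents L q B' Ψ') :
    Represents L q (B * B') (Ψ * Ψ') := fun f hf =>
  ⟨(h _ (h' f hf).1).1, by rw [Matrix.mul_assoc, (h' f hf).2, (h _ (h' f hf).1).2]; rfl⟩

theorem Represents.one : Represents (N := N) L q 1 1 := fun f hf =>
  ⟨hf, by rw [Matrix.one_mul]; rfl⟩

theorem Represents.zero : Represents (N := N) L q 0 0 := fun f hf =>
  ⟨fun _ _ _ _ => rfl, by rw [Matrix.zero_mul, LinearMap.zero_apply, map_zero]⟩

theorem Represents.sum {ι : Type*} (s : Finset ι) {B : ι → Matrix (Comp m N) (Comp m N) ℂ}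
    {Ψ : ι → Module.End ℂ (Field m)} (h : ∀ i, Represents L q (B i) (Ψ i)) :
    Represents L q (∑ i ∈ s, B i) (∑ i ∈ s, Ψ i) := by
  classical
  induction s using Finset.induction_on with
  | empty => simpa using Represents.zero
  | insert i s hi ih =>
    rw [Finset.sum_insert hi, Finset.sum_insert hi]
    exact (h i).add ih

theorem represents_mulMat (X : Matrix (Fin (2 ^ m)) (Fin (2 ^ m)) ℂ) :
    Represents L q ((1 : Matrix (Site (2 * m) N) (Site (2 * m) N) ℂ) ⊗ₖ X) (mulMat X) :=
  fun f hf => ⟨fun a q x μ => congrArg (X * ·) (hf a q x μ), by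
    ext ⟨x, s⟩ t
    rw [Matrix.mul_apply, Fintype.sum_prod_type, Finset.sum_eq_single x]
    · simp only [Matrix.kroneckerMap_apply, Matrix.one_apply_eq, one_mul, waveMap_apply,
        mulMat_apply, Matrix.mul_apply, Finset.mul_sum]
      refine Finset.sum_congr rfl fun y _ => ?_
      ring
    · intro y _ hy
      simp [Matrix.kroneckerMap_apply, Matrix.one_apply_ne hy.symm]
    · simp⟩

theorem represents_diagonal {c : ℝ → (Fin (2 * m) → ℝ) → (Fin (2 * m) → ℝ) → ℂ}
    (hc : ∀ a q x μ, c a q (x + Pi.single μ L) = c a q x) :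
    Represents L q ((Matrix.diagonal fun x : Site (2 * m) N => c (spacing L N) q (position L N x)) ⊗ₖ
      (1 : Matrix (Fin (2 ^ m)) (Fin (2 ^ m)) ℂ)) (mulFun c) :=
  fun f hf => ⟨fun a q x μ => by rw [mulFun_apply, mulFun_apply, hc, hf], by
    rw [← diagonal_fst_eq]
    ext ⟨x, s⟩ t
    rw [Matrix.diagonal_mul, waveMap_apply, waveMap_apply, mulFun_apply, Matrix.smul_apply,
      smul_eq_mul]
    ring⟩

theorem represents_mulCoef (c : ℝ → (Fin (2 * m) → ℝ) → ℂ) :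
    Represents L q (c (spacing L N) q • (1 : Matrix (Comp m N) (Comp m N) ℂ)) (mulCoef c) := by
  have h := represents_diagonal (L := L) (N := N) (q := q) (c := fun a q _ => c a q)
    (fun _ _ _ _ => rfl)
  rwa [← Matrix.smul_one_eq_diagonal, Matrix.smul_kronecker, Matrix.one_kronecker_one] at h

variable [NeZero N] {Q : ℝ} {A : Fin (2 * m) → (Fin (2 * m) → ℝ) → ℝ}

omit [NeZero N] in
theorem transport_periodic (hA : ∀ μ, SmoothOnTorus L (A μ)) (μ ν : Fin (2 * m)) (b : ℝ)
    (x : Fin (2 * m) → ℝ) : transport Q A μ b (x + Pi.single ν L) = transport Q A μ b x := by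
  have := (smoothFamily_transport Q hA μ 1).periodic ν b x
  simpa using this

omit [NeZero N] in
theorem symTrans_periodic (hA : ∀ μ, SmoothOnTorus L (A μ)) (μ : Fin (2 * m)) (σ : ℝ)
    {f : Field m} (hf : PeriodicField L f) : PeriodicField L (symTrans Q A μ σ f) :=
  fun a q x ν => by
    rw [symTrans_apply, symTrans_apply, transport_periodic hA, add_right_comm, hf]

theorem represents_translation (hA : ∀ μ, SmoothOnTorus L (A μ)) (hq : AntiPeriodic N q)
    (μ : Fin (2 * m)) : Represents L q (translation L Q A N μ ⊗ₖ
      (1 : Matrix (Fin (2 ^ m)) (Fin (2 ^ m)) ℂ)) (symTrans Q A μ 1) :=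
  fun f hf => ⟨symTrans_periodic hA μ 1 hf, by
    ext ⟨x, s⟩ t
    rw [Matrix.mul_apply, Fintype.sum_prod_type, Finset.sum_eq_single (next x μ),
      Finset.sum_eq_single s]
    · rw [Matrix.kroneckerMap_apply, Matrix.one_apply_eq, mul_one, translation, Matrix.of_apply,
        if_pos rfl, waveMap_apply, waveMap_apply, symTrans_apply, Matrix.smul_apply, smul_eq_mul]
      -- Past the seam the representative of the neighbour is off by L, which periodicity of the
      -- symbol absorbs. This is why `Represents` is restricted to periodic fields and must preserve
      -- them.
      have h1 : f (spacing L N) q (position L N (next x μ)) =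
          f (spacing L N) q (position L N x + Pi.single μ (spacing L N)) := by
        rcases position_next L x μ with h | h
        · rw [h]
        · rw [← h, hf]
      have h2 := wrapSign_mul_wave_next hq x μ
      have h3 : transport Q A μ (spacing L N) (position L N x) = link L Q A N μ x := rfl
      simp only [one_mul, h1, h3]
      linear_combination link L Q A N μ x *
        f (spacing L N) q (position L N x + Pi.single μ (spacing L N)) s t * h2
    · intro y _ hy
      rw [Matrix.kroneckerMap_apply, Matrix.one_apply_ne hy.symm, mul_zero, zero_mul]
    · simp
    · intro y _ hy
      refine Finset.sum_eq_zero fun t' _ => ?_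
      rw [Matrix.kroneckerMap_apply, translation, Matrix.of_apply, if_neg hy, zero_mul, zero_mul]
    · simp⟩

omit [NeZero N] in
theorem transport_mul_transport_neg (μ : Fin (2 * m)) (b : ℝ) (x : Fin (2 * m) → ℝ) :
    transport Q A μ b x * transport Q A μ (-b) (x + Pi.single μ b) = 1 := by
  rw [transport, transport, ← Complex.exp_add, ← mul_add, ← Complex.ofReal_add]
  have h1 : ∀ s, A μ (x + Pi.single μ b + Pi.single μ s) = A μ (x + Pi.single μ (b + s)) := by
    intro s
    rw [add_assoc, ← Pi.single_add]
  have h2 := intervalIntegral.integral_comp_add_left (a := 0) (b := -b)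
    (fun s => A μ (x + Pi.single μ s)) b
  simp only [h1]
  rw [h2, add_zero, add_neg_cancel, intervalIntegral.integral_symm 0 b, add_neg_cancel,
    Complex.ofReal_zero, mul_zero, Complex.exp_zero]

omit [NeZero N] in
theorem symTrans_mul_symTrans_neg (μ : Fin (2 * m)) (f : Field m) :
    symTrans Q A μ 1 (symTrans Q A μ (-1) f) = f := by
  funext a q x
  rw [symTrans_apply, symTrans_apply, smul_smul, add_assoc, ← Pi.single_add, neg_one_mul a,
    one_mul a, add_neg_cancel, Pi.single_zero, add_zero, one_mul, neg_one_mul (q μ),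
    mul_mul_mul_comm, transport_mul_transport_neg, ← Complex.exp_add, Complex.ofReal_neg, mul_neg,
    add_neg_cancel, Complex.exp_zero, one_mul, one_smul]

/-- The adjoint of a unitary translation is its inverse, and on symbols the backward translation
inverts the forward one, so the forward case implies the backward one. -/
theorem represents_translation_conjTranspose (hA : ∀ μ, SmoothOnTorus L (A μ))
    (hq : AntiPeriodic N q) (μ : Fin (2 * m)) : Represents L q ((translation L Q A N μ)ᴴ ⊗ₖ
      (1 : Matrix (Fin (2 ^ m)) (Fin (2 ^ m)) ℂ)) (symTrans Q A μ (-1)) :=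
  fun f hf => ⟨symTrans_periodic hA μ (-1) hf, by
    have h1 := (represents_translation (Q := Q) hA hq μ _ (symTrans_periodic (Q := Q) hA μ (-1) hf)).2
    rw [symTrans_mul_symTrans_neg] at h1
    rw [← h1, ← Matrix.mul_assoc, ← Matrix.mul_kronecker_mul, translation_unitary, mul_one,
      Matrix.one_kronecker_one, Matrix.one_mul]⟩

theorem represents_wilsonOp (hA : ∀ μ, SmoothOnTorus L (A μ)) (hq : AntiPeriodic N q) :
    Represents L q (wilsonOp L Q A N ⊗ₖ (1 : Matrix (Fin (2 ^ m)) (Fin (2 ^ m)) ℂ))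
      (wSym Q A) := by
  have e : wilsonOp L Q A N ⊗ₖ (1 : Matrix (Fin (2 ^ m)) (Fin (2 ^ m)) ℂ) =
      ∑ μ, (translation L Q A N μ ⊗ₖ (1 : Matrix (Fin (2 ^ m)) (Fin (2 ^ m)) ℂ) +
        (translation L Q A N μ)ᴴ ⊗ₖ (1 : Matrix (Fin (2 ^ m)) (Fin (2 ^ m)) ℂ) -
          (2 : ℂ) • (1 : Matrix (Comp m N) (Comp m N) ℂ)) := by
    rw [wilsonOp, ← Finset.sum_neg_distrib, kronecker_sum_left]
    refine Finset.sum_congr rfl fun μ _ => ?_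
    rw [neg_sub, sub_sub_eq_add_sub, sub_kronecker, Matrix.add_kronecker, Matrix.smul_kronecker,
      Matrix.one_kronecker_one, add_comm]
  rw [e]
  exact Represents.sum _ fun μ => ((represents_translation hA hq μ).add
    (represents_translation_conjTranspose hA hq μ)).sub (Represents.one.smul 2)

theorem represents_sSym (hA : ∀ μ, SmoothOnTorus L (A μ)) (hq : AntiPeriodic N q)
    (μ : Fin (2 * m)) : Represents L q
      ((1 / 2 : ℂ) • (translation L Q A N μ ⊗ₖ (1 : Matrix (Fin (2 ^ m)) (Fin (2 ^ m)) ℂ) -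
        (translation L Q A N μ)ᴴ ⊗ₖ (1 : Matrix (Fin (2 ^ m)) (Fin (2 ^ m)) ℂ))) (sSym Q A μ) :=
  ((represents_translation hA hq μ).sub (represents_translation_conjTranspose hA hq μ)).smul _

theorem represents_actionOp (hL : 0 < L) (M r : ℝ)
    (γ : Fin (2 * m) → Matrix (Fin (2 ^ m)) (Fin (2 ^ m)) ℂ)
    (hA : ∀ μ, SmoothOnTorus L (A μ)) (hq : AntiPeriodic N q) :
    Represents L q ((spacing L N : ℂ) • actionOp L M r Q A γ N) (hSym M r Q A γ) := by
  have ha : (spacing L N : ℂ) ≠ 0 := Complex.ofReal_ne_zero.mpr (spacing_pos L hL).ne'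
  have e : (spacing L N : ℂ) • actionOp L M r Q A γ N =
      (((M * spacing L N : ℝ) : ℂ) • (1 : Matrix (Comp m N) (Comp m N) ℂ) -
        ((r / 2 : ℝ) : ℂ) • (wilsonOp L Q A N ⊗ₖ (1 : Matrix (Fin (2 ^ m)) (Fin (2 ^ m)) ℂ))) +
      Complex.I • ∑ μ, ((1 : Matrix (Site (2 * m) N) (Site (2 * m) N) ℂ) ⊗ₖ γ μ) *
        ((1 / 2 : ℂ) • (translation L Q A N μ ⊗ₖ (1 : Matrix (Fin (2 ^ m)) (Fin (2 ^ m)) ℂ) -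
          (translation L Q A N μ)ᴴ ⊗ₖ (1 : Matrix (Fin (2 ^ m)) (Fin (2 ^ m)) ℂ))) := by
    have h1 : ∀ μ, ((1 : Matrix (Site (2 * m) N) (Site (2 * m) N) ℂ) ⊗ₖ γ μ) *
        ((1 / 2 : ℂ) • (translation L Q A N μ ⊗ₖ (1 : Matrix (Fin (2 ^ m)) (Fin (2 ^ m)) ℂ) -
          (translation L Q A N μ)ᴴ ⊗ₖ (1 : Matrix (Fin (2 ^ m)) (Fin (2 ^ m)) ℂ))) =
        (spacing L N : ℂ) • (derivOp L Q A N μ ⊗ₖ γ μ) := by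
      intro μ
      rw [mul_smul_comm, mul_sub, ← Matrix.mul_kronecker_mul, ← Matrix.mul_kronecker_mul, one_mul,
        one_mul, mul_one, ← sub_kronecker, derivOp, Matrix.smul_kronecker, smul_smul]
      congr 1
      field_simp
    simp only [h1]
    rw [← Finset.smul_sum, actionOp, diracOp, smul_sub, smul_add, smul_smul, smul_smul, smul_smul,
      smul_smul]
    have h2 : (spacing L N : ℂ) * (r / (2 * spacing L N)) = ((r / 2 : ℝ) : ℂ) := by
      push_cast
      field_simp
    have h3 : (spacing L N : ℂ) * M = ((M * spacing L N : ℝ) : ℂ) := by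
      push_cast
      ring
    rw [h2, h3, mul_comm Complex.I]
    abel
  rw [e]
  exact ((represents_mulCoef (fun a _ => ((M * a : ℝ) : ℂ))).sub
    ((represents_wilsonOp hA hq).smul _)).add
      ((Represents.sum _ fun μ => (represents_mulMat (γ μ)).mul (represents_sSym hA hq μ)).smul _)

end Intertwining
end
end LatticeFermion

namespace LatticeFermion
noncomputable section
open scoped Kronecker Matrix ComplexConjugate

/-! ### Completeness of the modes and the trace as a sum over momenta -/

section Completeness

variable {d : ℕ} (L : ℝ) (N : ℕ)

/-- The lattice momenta of the anti-periodic plane waves. -/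
def mode (k : Site d N) (μ : Fin d) : ℝ :=
  spacing L N * ((2 * ((k μ : ℕ) : ℝ) + 1) / L * Real.pi)

variable {L} [NeZero N]

omit [NeZero N] in
theorem mode_eq (hL : 0 < L) (k : Site d N) (μ : Fin d) :
    mode L N k μ = (2 * ((k μ : ℕ) : ℝ) + 1) * Real.pi / N := by
  rw [mode, spacing]
  field_simp

theorem antiPeriodic_mode (hL : 0 < L) (k : Site d N) : AntiPeriodic N (mode L N k) := by
  intro μ
  have hN : (N : ℝ) ≠ 0 := Nat.cast_ne_zero.mpr (NeZero.ne N)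
  rw [mode_eq N hL, div_mul_cancel₀ _ hN]
  have : Complex.I * (((2 * ((k μ : ℕ) : ℝ) + 1) * Real.pi : ℝ) : ℂ) =
      (k μ : ℕ) * (2 * Real.pi * Complex.I) + Real.pi * Complex.I := by
    push_cast
    ring
  rw [this, Complex.exp_add, Complex.exp_nat_mul_two_pi_mul_I, Complex.exp_pi_mul_I, one_mul]

/-- The half-integer shift of the momenta is a common phase; what remains is a geometric sum over
the powers of an N-th root of unity, which is 1 only for x = y. -/
theorem sum_exp_mode (x y : Fin N) : ∑ j : Fin N,
    Complex.exp (Complex.I * ((2 * ((j : ℕ) : ℝ) + 1) * Real.pi / N * (x : ℕ) : ℝ)) *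
      star (Complex.exp (Complex.I * ((2 * ((j : ℕ) : ℝ) + 1) * Real.pi / N * (y : ℕ) : ℝ))) =
      if x = y then (N : ℂ) else 0 := by
  have hN : (N : ℂ) ≠ 0 := Nat.cast_ne_zero.mpr (NeZero.ne N)
  set ω := Complex.exp (2 * Real.pi * Complex.I * (((x : ℕ) : ℂ) - (y : ℕ)) / N) with hω
  have h1 : ∀ j : Fin N,
      Complex.exp (Complex.I * ((2 * ((j : ℕ) : ℝ) + 1) * Real.pi / N * (x : ℕ) : ℝ)) *
        star (Complex.exp (Complex.I * ((2 * ((j : ℕ) : ℝ) + 1) * Real.pi / N * (y : ℕ) : ℝ))) =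
      Complex.exp (Real.pi * Complex.I * (((x : ℕ) : ℂ) - (y : ℕ)) / N) * ω ^ (j : ℕ) := by
    intro j
    change _ * (starRingEnd ℂ) _ = _
    rw [← Complex.exp_conj, hω, ← Complex.exp_nat_mul, ← Complex.exp_add, ← Complex.exp_add,
      map_mul, Complex.conj_I, Complex.conj_ofReal]
    congr 1
    push_cast
    field_simp
    ring
  simp only [h1]
  rw [← Finset.mul_sum, Fin.sum_univ_eq_sum_range (fun j => ω ^ j)]
  split_ifs with h
  · subst h
    simp [hω]
  · have h2 : ω ≠ 1 := by
      intro h3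
      rw [hω, Complex.exp_eq_one_iff] at h3
      obtain ⟨n, hn⟩ := h3
      have h4 : (((x : ℕ) : ℂ) - (y : ℕ)) = n * N := by
        have h5 : (2 * Real.pi * Complex.I : ℂ) ≠ 0 := Complex.two_pi_I_ne_zero
        field_simp at hn
        linear_combination hn
      have h5 : ((x : ℕ) : ℤ) - (y : ℕ) = n * N := by exact_mod_cast h4
      have hx := x.2
      have hy := y.2
      have h6 : n = 0 := by
        by_contra h7
        rcases lt_or_gt_of_ne h7 with h8 | h8
        · nlinarith
        · nlinarith
      rw [h6, zero_mul] at h5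
      exact h (Fin.ext (by omega))
    have h3 : ω ^ N = 1 := by
      rw [hω, ← Complex.exp_nat_mul, Complex.exp_eq_one_iff]
      refine ⟨((x : ℕ) : ℤ) - (y : ℕ), ?_⟩
      push_cast
      field_simp
    rw [geom_sum_eq h2, h3, sub_self, zero_div, mul_zero]

theorem sum_wave_mode (hL : 0 < L) (x y : Site d N) :
    ∑ k : Site d N, wave (mode L N k) x * star (wave (mode L N k) y) =
      if x = y then (N : ℂ) ^ d else 0 := by
  have h1 : ∀ k : Site d N, wave (mode L N k) x * star (wave (mode L N k) y) =
      ∏ μ, (Complex.exp (Complex.I * ((2 * ((k μ : ℕ) : ℝ) + 1) * Real.pi / N * (x μ : ℕ) : ℝ)) *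
        star (Complex.exp
          (Complex.I * ((2 * ((k μ : ℕ) : ℝ) + 1) * Real.pi / N * (y μ : ℕ) : ℝ)))) := by
    intro k
    rw [wave, wave, star_prod, ← Finset.prod_mul_distrib]
    simp only [mode_eq N hL]
  simp only [h1]
  have h2 := Finset.prod_univ_sum (fun _ : Fin d => (Finset.univ : Finset (Fin N))) (fun μ j =>
    Complex.exp (Complex.I * ((2 * ((j : ℕ) : ℝ) + 1) * Real.pi / N * (x μ : ℕ) : ℝ)) *
        star (Complex.exp (Complex.I * ((2 * ((j : ℕ) : ℝ) + 1) * Real.pi / N * (y μ : ℕ) : ℝ))))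
  rw [Fintype.piFinset_univ] at h2
  rw [← h2]
  simp only [sum_exp_mode]
  split_ifs with h
  · subst h
    simp
  · obtain ⟨μ, hμ⟩ := Function.ne_iff.mp h
    exact Finset.prod_eq_zero (Finset.mem_univ μ) (if_neg hμ)

variable {N} {m : ℕ}

omit [NeZero N] in
theorem waveMap_one_apply (q : Fin (2 * m) → ℝ) (i : Comp m N) (s : Fin (2 ^ m)) :
    waveMap L N q (scalarField fun _ => 1) i s =
      wave q i.1 * (1 : Matrix (Fin (2 ^ m)) (Fin (2 ^ m)) ℂ) i.2 s := by
  rw [waveMap_apply, scalarField, Complex.ofReal_one, one_smul]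

theorem sum_waveMap_mul_conjTranspose (hL : 0 < L) : ∑ k : Site (2 * m) N,
    waveMap L N (mode L N k) (scalarField fun _ => 1) *
      (waveMap L N (mode L N k) (scalarField fun _ => 1))ᴴ =
    ((N : ℂ) ^ (2 * m)) • (1 : Matrix (Comp m N) (Comp m N) ℂ) := by
  ext ⟨x, s⟩ ⟨y, t⟩
  rw [Matrix.sum_apply, Matrix.smul_apply, Matrix.one_apply, smul_eq_mul]
  have h1 : ∀ k : Site (2 * m) N, (waveMap L N (mode L N k) (scalarField fun _ => 1) *
      (waveMap L N (mode L N k) (scalarField fun _ => 1))ᴴ) (x, s) (y, t) =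
      (wave (mode L N k) x * star (wave (mode L N k) y)) * if s = t then 1 else 0 := by
    intro k
    rw [Matrix.mul_apply, Finset.sum_eq_single s]
    · rw [Matrix.conjTranspose_apply, waveMap_one_apply, waveMap_one_apply, Matrix.one_apply_eq,
        Matrix.one_apply, mul_one]
      simp only [eq_comm (a := t)]
      split_ifs <;> simp
    · intro s' _ hs
      rw [waveMap_one_apply, Matrix.one_apply_ne (Ne.symm hs), mul_zero, zero_mul]
    · simp
  simp only [h1]
  rw [← Finset.sum_mul, sum_wave_mode N hL]
  by_cases hx : x = y <;> by_cases hs : s = t <;> simp [hx, hs]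

/-- The unnormalized waves, tensored with the identity on spinors, resolve N^d times the identity;
insert this into the trace and use cyclicity. -/
theorem trace_eq_sum_mode (hL : 0 < L) (O : Matrix (Comp m N) (Comp m N) ℂ) :
    (N : ℂ) ^ (2 * m) * O.trace = ∑ k : Site (2 * m) N,
      ((waveMap L N (mode L N k) (scalarField fun _ => 1))ᴴ *
        (O * waveMap L N (mode L N k) (scalarField fun _ => 1))).trace := by
  have h1 : ∀ k : Site (2 * m) N, ((waveMap L N (mode L N k) (scalarField fun _ => 1))ᴴ *
        (O * waveMap L N (mode L N k) (scalarField fun _ => 1))).trace =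
      (O * (waveMap L N (mode L N k) (scalarField fun _ => 1) *
        (waveMap L N (mode L N k) (scalarField fun _ => 1))ᴴ)).trace := by
    intro k
    rw [Matrix.trace_mul_comm, Matrix.mul_assoc]
  simp only [h1]
  rw [← Matrix.trace_sum, ← Matrix.mul_sum, sum_waveMap_mul_conjTranspose hL, mul_smul_comm,
    mul_one, Matrix.trace_smul, smul_eq_mul]

omit [NeZero N] in
theorem waveMap_one_conjTranspose_mul (q : Fin (2 * m) → ℝ) (f : Field m) :
    (waveMap L N q (scalarField fun _ => 1))ᴴ * waveMap L N q f =
      ∑ x : Site (2 * m) N, f (spacing L N) q (position L N x) := by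
  ext s t
  rw [Matrix.mul_apply, Matrix.sum_apply, Fintype.sum_prod_type]
  refine Finset.sum_congr rfl fun x _ => ?_
  rw [Finset.sum_eq_single s]
  · rw [Matrix.conjTranspose_apply, waveMap_one_apply, Matrix.one_apply_eq, mul_one, waveMap_apply,
      ← mul_assoc, star_wave_mul_self, one_mul]
  · intro s' _ hs
    rw [Matrix.conjTranspose_apply, waveMap_one_apply, Matrix.one_apply_ne hs, mul_zero, star_zero,
      zero_mul]
  · simp

variable {Q : ℝ} {A : Fin (2 * m) → (Fin (2 * m) → ℝ) → ℝ}

/-- A constant spin matrix commutes with everything scalar, so it can be carried to the right of the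
wave. The inverse then acts on a symbol without chirality, and γ_{d+1} enters only in the final
trace. -/
theorem source_mul_waveMap_one (hA : ∀ μ, SmoothOnTorus L (A μ))
    {ξ : (Fin (2 * m) → ℝ) → ℝ} (hξ : SmoothOnTorus L ξ) {q : Fin (2 * m) → ℝ}
    (hq : AntiPeriodic N q) (X : Matrix (Fin (2 ^ m)) (Fin (2 ^ m)) ℂ) :
    ((wilsonOp L Q A N * Matrix.diagonal (fun x => ((ξ (position L N x) : ℝ) : ℂ)) +
        Matrix.diagonal (fun x => ((ξ (position L N x) : ℝ) : ℂ)) * wilsonOp L Q A N) ⊗ₖ X) *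
      waveMap L N q (scalarField fun _ => 1) = waveMap L N q (sourceSym Q A ξ) * X := by
  have hΞ := represents_diagonal (L := L) (N := N) (q := q) (c := fun _ _ x => ((ξ x : ℝ) : ℂ))
    (fun _ _ x μ => by rw [hξ.2])
  have hW := represents_wilsonOp (L := L) (Q := Q) hA hq
  have h1 := ((hW.mul hΞ).add (hΞ.mul hW) (scalarField fun _ => 1) (fun _ _ _ _ => rfl)).2
  rw [← Matrix.mul_kronecker_mul, ← Matrix.mul_kronecker_mul, mul_one, ← Matrix.add_kronecker]
    at h1
  have h2 : (wSym Q A * mulFun (fun _ _ x => ((ξ x : ℝ) : ℂ)) +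
      mulFun (fun _ _ x => ((ξ x : ℝ) : ℂ)) * wSym Q A) (scalarField fun _ => 1) =
      sourceSym Q A ξ := by
    have h3 : mulFun (fun _ _ x => ((ξ x : ℝ) : ℂ)) (scalarField fun _ => 1) =
        (scalarField ξ : Field m) := by
      funext a q x
      rw [mulFun_apply, scalarField, scalarField, Complex.ofReal_one, one_smul]
    rw [LinearMap.add_apply, Module.End.mul_apply, Module.End.mul_apply, h3, sourceSym]
  rw [h2] at h1
  rw [← h1, Matrix.mul_assoc]
  have h4 : waveMap L N q (scalarField fun _ => 1) * X =
      ((1 : Matrix (Site (2 * m) N) (Site (2 * m) N) ℂ) ⊗ₖ X) *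
        waveMap L N q (scalarField fun _ => 1) := by
    rw [(represents_mulMat (L := L) X _ (fun _ _ _ _ => rfl)).2]
    ext i s
    rw [waveMap_apply, mulMat_apply, scalarField, Complex.ofReal_one, one_smul, mul_one,
      Matrix.mul_apply, Finset.sum_eq_single i.2]
    · rw [waveMap_one_apply, Matrix.one_apply_eq, mul_one]
    · intro t _ ht
      rw [waveMap_one_apply, Matrix.one_apply_ne (Ne.symm ht), mul_zero, zero_mul]
    · simp
  rw [h4, ← Matrix.mul_assoc, ← Matrix.mul_kronecker_mul, mul_one, one_mul]

end Completeness

/-! ### Neumann expansion of the inverse -/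

section InverseExpansion

variable {m N : ℕ} [NeZero N] {L M r Q : ℝ} {A : Fin (2 * m) → (Fin (2 * m) → ℝ) → ℝ}
  {γ : Fin (2 * m) → Matrix (Fin (2 ^ m)) (Fin (2 ^ m)) ℂ}
  (hL : 0 < L) (hM : 0 < M) (hr : 0 < r) (hγ : ∀ μ, (γ μ).conjTranspose = -γ μ)
  (hγγ : CliffordRel γ) (hA : ∀ μ, SmoothOnTorus L (A μ))
  {ξ : (Fin (2 * m) → ℝ) → ℝ} (hξ : SmoothOnTorus L ξ) {q : Fin (2 * m) → ℝ}
  (hq : AntiPeriodic N q)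

include hL hM hr hγ hγγ hA hξ hq

/-- Applied to the wave of the adjoint symbol, aH returns ρ² times the original symbol plus its
image under the remainder. Multiply by H⁻¹ and solve for the original. -/
theorem actionOp_inv_mul_waveMap_step (k : ℕ) :
    (actionOp L M r Q A γ N)⁻¹ * waveMap L N q ((remSym M r Q A γ ^ k) (sourceSym Q A ξ)) =
      (freeSq M r (spacing L N) q : ℂ)⁻¹ • ((spacing L N : ℂ) •
        waveMap L N q (hSymAdj M r Q A γ ((remSym M r Q A γ ^ k) (sourceSym Q A ξ))) -
        (actionOp L M r Q A γ N)⁻¹ *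
          waveMap L N q ((remSym M r Q A γ ^ (k + 1)) (sourceSym Q A ξ))) := by
  set U := (remSym M r Q A γ ^ k) (sourceSym Q A ξ) with hU
  have hUm := remSym_pow_mem (Q := Q) hM hr hA hξ hγγ k
  have hΔ : (freeSq M r (spacing L N) q : ℂ) ≠ 0 := by
    rw [← rho_sq]
    exact Complex.ofReal_ne_zero.mpr
      (pow_ne_zero 2 (rho_pos hM hr (spacing_pos L hL) q).ne')
  have h1 := (represents_actionOp hL M r γ (Q := Q) hA hq (hSymAdj M r Q A γ U)
    (Sym_periodic (hSymAdj_mem (Q := Q) hM hr hA _ _ _ _ hUm))).2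
  have h2 : hSym M r Q A γ (hSymAdj M r Q A γ U) =
      (remSym M r Q A γ ^ (k + 1)) (sourceSym Q A ξ) +
        mulCoef (fun a q => (freeSq M r a q : ℂ)) U := by
    rw [pow_succ', Module.End.mul_apply, ← hU, remSym, LinearMap.sub_apply, Module.End.mul_apply,
      sub_add_cancel]
  have h3 : waveMap L N q (mulCoef (fun a q => (freeSq M r a q : ℂ)) U) =
      (freeSq M r (spacing L N) q : ℂ) • waveMap L N q U := by
    ext i s
    rw [waveMap_apply, mulCoef, mulFun_apply, Matrix.smul_apply, Matrix.smul_apply, waveMap_apply,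
      smul_eq_mul, smul_eq_mul]
    ring
  rw [h2, map_add, h3] at h1
  have h4 := congrArg ((actionOp L M r Q A γ N)⁻¹ * ·) h1
  simp only [Matrix.smul_mul, Matrix.mul_smul, Matrix.mul_add] at h4
  rw [← Matrix.mul_assoc, Matrix.nonsing_inv_mul _ (actionOp_isUnit_det L M r Q A γ hL hM hr hγ),
    Matrix.one_mul] at h4
  rw [h4, add_sub_cancel_left, smul_smul, inv_mul_cancel₀ hΔ, one_smul]

/-- The expansion of the inverse of the action operator on a symbol. -/
theorem actionOp_inv_mul_waveMap (n : ℕ) :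
    (actionOp L M r Q A γ N)⁻¹ * waveMap L N q (sourceSym Q A ξ) =
      ∑ k ∈ Finset.range n, ((-1) ^ k * ((freeSq M r (spacing L N) q : ℂ)⁻¹) ^ (k + 1) *
        (spacing L N : ℂ)) •
          waveMap L N q (hSymAdj M r Q A γ ((remSym M r Q A γ ^ k) (sourceSym Q A ξ))) +
      ((-1) ^ n * ((freeSq M r (spacing L N) q : ℂ)⁻¹) ^ n) • ((actionOp L M r Q A γ N)⁻¹ *
        waveMap L N q ((remSym M r Q A γ ^ n) (sourceSym Q A ξ))) := by
  induction n with
  | zero => simp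
  | succ n ih =>
    rw [ih, Finset.sum_range_succ,
      actionOp_inv_mul_waveMap_step hL hM hr hγ hγγ hA hξ hq n, add_assoc]
    congr 1
    rw [smul_smul, smul_sub, smul_smul, sub_eq_add_neg, ← neg_smul]
    congr 2
    · ring
    · ring

end InverseExpansion
end
end LatticeFermion

namespace LatticeFermion
noncomputable section
open scoped Kronecker Matrix ComplexConjugate

/-! ### The contribution of a single mode -/

section Estimate

variable {m N : ℕ}

theorem norm_toLp_le {ι : Type*} [Fintype ι] {w : ι → ℂ} {c : ℝ} (hc : 0 ≤ c)
    (h : ∀ i, ‖w i‖ ≤ c) : ‖WithLp.toLp 2 w‖ ≤ Real.sqrt (Fintype.card ι) * c := by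
  rw [EuclideanSpace.norm_eq]
  calc Real.sqrt (∑ i, ‖w i‖ ^ 2) ≤ Real.sqrt (∑ _ : ι, c ^ 2) :=
        Real.sqrt_le_sqrt (Finset.sum_le_sum fun i _ => pow_le_pow_left₀ (norm_nonneg _) (h i) 2)
    _ = Real.sqrt (Fintype.card ι) * c := by
      rw [Finset.sum_const, Finset.card_univ, nsmul_eq_mul, Real.sqrt_mul (Nat.cast_nonneg _),
        Real.sqrt_sq hc]

/-- A bound for traces of the inverse of the action operator between bounded fields. -/
theorem norm_trace_conjTranspose_inv_le [NeZero N] {L M r Q : ℝ}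
    {A : Fin (2 * m) → (Fin (2 * m) → ℝ) → ℝ}
    {γ : Fin (2 * m) → Matrix (Fin (2 ^ m)) (Fin (2 ^ m)) ℂ} (hL : 0 < L) (hM : 0 < M)
    (hr : 0 < r) (hγ : ∀ μ, (γ μ).conjTranspose = -γ μ)
    (E Y : Matrix (Comp m N) (Fin (2 ^ m)) ℂ) {c : ℝ} (hc : 0 ≤ c) (hE : ∀ i s, ‖E i s‖ ≤ 1)
    (hY : ∀ i s, ‖Y i s‖ ≤ c) :
    ‖(Eᴴ * ((actionOp L M r Q A γ N)⁻¹ * Y)).trace‖ ≤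
      2 ^ m * ((N : ℝ) ^ (2 * m) * 2 ^ m * c / M) := by
  have hcard : (Fintype.card (Comp m N) : ℝ) = (N : ℝ) ^ (2 * m) * 2 ^ m := by
    rw [Fintype.card_prod, Fintype.card_fun, Fintype.card_fin, Fintype.card_fin, Fintype.card_fin]
    push_cast
    ring
  have h1 : ∀ s, ‖(Eᴴ * ((actionOp L M r Q A γ N)⁻¹ * Y)) s s‖ ≤
      (N : ℝ) ^ (2 * m) * 2 ^ m * c / M := by
    intro s
    have e : (Eᴴ * ((actionOp L M r Q A γ N)⁻¹ * Y)) s s =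
        star (fun i => E i s) ⬝ᵥ ((actionOp L M r Q A γ N)⁻¹ *ᵥ fun i => Y i s) := rfl
    rw [e]
    refine (norm_actionOp_inv_le L M r Q A γ hL hM hr hγ _ _).trans ?_
    refine div_le_div_of_nonneg_right ?_ hM.le
    have h2 := norm_toLp_le zero_le_one fun i => hE i s
    have h3 := norm_toLp_le hc fun i => hY i s
    refine (mul_le_mul h2 h3 (norm_nonneg _)
      (mul_nonneg (Real.sqrt_nonneg _) zero_le_one)).trans (le_of_eq ?_)
    rw [mul_one, ← mul_assoc, Real.mul_self_sqrt (Nat.cast_nonneg _), hcard]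
  rw [Matrix.trace]
  refine (norm_sum_le _ _).trans ((Finset.sum_le_sum fun s _ => h1 s).trans (le_of_eq ?_))
  rw [Finset.sum_const, Finset.card_univ, Fintype.card_fin, nsmul_eq_mul]
  push_cast
  rfl

variable (L : ℝ) (N) (γ : Fin (2 * m) → Matrix (Fin (2 ^ m)) (Fin (2 ^ m)) ℂ) in
/-- The sum over the lattice of the chiral trace of a symbol. -/
def chiralSum (q : Fin (2 * m) → ℝ) : Field m →ₗ[ℂ] ℂ where
  toFun f := ∑ x : Site (2 * m) N, (f (spacing L N) q (position L N x) * chirality γ).trace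
  map_add' f g := by
    rw [← Finset.sum_add_distrib]
    refine Finset.sum_congr rfl fun x _ => ?_
    rw [Pi.add_apply, Pi.add_apply, Pi.add_apply, add_mul, Matrix.trace_add]
  map_smul' z f := by
    rw [RingHom.id_apply, smul_eq_mul, Finset.mul_sum]
    refine Finset.sum_congr rfl fun x _ => ?_
    rw [Pi.smul_apply, Pi.smul_apply, Pi.smul_apply, Matrix.smul_mul, Matrix.trace_smul,
      smul_eq_mul]

variable {L M r Q : ℝ} {A : Fin (2 * m) → (Fin (2 * m) → ℝ) → ℝ}
  {γ : Fin (2 * m) → Matrix (Fin (2 ^ m)) (Fin (2 ^ m)) ℂ}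

theorem chiralSum_apply (q : Fin (2 * m) → ℝ) (f : Field m) : chiralSum N L γ q f =
    ∑ x : Site (2 * m) N, (f (spacing L N) q (position L N x) * chirality γ).trace := rfl

theorem trace_waveMap_mul_chirality (q : Fin (2 * m) → ℝ) (f : Field m) :
    ((waveMap L N q (scalarField fun _ => 1))ᴴ * (waveMap L N q f * chirality γ)).trace =
      chiralSum N L γ q f := by
  rw [← Matrix.mul_assoc, waveMap_one_conjTranspose_mul, Matrix.sum_mul, Matrix.trace_sum,
    chiralSum_apply]

variable [NeZero N]

theorem spacing_le (hL : 0 < L) : spacing L N ≤ L :=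
  div_le_self hL.le (by exact_mod_cast NeZero.one_le)

theorem position_mem (hL : 0 < L) {d : ℕ} (x : Site d N) :
    position L N x ∈ Set.univ.pi fun _ : Fin d => Set.Icc 0 L := by
  intro μ _
  have hN : (N : ℝ) ≠ 0 := Nat.cast_ne_zero.mpr (NeZero.ne N)
  have h1 : spacing L N * N = L := by rw [spacing]; field_simp
  have h2 : ((x μ : ℕ) : ℝ) ≤ N := by exact_mod_cast (x μ).2.le
  have h3 := spacing_pos (N := N) L hL
  refine ⟨mul_nonneg h3.le (Nat.cast_nonneg _), ?_⟩
  calc position L N x μ ≤ spacing L N * N := mul_le_mul_of_nonneg_left h2 h3.le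
    _ = L := h1

theorem norm_chiralSum_le (hL : 0 < L) {k : ℕ} {C : ℝ} {f : Field m}
    (hC : ∀ a, 0 < a → a ≤ L → ∀ q, ∀ x ∈ Set.univ.pi fun _ => Set.Icc 0 L,
      ‖(f a q x * chirality γ).trace‖ * rho M r a q ^ (2 * m) ≤
        C * (a ^ (2 * m + 1) * rho M r a q ^ (2 * k + 2))) (q : Fin (2 * m) → ℝ) :
    ‖chiralSum N L γ q f‖ * rho M r (spacing L N) q ^ (2 * m) ≤
      (N : ℝ) ^ (2 * m) *
        (C * (spacing L N ^ (2 * m + 1) * rho M r (spacing L N) q ^ (2 * k + 2))) := by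
  rw [chiralSum_apply]
  calc _ ≤ (∑ x : Site (2 * m) N,
        ‖(f (spacing L N) q (position L N x) * chirality γ).trace‖) *
          rho M r (spacing L N) q ^ (2 * m) :=
        mul_le_mul_of_nonneg_right (norm_sum_le _ _) (pow_nonneg (rho_nonneg _ _ _ _) _)
    _ ≤ ∑ _ : Site (2 * m) N,
        C * (spacing L N ^ (2 * m + 1) * rho M r (spacing L N) q ^ (2 * k + 2)) := by
      rw [Finset.sum_mul]
      exact Finset.sum_le_sum fun x _ =>
        hC _ (spacing_pos L hL) (spacing_le hL) q _ (position_mem hL x)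
    _ = _ := by
      rw [Finset.sum_const, Finset.card_univ, Fintype.card_fun, Fintype.card_fin, Fintype.card_fin,
        nsmul_eq_mul]
      push_cast
      rfl

omit [NeZero N] in
/-- The contribution of one plane wave is its leading part up to a small error. -/
theorem exists_mode_bound (hL : 0 < L) (hM : 0 < M) (hr : 0 < r)
    (hγ : ∀ μ, (γ μ).conjTranspose = -γ μ) (hγγ : CliffordRel γ)
    (hA : ∀ μ, SmoothOnTorus L (A μ)) {ξ : (Fin (2 * m) → ℝ) → ℝ} (hξ : SmoothOnTorus L ξ) :
    ∃ C : ℝ, ∀ (N : ℕ) [NeZero N] (q : Fin (2 * m) → ℝ), AntiPeriodic N q →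
      ‖((waveMap L N q (scalarField fun _ => 1))ᴴ * ((actionOp L M r Q A γ N)⁻¹ *
          (waveMap L N q (sourceSym Q A ξ) * chirality γ))).trace -
        (-1) ^ m * ((freeSq M r (spacing L N) q : ℂ)⁻¹) ^ (m + 1) * (spacing L N : ℂ) *
          chiralSum N L γ q (freeAdj M r γ ((leadSym r Q A γ ^ m) (leadSource ξ)))‖ ≤
      C * ((N : ℝ) ^ (2 * m) * spacing L N *
        (spacing L N ^ (2 * m + 1) / rho M r (spacing L N) q ^ (2 * m))) := by
  choose C hC using fun k => hSymAdj_remSym_pow_mem (Q := Q) hM hr hA hξ hγγ k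
  -- The tail is O(a^n ρ^{n+2}) against the prefactor ρ^{-2n}, that is a^n ρ^{2-n}. The value n = 2m
  -- + 2 makes this a · a^{2m+1}/ρ^{2m}, the same size as the other errors.
  set n := 2 * m + 2 with hn
  obtain ⟨D, hD⟩ := Sym_entry_bounded (remSym_pow_mem (Q := Q) hM hr hA hξ hγγ n)
  set K := ∑ s, ∑ t, ‖chirality γ s t‖ with hK
  have hK0 : 0 ≤ K := Finset.sum_nonneg fun _ _ => Finset.sum_nonneg fun _ _ => norm_nonneg _
  refine ⟨∑ k ∈ Finset.range n, C k + 2 ^ m * 2 ^ m * (2 ^ m * |D| * K) / M,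
    fun N _ q hq => ?_⟩
  have ha := spacing_pos (N := N) L hL
  have hρ := rho_pos hM hr ha q
  set a := spacing L N with ha'
  set ρ := rho M r a q with hρ'
  have hΔ : (freeSq M r a q : ℂ) = ((ρ ^ 2 : ℝ) : ℂ) := by rw [hρ', rho_sq]
  set g : ℕ → Field m := fun k => hSymAdj M r Q A γ ((remSym M r Q A γ ^ k) (sourceSym Q A ξ)) -
    (if k = m then freeAdj M r γ ((leadSym r Q A γ ^ m) (leadSource ξ)) else 0) with hg
  set c : ℕ → ℂ := fun k => (-1) ^ k * ((freeSq M r a q : ℂ)⁻¹) ^ (k + 1) * (a : ℂ) with hc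
  set R := ((waveMap L N q (scalarField fun _ => 1))ᴴ * ((actionOp L M r Q A γ N)⁻¹ *
    (waveMap L N q ((remSym M r Q A γ ^ n) (sourceSym Q A ξ)) * chirality γ))).trace with hR
  have e : ((waveMap L N q (scalarField fun _ => 1))ᴴ * ((actionOp L M r Q A γ N)⁻¹ *
      (waveMap L N q (sourceSym Q A ξ) * chirality γ))).trace -
      c m * chiralSum N L γ q (freeAdj M r γ ((leadSym r Q A γ ^ m) (leadSource ξ))) =
      ∑ k ∈ Finset.range n, c k * chiralSum N L γ q (g k) +
        (-1) ^ n * ((freeSq M r a q : ℂ)⁻¹) ^ n * R := by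
    have h1 : ∑ k ∈ Finset.range n, c k * chiralSum N L γ q (g k) =
        ∑ k ∈ Finset.range n, c k * chiralSum N L γ q
          (hSymAdj M r Q A γ ((remSym M r Q A γ ^ k) (sourceSym Q A ξ))) -
        c m * chiralSum N L γ q (freeAdj M r γ ((leadSym r Q A γ ^ m) (leadSource ξ))) := by
      have h2 : ∀ k, c k * chiralSum N L γ q (g k) = c k * chiralSum N L γ q
          (hSymAdj M r Q A γ ((remSym M r Q A γ ^ k) (sourceSym Q A ξ))) -
          (if k = m then c k * chiralSum N L γ q
            (freeAdj M r γ ((leadSym r Q A γ ^ m) (leadSource ξ))) else 0) := by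
        intro k
        simp only [hg]
        rw [map_sub, mul_sub]
        split_ifs <;> simp
      simp only [h2, Finset.sum_sub_distrib]
      rw [Finset.sum_ite_eq' , if_pos (Finset.mem_range.mpr (by omega))]
    rw [h1, ← Matrix.mul_assoc _ _ (chirality γ),
      actionOp_inv_mul_waveMap hL hM hr hγ hγγ hA hξ hq n, Matrix.add_mul, Matrix.mul_add,
      Matrix.trace_add, Matrix.sum_mul, Matrix.mul_sum, Matrix.trace_sum, Matrix.smul_mul,
      Matrix.mul_smul, Matrix.trace_smul, Matrix.mul_assoc _ _ (chirality γ), ← hR, smul_eq_mul]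
    have h3 : ∀ k, ((waveMap L N q (scalarField fun _ => 1))ᴴ *
        ((c k • waveMap L N q (hSymAdj M r Q A γ ((remSym M r Q A γ ^ k) (sourceSym Q A ξ)))) *
          chirality γ)).trace = c k * chiralSum N L γ q
            (hSymAdj M r Q A γ ((remSym M r Q A γ ^ k) (sourceSym Q A ξ))) := by
      intro k
      rw [Matrix.smul_mul, Matrix.mul_smul, Matrix.trace_smul, trace_waveMap_mul_chirality,
        smul_eq_mul]
    simp only [hc] at h3 ⊢
    simp only [← ha', h3]
    ring
  -- The coefficient has size a/ρ^{2k+2}, and `TrBound` allows a^{2m+1}ρ^{2k+2}/ρ^{2m} for each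
  -- site: the dependence on k cancels.
  have hterm : ∀ k, ‖c k * chiralSum N L γ q (g k)‖ ≤
      C k * ((N : ℝ) ^ (2 * m) * a * (a ^ (2 * m + 1) / ρ ^ (2 * m))) := by
    intro k
    have h1 := norm_chiralSum_le (N := N) (γ := γ) hL (hC k) q
    simp only [← ha', ← hρ'] at h1
    rw [← le_div_iff₀ (pow_pos hρ _)] at h1
    have h2 : ‖c k‖ = a / ρ ^ (2 * k + 2) := by
      simp only [hc]
      rw [norm_mul, norm_mul, norm_pow, norm_neg, norm_one, one_pow, one_mul, norm_pow, norm_inv,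
        hΔ, Complex.norm_real, Complex.norm_real, Real.norm_of_nonneg (sq_nonneg ρ),
        Real.norm_of_nonneg ha.le, inv_pow, ← pow_mul, mul_add, mul_one]
      field_simp
    rw [norm_mul, h2]
    refine (mul_le_mul_of_nonneg_left h1 (by positivity)).trans (le_of_eq ?_)
    field_simp
  -- Here the exact inverse is still present; it is bounded by 1/M through coercivity, at the cost
  -- of one factor N^d from the norms of the two lattice fields.
  have hrem : ‖(-1) ^ n * ((freeSq M r a q : ℂ)⁻¹) ^ n * R‖ ≤
      2 ^ m * 2 ^ m * (2 ^ m * |D| * K) / M *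
        ((N : ℝ) ^ (2 * m) * a * (a ^ (2 * m + 1) / ρ ^ (2 * m))) := by
    have h1 : ∀ i s, ‖(waveMap L N q ((remSym M r Q A γ ^ n) (sourceSym Q A ξ)) *
        chirality γ) i s‖ ≤ 2 ^ m * |D| * K * (a ^ n * ρ ^ (n + 2)) := by
      intro i s
      rw [Matrix.mul_apply]
      refine (norm_sum_le _ _).trans ?_
      have h2 : ∀ t, ‖waveMap L N q ((remSym M r Q A γ ^ n) (sourceSym Q A ξ)) i t *
          chirality γ t s‖ ≤ |D| * (a ^ n * ρ ^ (n + 2)) * K := by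
        intro t
        rw [norm_mul, waveMap_apply, norm_mul, norm_wave, one_mul]
        have h3 := hD a ha (spacing_le hL) q _ (position_mem hL i.1) i.2 t
        have h4 : ‖chirality γ t s‖ ≤ K :=
          (Finset.single_le_sum (f := fun s => ‖chirality γ t s‖) (fun _ _ => norm_nonneg _)
            (Finset.mem_univ s)).trans
          (Finset.single_le_sum (f := fun t => ∑ s, ‖chirality γ t s‖)
            (fun _ _ => Finset.sum_nonneg fun _ _ => norm_nonneg _) (Finset.mem_univ t))
        have h5 : D * (a ^ n * ρ ^ (n + 2)) ≤ |D| * (a ^ n * ρ ^ (n + 2)) :=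
          mul_le_mul_of_nonneg_right (le_abs_self D) (by positivity)
        exact mul_le_mul (h3.trans h5) h4 (norm_nonneg _) (by positivity)
      refine (Finset.sum_le_sum fun t _ => h2 t).trans (le_of_eq ?_)
      rw [Finset.sum_const, Finset.card_univ, Fintype.card_fin, nsmul_eq_mul]
      push_cast
      ring
    have h6 : ∀ i s, ‖waveMap L N q (scalarField fun _ => 1) i s‖ ≤ 1 := by
      intro i s
      rw [waveMap_one_apply, norm_mul, norm_wave, one_mul, Matrix.one_apply]
      split_ifs <;> simp
    have h7 := norm_trace_conjTranspose_inv_le (L := L) (M := M) (r := r) (Q := Q) (A := A)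
      hL hM hr hγ _ _ (by positivity) h6 h1
    rw [norm_mul, norm_mul, norm_pow, norm_neg, norm_one, one_pow, one_mul, norm_pow, norm_inv,
      hΔ, Complex.norm_real, Real.norm_of_nonneg (sq_nonneg ρ), inv_pow, ← pow_mul]
    refine (mul_le_mul_of_nonneg_left h7 (by positivity)).trans (le_of_eq ?_)
    have h8 : ρ ^ (2 * n) = ρ ^ (n + 2) * ρ ^ (2 * m) := by rw [← pow_add]; congr 1; omega
    have h9 : a ^ n = a * a ^ (2 * m + 1) := by rw [← pow_succ']
    rw [h8, h9]
    field_simp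
  rw [e, add_mul, Finset.sum_mul]
  exact (norm_add_le _ _).trans (add_le_add ((norm_sum_le _ _).trans
    (Finset.sum_le_sum fun k _ => hterm k)) hrem)

end Estimate
end
end LatticeFermion

namespace LatticeFermion
noncomputable section
open scoped Kronecker Matrix ComplexConjugate

/-! ### The leading term and the coefficient -/

section Leading

variable {m N : ℕ} {L M r Q : ℝ} {A : Fin (2 * m) → (Fin (2 * m) → ℝ) → ℝ}
  {γ : Fin (2 * m) → Matrix (Fin (2 ^ m)) (Fin (2 ^ m)) ℂ}

/-- The momentum dependence of the leading chiral trace. -/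
def momentumFactor (M r a : ℝ) (q : Fin (2 * m) → ℝ) : ℝ :=
  freeMass M r a q * ∏ l, Real.cos (q l) -
    r * ∑ l, Real.sin (q l) ^ 2 * ∏ k ∈ Finset.univ.erase l, Real.cos (q k)

theorem momentumG_eq (hr : 0 < r) (a : ℝ) (p : Fin (2 * m) → ℝ) :
    momentumG m M r a p = -2 * r * a ^ (2 * m) * wilsonMass (fun μ => a * p μ) *
      momentumFactor M r a (fun μ => a * p μ) / freeSq M r a (fun μ => a * p μ) ^ (m + 1) := by
  rw [momentumG, momentumFactor, freeSq, freeMass, wilsonMass]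
  have h : r ≠ 0 := hr.ne'
  have e : r * ((M * a / r + ∑ ν, (1 - Real.cos (a * p ν))) * ∏ l, Real.cos (a * p l)
        - ∑ ν, Real.sin (a * p ν) ^ 2 * ∏ l ∈ Finset.univ.erase ν, Real.cos (a * p l)) =
      (M * a + r * ∑ ν, (1 - Real.cos (a * p ν))) * ∏ l, Real.cos (a * p l) -
        r * ∑ l, Real.sin (a * p l) ^ 2 * ∏ k ∈ Finset.univ.erase l, Real.cos (a * p k) := by
    field_simp
  rw [← e]
  ring

/-- At leading order everything is pointwise in x: the source is a scalar, the curvature factors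
give `leadMat` to the power m, and the free adjoint supplies the mass plus the linear element ∑
sin(q_μ) γ_μ that `trace_main` expects. -/
theorem trace_leadSym (hm : 0 < m) (hγγ : CliffordRel γ) (ξ : (Fin (2 * m) → ℝ) → ℝ) (a : ℝ)
    (q x : Fin (2 * m) → ℝ) :
    (freeAdj M r γ ((leadSym r Q A γ ^ m) (leadSource ξ)) a q x * chirality γ).trace =
      (a : ℂ) ^ (2 * m) * (-4 * (wilsonMass q : ℂ)) * ((-Complex.I * Q) ^ m * (-Complex.I) ^ m) *
        (momentumFactor M r a q : ℂ) * ((ξ x * epsilonF A x : ℝ) : ℂ) := by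
  have h := hγγ.trace_main hm (fun μ ν => (fieldStrength A μ ν x : ℂ))
    (fun μ ν => by rw [fieldStrength, fieldStrength]; push_cast; ring)
    (freeMass M r a q : ℂ) r (-Complex.I * Q) (fun μ => (Real.cos (q μ) : ℂ))
    (fun μ => (Real.sin (q μ) : ℂ))
  rw [freeAdj_apply, leadSym_pow_apply, leadSource, mul_smul_comm, mul_smul_comm, mul_one,
    mul_smul_comm, smul_mul_assoc, smul_mul_assoc, Matrix.trace_smul, Matrix.trace_smul, leadMat,
    h, smul_eq_mul, smul_eq_mul, momentumFactor, epsilonF]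
  push_cast
  ring

theorem chiralSum_leadSym (hm : 0 < m) (hγγ : CliffordRel γ) (ξ : (Fin (2 * m) → ℝ) → ℝ)
    (q : Fin (2 * m) → ℝ) :
    chiralSum N L γ q (freeAdj M r γ ((leadSym r Q A γ ^ m) (leadSource ξ))) =
      (spacing L N : ℂ) ^ (2 * m) * (-4 * (wilsonMass q : ℂ)) *
        ((-Complex.I * Q) ^ m * (-Complex.I) ^ m) * (momentumFactor M r (spacing L N) q : ℂ) *
          ∑ x : Site (2 * m) N, ((ξ (position L N x) * epsilonF A (position L N x) : ℝ) : ℂ) := by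
  rw [chiralSum_apply, Finset.mul_sum]
  exact Finset.sum_congr rfl fun x _ => trace_leadSym hm hγγ ξ _ q _

variable [NeZero N]

/-- The leading terms add up to the anomaly. -/
theorem sum_leading (hm : 0 < m) (hL : 0 < L) (hM : 0 < M) (hr : 0 < r) (hγγ : CliffordRel γ)
    (ξ : (Fin (2 * m) → ℝ) → ℝ) :
    Complex.I * ((r : ℂ) / (2 * (spacing L N : ℂ))) * (((N : ℂ) ^ (2 * m))⁻¹ *
      ∑ k : Site (2 * m) N, (-1) ^ m *
        ((freeSq M r (spacing L N) (mode L N k) : ℂ)⁻¹) ^ (m + 1) * (spacing L N : ℂ) *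
          chiralSum N L γ (mode L N k) (freeAdj M r γ ((leadSym r Q A γ ^ m) (leadSource ξ)))) =
    Complex.I * (kappa m L M r N : ℂ) * (Q : ℂ) ^ m * (spacing L N : ℂ) ^ (2 * m) *
      ∑ x : Site (2 * m) N, ((ξ (position L N x) * epsilonF A (position L N x) : ℝ) : ℂ) := by
  have hN : (N : ℂ) ≠ 0 := Nat.cast_ne_zero.mpr (NeZero.ne N)
  have hL' : (L : ℂ) ≠ 0 := Complex.ofReal_ne_zero.mpr hL.ne'
  have ha : (spacing L N : ℂ) ≠ 0 := Complex.ofReal_ne_zero.mpr (spacing_pos L hL).ne'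
  have h1 : ((N : ℂ) ^ (2 * m))⁻¹ = (spacing L N : ℂ) ^ (2 * m) / (L : ℂ) ^ (2 * m) := by
    rw [spacing]
    push_cast
    rw [div_pow]
    field_simp
  -- The signs of the Neumann series, of the curvature and of the chiral trace multiply to Q^m, with
  -- no stray power of i.
  have h2 : (-1 : ℂ) ^ m * ((-Complex.I * Q) ^ m * (-Complex.I) ^ m) = (Q : ℂ) ^ m := by
    rw [← mul_pow, ← mul_pow]
    congr 1
    linear_combination -(Q : ℂ) * Complex.I_mul_I
  simp only [chiralSum_leadSym hm hγγ]
  generalize (∑ x : Site (2 * m) N,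
    ((ξ (position L N x) * epsilonF A (position L N x) : ℝ) : ℂ)) = S
  rw [kappa, h1]
  push_cast
  simp only [Finset.mul_sum, Finset.sum_mul]
  refine Finset.sum_congr rfl fun k _ => ?_
  rw [momentumG_eq hr, ← h2]
  have hf : (freeSq M r (spacing L N) (mode L N k) : ℂ) ≠ 0 := by
    rw [← rho_sq]
    exact Complex.ofReal_ne_zero.mpr
      (pow_ne_zero 2 (rho_pos hM hr (spacing_pos L hL) _).ne')
  change _ = Complex.I * (1 / (L : ℂ) ^ (2 * m) * ((-2 * r * spacing L N ^ (2 * m) *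
    wilsonMass (mode L N k) * momentumFactor M r (spacing L N) (mode L N k) /
      freeSq M r (spacing L N) (mode L N k) ^ (m + 1) : ℝ) : ℂ)) * _ * _ * _
  push_cast
  rw [inv_pow]
  field_simp
  ring

end Leading

/-! ### Summing the errors over the momenta -/

section Limit

/-- Jordan's inequality sin y ≥ 2y/π holds on the left half of (0, π); on the right half, reflect y
↦ π - y, which reverses the index. Adding both bounds avoids a case distinction later. -/
theorem inv_sin_le {N : ℕ} (j : Fin N) :
    0 < Real.sin ((2 * ((j : ℕ) : ℝ) + 1) * Real.pi / (2 * N)) ∧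
    1 / Real.sin ((2 * ((j : ℕ) : ℝ) + 1) * Real.pi / (2 * N)) ≤
      N * (1 / (((j : ℕ) : ℝ) + 1) + 1 / ((((Fin.rev j : Fin N) : ℕ) : ℝ) + 1)) := by
  have hN : (0 : ℝ) < N := Nat.cast_pos.mpr j.pos
  have hrev : (((Fin.rev j : Fin N) : ℕ) : ℝ) = N - 1 - ((j : ℕ) : ℝ) := by
    have h := Fin.val_rev j
    have hj := j.2
    have : ((Fin.rev j : Fin N) : ℕ) + (j + 1) = N := by omega
    have h2 : ((((Fin.rev j : Fin N) : ℕ) : ℝ)) + (((j : ℕ) : ℝ) + 1) = N := by exact_mod_cast this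
    linarith
  have hj0 : (0 : ℝ) ≤ ((j : ℕ) : ℝ) := Nat.cast_nonneg _
  have hr0 : (0 : ℝ) ≤ (((Fin.rev j : Fin N) : ℕ) : ℝ) := Nat.cast_nonneg _
  have low : ∀ t : ℝ, 0 ≤ t → (2 * t + 1) * Real.pi / (2 * N) ≤ Real.pi / 2 →
      (2 * t + 1) / N ≤ Real.sin ((2 * t + 1) * Real.pi / (2 * N)) := by
    intro t ht h
    have := Real.mul_le_sin (by positivity) h
    refine le_trans (le_of_eq ?_) this
    field_simp
  have fin : ∀ t u : ℝ, 0 ≤ t → 0 ≤ u → ∀ s : ℝ, (2 * t + 1) / N ≤ s →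
      0 < s ∧ 1 / s ≤ N * (1 / (t + 1) + 1 / (u + 1)) := by
    intro t u ht hu s hs
    have h0 : 0 < (2 * t + 1) / N := by positivity
    refine ⟨h0.trans_le hs, (one_div_le_one_div_of_le h0 hs).trans ?_⟩
    rw [one_div_div, div_eq_mul_one_div]
    refine mul_le_mul_of_nonneg_left ?_ hN.le
    have h1 : 1 / (2 * t + 1) ≤ 1 / (t + 1) := one_div_le_one_div_of_le (by linarith) (by linarith)
    have h2 : 0 ≤ 1 / (u + 1) := by positivity
    linarith
  rcases le_total ((2 * ((j : ℕ) : ℝ) + 1) * Real.pi / (2 * N)) (Real.pi / 2) with h | h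
  · exact fin _ _ hj0 hr0 _ (low _ hj0 h)
  · have e : Real.pi - (2 * ((j : ℕ) : ℝ) + 1) * Real.pi / (2 * N) =
        (2 * (((Fin.rev j : Fin N) : ℕ) : ℝ) + 1) * Real.pi / (2 * N) := by
      rw [hrev]
      field_simp
      ring
    rw [← Real.sin_pi_sub, e, add_comm (1 / _)]
    refine fin _ _ hr0 hj0 _ (low _ hr0 ?_)
    rw [← e]
    linarith

theorem sum_inv_sin_bound (N : ℕ) : ∑ j : Fin N,
    (N : ℝ) * (1 / (((j : ℕ) : ℝ) + 1) + 1 / ((((Fin.rev j : Fin N) : ℕ) : ℝ) + 1)) =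
      2 * N * (harmonic N : ℝ) := by
  have h1 : ∑ j : Fin N, 1 / (((j : ℕ) : ℝ) + 1) = (harmonic N : ℝ) := by
    rw [harmonic, Fin.sum_univ_eq_sum_range (fun j => 1 / ((j : ℝ) + 1))]
    push_cast
    simp
  have h2 : ∑ j : Fin N, 1 / ((((Fin.rev j : Fin N) : ℕ) : ℝ) + 1) = (harmonic N : ℝ) := by
    rw [← h1]
    exact Equiv.sum_comp Fin.revPerm fun j : Fin N => 1 / (((j : ℕ) : ℝ) + 1)
  rw [← Finset.mul_sum, Finset.sum_add_distrib, h1, h2]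
  ring

variable {m N : ℕ} [NeZero N] {L M r : ℝ}

/-- From 1 - cos q_μ = 2 sin²(q_μ/2), ρ dominates min(1, r) sin(q_μ/2) in every direction μ
separately. -/
theorem inv_rho_le (hL : 0 < L) (hM : 0 < M) (hr : 0 < r) (k : Site (2 * m) N) (μ : Fin (2 * m)) :
    1 / rho M r (spacing L N) (mode L N k) ≤ 1 / min 1 r *
      (N * (1 / (((k μ : ℕ) : ℝ) + 1) + 1 / ((((Fin.rev (k μ) : Fin N) : ℕ) : ℝ) + 1))) := by
  obtain ⟨h1, h2⟩ := inv_sin_le (k μ)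
  set y := (2 * ((k μ : ℕ) : ℝ) + 1) * Real.pi / (2 * N) with hy
  have hs : 0 < min 1 r := lt_min one_pos hr
  have h3 := one_sub_cos_le_rho_sq hM hr (spacing_pos (N := N) L hL) (mode L N k) μ
  have h4 : mode L N k μ = 2 * y := by
    rw [mode_eq N hL, hy]
    field_simp
  have h5 : 1 - Real.cos (mode L N k μ) = 2 * Real.sin y ^ 2 := by
    rw [h4, Real.cos_two_mul, ← Real.sin_sq_add_cos_sq y]
    linarith [Real.sin_sq_add_cos_sq y]
  have h6 : min 1 r ^ 2 ≤ min 1 (r ^ 2) := by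
    refine le_min ?_ ?_
    · exact pow_le_one₀ hs.le (min_le_left _ _)
    · exact pow_le_pow_left₀ hs.le (min_le_right _ _) 2
  have h7 : min 1 r * Real.sin y ≤ rho M r (spacing L N) (mode L N k) := by
    refine le_of_sq_le_sq ?_ (rho_nonneg _ _ _ _)
    rw [h5] at h3
    nlinarith [mul_le_mul_of_nonneg_right h6 (sq_nonneg (Real.sin y)), sq_nonneg (min 1 r * Real.sin y)]
  calc 1 / rho M r (spacing L N) (mode L N k) ≤ 1 / (min 1 r * Real.sin y) :=
        one_div_le_one_div_of_le (mul_pos hs h1) h7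
    _ = 1 / min 1 r * (1 / Real.sin y) := by rw [one_div_mul_one_div]
    _ ≤ _ := mul_le_mul_of_nonneg_left h2 (by positivity)

/-- The sum over the lattice momenta of the error terms. -/
theorem sum_error_le (hL : 0 < L) (hM : 0 < M) (hr : 0 < r) :
    ∑ k : Site (2 * m) N, spacing L N ^ (2 * m + 1) /
      rho M r (spacing L N) (mode L N k) ^ (2 * m) ≤
        L ^ (2 * m + 1) * (2 / min 1 r) ^ (2 * m) * ((1 + Real.log N) ^ (2 * m) / N) := by
  have hN : (0 : ℝ) < N := Nat.cast_pos.mpr (NeZero.pos N)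
  have hs : 0 < min 1 r := lt_min one_pos hr
  have ha := spacing_pos (N := N) L hL
  set h : Fin N → ℝ := fun j => 1 / min 1 r *
    (N * (1 / (((j : ℕ) : ℝ) + 1) + 1 / ((((Fin.rev j : Fin N) : ℕ) : ℝ) + 1))) with hh
  have h1 : ∀ k : Site (2 * m) N, spacing L N ^ (2 * m + 1) /
      rho M r (spacing L N) (mode L N k) ^ (2 * m) ≤
        spacing L N ^ (2 * m + 1) * ∏ μ, h (k μ) := by
    intro k
    have hρ := rho_pos hM hr ha (mode L N k)
    rw [div_eq_mul_one_div, ← one_div_pow]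
    refine mul_le_mul_of_nonneg_left ?_ (by positivity)
    -- One power of 1/ρ is spent on each of the 2m directions, so the sum over momenta factorizes
    -- into equal one-dimensional sums.
    calc (1 / rho M r (spacing L N) (mode L N k)) ^ (2 * m) =
        ∏ _ : Fin (2 * m), 1 / rho M r (spacing L N) (mode L N k) := by simp
      _ ≤ _ := Finset.prod_le_prod (fun _ _ => by positivity)
        fun μ _ => inv_rho_le hL hM hr k μ
  refine (Finset.sum_le_sum fun k _ => h1 k).trans ?_
  have h2 := Finset.prod_univ_sum (fun _ : Fin (2 * m) => (Finset.univ : Finset (Fin N)))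
    (fun _ j => h j)
  rw [Fintype.piFinset_univ] at h2
  rw [← Finset.mul_sum, ← h2, Finset.prod_const, Finset.card_univ, Fintype.card_fin, hh,
    ← Finset.mul_sum, sum_inv_sin_bound]
  have h3 : (0 : ℝ) ≤ (harmonic N : ℝ) := by
    rw [harmonic]
    push_cast
    exact Finset.sum_nonneg fun _ _ => by positivity
  have h4 := pow_le_pow_left₀ h3 (harmonic_le_one_add_log N) (2 * m)
  calc spacing L N ^ (2 * m + 1) * (1 / min 1 r * (2 * N * (harmonic N : ℝ))) ^ (2 * m) =
      L ^ (2 * m + 1) * (2 / min 1 r) ^ (2 * m) * ((harmonic N : ℝ) ^ (2 * m) / N) := by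
        rw [spacing, div_pow, show 1 / min 1 r * (2 * N * (harmonic N : ℝ)) =
          N * (2 / min 1 r * (harmonic N : ℝ)) by ring, mul_pow, mul_pow, pow_succ (N : ℝ)]
        field_simp
    _ ≤ _ := mul_le_mul_of_nonneg_left (div_le_div_of_nonneg_right h4 hN.le) (by positivity)

/-- Writing 1 + log N = log(eN) reduces this to (log y)^n / y → 0. -/
theorem tendsto_log_pow_div (n : ℕ) : Filter.Tendsto
    (fun N : ℕ => (1 + Real.log ((N + 1 : ℕ) : ℝ)) ^ n / ((N + 1 : ℕ) : ℝ)) Filter.atTop (nhds 0) := by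
  have h1 := (Real.isLittleO_pow_log_id_atTop (n := n)).tendsto_div_nhds_zero
  have h2 : Filter.Tendsto (fun N : ℕ => Real.exp 1 * ((N + 1 : ℕ) : ℝ)) Filter.atTop
      Filter.atTop :=
    ((tendsto_natCast_atTop_atTop (R := ℝ)).comp (Filter.tendsto_add_atTop_nat 1)).const_mul_atTop
      (Real.exp_pos 1)
  have h3 := (h1.comp h2).const_mul (Real.exp 1)
  rw [mul_zero] at h3
  refine h3.congr fun N => ?_
  have hN : ((N + 1 : ℕ) : ℝ) ≠ 0 := Nat.cast_ne_zero.mpr N.succ_ne_zero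
  simp only [Function.comp_apply, id_eq]
  rw [Real.log_mul (Real.exp_pos 1).ne' hN, Real.log_exp]
  field_simp

end Limit

/-! ### The quantitative bound and the limit -/

section Main

variable {m : ℕ} {L M r Q : ℝ} {A : Fin (2 * m) → (Fin (2 * m) → ℝ) → ℝ}
  {γ : Fin (2 * m) → Matrix (Fin (2 ^ m)) (Fin (2 ^ m)) ℂ}

/-- Combine the Ward identity with the mode expansion of the trace. The prefactor r/(2a) and the
normalization N^{-d} cancel the factor N^d a of the single-mode bound, leaving ∑ a^{d+1}/ρ^d. -/
theorem exists_expectation_bound (hm : 0 < m) (hL : 0 < L) (hM : 0 < M) (hr : 0 < r)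
    (hγ : ∀ μ, (γ μ).conjTranspose = -γ μ) (hγγ : CliffordRel γ)
    (hA : ∀ μ, SmoothOnTorus L (A μ)) {ξ : (Fin (2 * m) → ℝ) → ℝ} (hξ : SmoothOnTorus L ξ) :
    ∃ C : ℝ, ∀ (N : ℕ) [NeZero N],
      ‖expectation L M r Q A γ N (smearedDivergence L M Q A γ ξ N) -
        Complex.I * (kappa m L M r N : ℂ) * (Q : ℂ) ^ m * (spacing L N : ℂ) ^ (2 * m) *
          ∑ x : Site (2 * m) N,
            ((ξ (position L N x) * epsilonF A (position L N x) : ℝ) : ℂ)‖ ≤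
      C * ∑ k : Site (2 * m) N, spacing L N ^ (2 * m + 1) /
        rho M r (spacing L N) (mode L N k) ^ (2 * m) := by
  obtain ⟨C, hC⟩ := exists_mode_bound (Q := Q) hL hM hr hγ hγγ hA hξ
  refine ⟨r / 2 * C, fun N _ => ?_⟩
  have hN : (N : ℂ) ^ (2 * m) ≠ 0 := pow_ne_zero _ (Nat.cast_ne_zero.mpr (NeZero.ne N))
  have hN' : (0 : ℝ) < (N : ℝ) ^ (2 * m) := pow_pos (Nat.cast_pos.mpr (NeZero.pos N)) _
  have ha := spacing_pos (N := N) L hL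
  rw [expectation_smearedDivergence L M r Q A γ hm hL hγγ
    (actionOp_isUnit_det L M r Q A γ hL hM hr hγ), ← sum_leading (N := N) hm hL hM hr hγγ ξ]
  set O := (wilsonOp L Q A N * Matrix.diagonal (fun x => ((ξ (position L N x) : ℝ) : ℂ)) +
    Matrix.diagonal (fun x => ((ξ (position L N x) : ℝ) : ℂ)) * wilsonOp L Q A N) ⊗ₖ
      chirality γ with hO
  have h1 := trace_eq_sum_mode (N := N) hL ((actionOp L M r Q A γ N)⁻¹ * O)
  have h2 : ∀ k : Site (2 * m) N, (actionOp L M r Q A γ N)⁻¹ * O *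
      waveMap L N (mode L N k) (scalarField fun _ => 1) = (actionOp L M r Q A γ N)⁻¹ *
        (waveMap L N (mode L N k) (sourceSym Q A ξ) * chirality γ) := by
    intro k
    rw [Matrix.mul_assoc, hO, source_mul_waveMap_one hA hξ (antiPeriodic_mode N hL k)]
  simp only [h2] at h1
  have h3 : ((actionOp L M r Q A γ N)⁻¹ * O).trace = ((N : ℂ) ^ (2 * m))⁻¹ *
      ∑ k : Site (2 * m) N, ((waveMap L N (mode L N k) (scalarField fun _ => 1))ᴴ *
        ((actionOp L M r Q A γ N)⁻¹ *
          (waveMap L N (mode L N k) (sourceSym Q A ξ) * chirality γ))).trace := by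
    rw [← h1, inv_mul_cancel_left₀ hN]
  rw [h3, ← mul_sub, ← mul_sub, ← Finset.sum_sub_distrib, norm_mul, norm_mul, norm_mul,
    Complex.norm_I, one_mul, norm_inv, norm_pow, Complex.norm_natCast, norm_div, norm_mul,
    Complex.norm_real, Complex.norm_real, Complex.norm_ofNat, Real.norm_of_nonneg hr.le,
    Real.norm_of_nonneg ha.le]
  have h4 := (norm_sum_le (Finset.univ : Finset (Site (2 * m) N)) _).trans
    (Finset.sum_le_sum fun k _ => hC N (mode L N k) (antiPeriodic_mode N hL k))
  rw [← Finset.mul_sum, ← Finset.mul_sum] at h4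
  refine (mul_le_mul_of_nonneg_left (mul_le_mul_of_nonneg_left h4 (by positivity))
    (by positivity)).trans (le_of_eq ?_)
  field_simp

end Main
end
end LatticeFermion

theorem proposition6p5 (m : ℕ) (hm : 0 < m) (L M r Q : ℝ) (hL : 0 < L) (hM : 0 < M) (hr : 0 < r)
    (γ : Fin (2 * m) → Matrix (Fin (2 ^ m)) (Fin (2 ^ m)) ℂ)
    (hγ : ∀ μ, (γ μ).conjTranspose = -γ μ)
    (hγγ : ∀ μ ν, γ μ * γ ν + γ ν * γ μ =
      if μ = ν then (-2 : ℂ) • (1 : Matrix (Fin (2 ^ m)) (Fin (2 ^ m)) ℂ) else 0)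
    (A : Fin (2 * m) → (Fin (2 * m) → ℝ) → ℝ) (hA : ∀ μ, LatticeFermion.SmoothOnTorus L (A μ))
    (ξ : (Fin (2 * m) → ℝ) → ℝ) (hξ : LatticeFermion.SmoothOnTorus L ξ) :
    -- the continuum limit `a → 0` runs through `a = L / N` with `N = n + 1`
    Filter.Tendsto
      (fun n : ℕ =>
        LatticeFermion.expectation L M r Q A γ (n + 1)
            (LatticeFermion.smearedDivergence L M Q A γ ξ (n + 1))
          - Complex.I * (LatticeFermion.kappa m L M r (n + 1) : ℂ) * (Q : ℂ) ^ m *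
            (LatticeFermion.spacing L (n + 1) : ℂ) ^ (2 * m) *
            ∑ x : LatticeFermion.Site (2 * m) (n + 1),
              ((ξ (LatticeFermion.position L (n + 1) x) *
                LatticeFermion.epsilonF A (LatticeFermion.position L (n + 1) x) : ℝ) : ℂ))
      Filter.atTop (nhds 0) := by
  obtain ⟨C, hC⟩ := LatticeFermion.exists_expectation_bound (Q := Q) hm hL hM hr hγ hγγ hA hξ
  have h1 := (LatticeFermion.tendsto_log_pow_div (2 * m)).const_mul
    (|C| * (L ^ (2 * m + 1) * (2 / min 1 r) ^ (2 * m)))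
  rw [mul_zero] at h1
  refine squeeze_zero_norm (fun n => ?_) h1
  have h2 := LatticeFermion.sum_error_le (m := m) (N := n + 1) hL hM hr
  have h3 : 0 ≤ ∑ k : LatticeFermion.Site (2 * m) (n + 1),
      LatticeFermion.spacing L (n + 1) ^ (2 * m + 1) /
        LatticeFermion.rho M r (LatticeFermion.spacing L (n + 1))
          (LatticeFermion.mode L (n + 1) k) ^ (2 * m) :=
    Finset.sum_nonneg fun k _ => div_nonneg
      (pow_nonneg (LatticeFermion.spacing_pos L hL).le _)
      (pow_nonneg (LatticeFermion.rho_nonneg _ _ _ _) _)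
  calc _ ≤ _ := hC (n + 1)
    -- The constant C is not known to be nonnegative, so |C| replaces it before the momentum sum is
    -- estimated.
    _ ≤ _ := mul_le_mul_of_nonneg_right (le_abs_self C) h3
    _ ≤ _ := mul_le_mul_of_nonneg_left h2 (abs_nonneg C)
    _ = _ := by ring
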